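/- **Theorem.** Let $\rho>\frac54$, $\frac12<\gamma<1$, $T>0$, and let $w\in C([0,T];\mathbb R)$, $w(0)=0$, be $(\rho,\gamma)$-irregular on $[0,T]$, that is, $$\sup_{a\in\mathbb R}\ \sup_{0\le r<t\le T}\ (1+a^2)^{\rho/2}\,\frac{1}{|t-r|^{\gamma}}\,\Big|\int_r^t e^{iaw(t')}\,dt'\Big|<\infty .$$ Consider on $\mathbb T=\mathbb R/2\pi\mathbb Z$ the modulated KdV equation $\partial_t u+\partial_x^3u\cdot\partial_t w=\partial_x u^2$, $u|_{t=0}=u_0$, where $u_0$ has mean zero. A solution in $C(J;H^s(\mathbb T))$, $s\ge0$, where $J=[0,\tau]$ or $J=[0,\infty)$, is a function $u\in C(J;H^s(\mathbb T))$ that satisfies, for all $t\in J$, in the sense of distributions on $\mathbb T$, $$u(t)=U^w(t)u_0+U^w(t)\int_0^t U^w(t')^{-1}\partial_x u^2(t')\,dt',\qquad U^w(t)=e^{-w(t)\partial_x^3}.$$ Functions are complex-valued unless stated otherwise. (i) *Unconditional well-posedness.* Let $s\ge0$. The equation is unconditionally locally well-posed in $H^s(\mathbb T)$: for every mean-zero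 $u_0\in H^s(\mathbb T)$ there are $\tau\in(0,T]$ and a solution $u\in C([0,\tau];H^s(\mathbb T))$, real-valued if $u_0$ is; and, for every $\tau\in(0,T]$, there is at most one solution in the entire class $C([0,\tau];H^s(\mathbb T))$. If, in addition, $w$ is defined on $\mathbb R_+$ and $(\rho,\gamma)$-irregular on $[0,T']$ for every $T'>0$, then the equation is unconditionally globally well-posed in $H^s(\mathbb T)$: for every real-valued mean-zero $u_0\in H^s(\mathbb T)$ there is a unique solution in the entire class $C(\mathbb R_+;H^s(\mathbb T))$, and it is real-valued. (ii) *Nonlinear smoothing.* Let $0\le s<s_0<s+2\rho-\frac52$, let $u_0\in H^s(\mathbb T)$ have mean zero, let $\tau\in(0,T]$, and let $u\in C([0,\tau];H^s(\mathbb T))$ be the solution with $u|_{t=0}=u_0$ on $[0,\tau]$. Then $$u-e^{-w(t)\partial_x^3}u_0\in C([0,\tau];H^{s_0}(\mathbb T)).$$ -/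

import Mathlib

open Set Filter Topology MeasureTheory

noncomputable section

namespace ModulatedKdV

/-! ### The modulation -/

/-- `Φ^w_{t,r}(a) = ∫_r^t exp(i a w(t')) dt'`. -/
def occupation (w : ℝ → ℝ) (t r a : ℝ) : ℂ :=
  ∫ t' in r..t, Complex.exp (Complex.I * ((a * w t' : ℝ) : ℂ))

/-- `w ∈ C([0,T]; ℝ)` is `(ρ,γ)`-irregular on `[0,T]`: the supremum over `a ∈ ℝ` and
`0 ≤ r < t ≤ T` of `⟨a⟩^ρ |Φ^w_{t,r}(a)| / |t - r|^γ` is finite, with `⟨a⟩ = (1 + a²)^{1/2}`. -/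
def IsIrregular (ρ γ T : ℝ) (w : ℝ → ℝ) : Prop :=
  ContinuousOn w (Icc 0 T) ∧
    ∃ C : ℝ, ∀ a r t : ℝ, 0 ≤ r → r < t → t ≤ T →
      (1 + a ^ 2) ^ (ρ / 2) * (‖occupation w t r a‖ / |t - r| ^ γ) ≤ C

/-- `w` is `(ρ,γ)`-irregular on `ℝ₊`: it is so on `[0,T]` for each finite `T > 0`. -/
def IsIrregularOnHalfLine (ρ γ : ℝ) (w : ℝ → ℝ) : Prop :=
  ∀ T : ℝ, 0 < T → IsIrregular ρ γ T w

/-! ### Functions on the circle `𝕋 = ℝ / 2πℤ` with normalized Lebesgue measure -/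

instance instFactTwoPiPos : Fact (0 < 2 * Real.pi) := ⟨Real.two_pi_pos⟩

/-- The circle `𝕋 = ℝ / 2πℤ`. -/
abbrev Torus : Type := AddCircle (2 * Real.pi)

/-- `L²(𝕋; ℂ)` for the normalized Lebesgue measure. The Fourier coefficients
`fourierCoeff f n` are `(2π)⁻¹ ∫_0^{2π} f(x) e^{-inx} dx`. -/
abbrev L2 : Type := Lp ℂ 2 (AddCircle.haarAddCircle : Measure Torus)

/-- `f ∈ H^s(𝕋)`, for `f ∈ L²(𝕋)` (so this is all of `H^s(𝕋)` when `s ≥ 0`). -/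
def MemSobolev (s : ℝ) (f : L2) : Prop :=
  Summable fun n : ℤ => (1 + (n : ℝ) ^ 2) ^ s * ‖fourierCoeff f n‖ ^ 2

/-- The norm of `H^s(𝕋)`, for `f ∈ H^s(𝕋)`. -/
def sobolevNorm (s : ℝ) (f : L2) : ℝ :=
  Real.sqrt (∑' n : ℤ, (1 + (n : ℝ) ^ 2) ^ s * ‖fourierCoeff f n‖ ^ 2)

/-- `u ∈ C(J; H^s(𝕋))` for a set `J` of times. -/
def ContinuousInSobolev (s : ℝ) (J : Set ℝ) (u : ℝ → L2) : Prop :=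
  (∀ t ∈ J, MemSobolev s (u t)) ∧
    ∀ t ∈ J, Tendsto (fun t' => sobolevNorm s (u t' - u t)) (𝓝[J] t) (𝓝 0)

/-- The spatial mean of `f` vanishes. -/
def MeanZero (f : L2) : Prop := ∫ x, f x ∂(AddCircle.haarAddCircle : Measure Torus) = 0

/-- `f` is real-valued. -/
def IsRealValued (f : L2) : Prop :=
  ∀ᵐ x ∂(AddCircle.haarAddCircle : Measure Torus), (f x).im = 0

/-! ### The linear propagator -/

/-- The Fourier multiplier of `e^{-a ∂ₓ³}`: as `∂ₓ³` has symbol `(in)³ = -i n³`, it is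
`e^{i n³ a}`. -/
def airySymbol (a : ℝ) (n : ℤ) : ℂ :=
  Complex.exp (Complex.I * (((n : ℝ) ^ 3 * a : ℝ) : ℂ))

theorem norm_airySymbol (a : ℝ) (n : ℤ) : ‖airySymbol a n‖ = 1 := by
  rw [airySymbol, mul_comm]
  exact Complex.norm_exp_ofReal_mul_I _

theorem memℓp_airySymbol_mul (a : ℝ) (f : L2) :
    Memℓp (fun n : ℤ => airySymbol a n * fourierBasis.repr f n) 2 := by
  have h := lp.memℓp (fourierBasis.repr f)
  rw [memℓp_gen_iff (by norm_num)] at h ⊢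
  simpa [norm_airySymbol] using h

/-- The operator `e^{-a ∂ₓ³}` on `L²(𝕋)`. -/
def airy (a : ℝ) (f : L2) : L2 :=
  fourierBasis.repr.symm
    (⟨fun n : ℤ => airySymbol a n * fourierBasis.repr f n, memℓp_airySymbol_mul a f⟩ :
      lp (fun _ : ℤ => ℂ) 2)

theorem fourierCoeff_airy (a : ℝ) (f : L2) (n : ℤ) :
    fourierCoeff (airy a f) n = airySymbol a n * fourierCoeff f n := by
  rw [← fourierBasis_repr, ← fourierBasis_repr, airy, LinearIsometryEquiv.apply_symm_apply]

/-! ### The modulated KdV equation `∂ₜu + ∂ₓ³u · ∂ₜw = ∂ₓ(u²)` -/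

/-- The Fourier coefficients of the distribution `∂ₓ(f²)`, for `f ∈ L²(𝕋)`
(so that `f² ∈ L¹(𝕋)`). -/
def nonlinearity (f : L2) (n : ℤ) : ℂ :=
  Complex.I * (n : ℂ) * fourierCoeff (fun x => f x ^ 2) n

/-- `u` is a solution in `C(J; H^s(𝕋))`, `s ≥ 0`, to the modulated KdV equation with initial data
`u₀`, i.e. to the Duhamel formulation
`u(t) = U(t) u₀ + U(t) ∫_0^t U(t')⁻¹ ∂ₓ(u(t')²) dt'`, `t ∈ J`, with `U(t) = e^{-w(t) ∂ₓ³}`.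
Here `J` is an interval containing `0` as left endpoint. As `∂ₓ(u²)` is continuous in time with
values in a Sobolev space of negative order only, the identity is one of distributions on `𝕋`; it
is tested against the characters `e^{-inx}`. -/
def IsSolution (w : ℝ → ℝ) (s : ℝ) (u₀ : L2) (J : Set ℝ) (u : ℝ → L2) : Prop :=
  ContinuousInSobolev s J u ∧
    ∀ t ∈ J, ∀ n : ℤ,
      fourierCoeff (u t) n =
        airySymbol (w t) n * fourierCoeff u₀ n +
          airySymbol (w t) n *
            ∫ t' in (0 : ℝ)..t, (airySymbol (w t') n)⁻¹ * nonlinearity (u t') n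

/-- Unconditional local well-posedness in `H^s(𝕋)` of the modulated KdV equation, for mean-zero
data and a modulation given on `[0,T]`: for each initial condition there is a solution in
`C([0,τ]; H^s(𝕋))` for some `τ > 0`, real-valued if the initial condition is, and, on any time
interval `[0,τ]`, solutions are unique in the entire class `C([0,τ]; H^s(𝕋))`. -/
def UnconditionallyLocallyWellPosed (w : ℝ → ℝ) (T s : ℝ) : Prop :=
  ∀ u₀ : L2, MemSobolev s u₀ → MeanZero u₀ →
    (∃ τ : ℝ, 0 < τ ∧ τ ≤ T ∧ ∃ u : ℝ → L2, IsSolution w s u₀ (Icc 0 τ) u ∧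
      (IsRealValued u₀ → ∀ t ∈ Icc 0 τ, IsRealValued (u t))) ∧
    ∀ τ : ℝ, 0 < τ → τ ≤ T → ∀ u v : ℝ → L2,
      IsSolution w s u₀ (Icc 0 τ) u → IsSolution w s u₀ (Icc 0 τ) v → EqOn u v (Icc 0 τ)

/-- Unconditional global well-posedness in `H^s(𝕋)` of the modulated KdV equation, for real-valued
mean-zero data: for each initial condition there is a real-valued solution in `C(ℝ₊; H^s(𝕋))`, and
solutions are unique in the entire class `C(ℝ₊; H^s(𝕋))`. -/
def UnconditionallyGloballyWellPosed (w : ℝ → ℝ) (s : ℝ) : Prop :=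
  ∀ u₀ : L2, MemSobolev s u₀ → MeanZero u₀ → IsRealValued u₀ →
    ∃ u : ℝ → L2, IsSolution w s u₀ (Ici 0) u ∧ (∀ t ∈ Ici (0 : ℝ), IsRealValued (u t)) ∧
      ∀ v : ℝ → L2, IsSolution w s u₀ (Ici 0) v → EqOn v u (Ici 0)

end ModulatedKdV

end

open ModulatedKdV

noncomputable section

namespace ModulatedKdV

/-! Write `u(t) = U^w(t) v(t)`. Since `n³ - m³ - (n-m)³ = 3nm(n-m)`, the coefficients of `v` satisfy
`vₙ' = i n ∑ₘ exp(-3i nm(n-m) w) vₘ vₙ₋ₘ` (`inv_airySymbol_mul_nonlinearity`). Mean zero is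
preserved, so only interactions with `n`, `m`, `n - m` all nonzero occur, and irregularity bounds
the integral of the phase over `[r,t]` by a constant times `|nm(n-m)|^{-ρ} (t-r)^γ`.

In each interaction one integrates by parts in time: the phase is replaced by its small primitive
and the derivative falls on `vₘ` or `vₙ₋ₘ`. By Cauchy–Schwarz `|vₘ'| ≤ |m| ‖v‖²` for every solution
that is merely continuous in `L²`. The cost is thus `|n|` from `∂ₓ` and one factor `|m|` or `|n-m|`
from the time derivative, against `|nm(n-m)|^{-ρ}`. With `σ` extra derivatives on the output, what
remains is dominated by the kernel `|n|^{-α} |n-m|^{-α} |m|^{-1-α}` or its reflection `m ↦ n - m`,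
where `α = ρ - 1 - σ/2`. Two applications of Cauchy–Schwarz bound it on `ℓ²` once `∑ |n|^{-4α} < ∞`,
that is, `σ < 2ρ - 5/2`. This is `PhaseDecay.exists_integral_bil_bound`, the source of both the
threshold `ρ > 5/4` (`σ = 0`) and the smoothing range.

The estimate uses only what every solution in `C([0,τ]; L²)` satisfies, so no auxiliary space is
needed: on a short interval any bound for the difference of two solutions can be halved
(`IsMild.unique`). The same contraction gives existence in `L²`, on a time depending on the `L²`
norm (`PhaseDecay.exists_isMild`). Taking `σ > 0` gives smoothing, and repeated smoothing propagates
`H^s` regularity of the data (`IsSolution.persistence`).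

For real data the `L²` norm is conserved (`IsMild.norm_eq`): the same integration by parts makes the
sum of `n vₘ vₙ₋ₘ v₋ₙ`, integrated against the phase, absolutely convergent over `(n,m)`, and cyclic
permutation of `m, n-m, -n` makes it vanish. Local solutions are then continued with a fixed step.
-/

/-! ### Square-summable sequences -/

/-- `∑ |dₙ|² ≤ A²`. -/
def SqSumLe (d : ℤ → ℝ) (A : ℝ) : Prop :=
  0 ≤ A ∧ ∀ F : Finset ℤ, ∑ n ∈ F, d n ^ 2 ≤ A ^ 2

theorem SqSumLe.mono {d e : ℤ → ℝ} {A : ℝ} (h : SqSumLe e A) (hde : ∀ n, |d n| ≤ |e n|) :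
    SqSumLe d A :=
  ⟨h.1, fun F => (Finset.sum_le_sum fun n _ => sq_le_sq.2 (hde n)).trans (h.2 F)⟩

theorem SqSumLe.mono_right {d : ℤ → ℝ} {A B : ℝ} (h : SqSumLe d A) (hAB : A ≤ B) : SqSumLe d B :=
  ⟨h.1.trans hAB, fun F => (h.2 F).trans (pow_le_pow_left₀ h.1 hAB 2)⟩

theorem SqSumLe.abs_le {d : ℤ → ℝ} {A : ℝ} (h : SqSumLe d A) (n : ℤ) : |d n| ≤ A := by
  have := h.2 {n}
  rw [Finset.sum_singleton] at this
  exact abs_le_of_sq_le_sq this h.1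

theorem SqSumLe.const_mul {d : ℤ → ℝ} {A c : ℝ} (h : SqSumLe d A) (hc : 0 ≤ c) :
    SqSumLe (fun n => c * d n) (c * A) := by
  refine ⟨mul_nonneg hc h.1, fun F => ?_⟩
  simp_rw [mul_pow, ← Finset.mul_sum]
  exact mul_le_mul_of_nonneg_left (h.2 F) (sq_nonneg c)

theorem sum_mul_le_of_sq_le {ι : Type*} (F : Finset ι) {f g : ι → ℝ} {A B : ℝ} (hA : 0 ≤ A)
    (hB : 0 ≤ B) (hf : ∑ i ∈ F, f i ^ 2 ≤ A ^ 2) (hg : ∑ i ∈ F, g i ^ 2 ≤ B ^ 2) :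
    ∑ i ∈ F, f i * g i ≤ A * B := by
  refine le_of_sq_le_sq ?_ (mul_nonneg hA hB)
  calc (∑ i ∈ F, f i * g i) ^ 2 ≤ (∑ i ∈ F, f i ^ 2) * ∑ i ∈ F, g i ^ 2 :=
        Finset.sum_mul_sq_le_sq_mul_sq F f g
    _ ≤ A ^ 2 * B ^ 2 := mul_le_mul hf hg (Finset.sum_nonneg fun _ _ => sq_nonneg _) (sq_nonneg A)
    _ = (A * B) ^ 2 := by ring

theorem SqSumLe.add {d e : ℤ → ℝ} {A B : ℝ} (hd : SqSumLe d A) (he : SqSumLe e B) :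
    SqSumLe (fun n => d n + e n) (A + B) := by
  refine ⟨add_nonneg hd.1 he.1, fun F => ?_⟩
  have h := sum_mul_le_of_sq_le F hd.1 he.1 (hd.2 F) (he.2 F)
  have : ∑ n ∈ F, (d n + e n) ^ 2
      = ∑ n ∈ F, d n ^ 2 + 2 * ∑ n ∈ F, d n * e n + ∑ n ∈ F, e n ^ 2 := by
    rw [Finset.mul_sum, ← Finset.sum_add_distrib, ← Finset.sum_add_distrib]
    exact Finset.sum_congr rfl fun n _ => by ring
  rw [this]
  nlinarith [hd.2 F, he.2 F]

theorem SqSumLe.comp_injective {d : ℤ → ℝ} {A : ℝ} (h : SqSumLe d A) {e : ℤ → ℤ}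
    (he : Function.Injective e) : SqSumLe (fun n => d (e n)) A := by
  refine ⟨h.1, fun F => ?_⟩
  have := h.2 (F.map ⟨e, he⟩)
  rwa [Finset.sum_map] at this

theorem SqSumLe.summable {d : ℤ → ℝ} {A : ℝ} (h : SqSumLe d A) : Summable fun n => d n ^ 2 :=
  summable_of_sum_le (fun _ => sq_nonneg _) h.2

/-- Cauchy–Schwarz in time, read off from the nonnegative integral of `((t - r) f - ∫ f)²`. -/
theorem sq_integral_le {f : ℝ → ℝ} {r t : ℝ} (hrt : r ≤ t) (hf : ContinuousOn f (Icc r t)) :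
    (∫ s in r..t, f s) ^ 2 ≤ (t - r) * ∫ s in r..t, f s ^ 2 := by
  have hu : uIcc r t = Icc r t := uIcc_of_le hrt
  have hi : IntervalIntegrable f volume r t := (hu ▸ hf).intervalIntegrable
  have hi2 : IntervalIntegrable (fun s => f s ^ 2) volume r t :=
    (hu ▸ hf.pow 2 : ContinuousOn _ (uIcc r t)).intervalIntegrable
  set c := ∫ s in r..t, f s with hc
  have h : 0 ≤ ∫ s in r..t, ((t - r) * f s - c) ^ 2 :=
    intervalIntegral.integral_nonneg hrt fun s _ => sq_nonneg _
  have h2 : ∫ s in r..t, ((t - r) * f s - c) ^ 2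
      = (t - r) * ((t - r) * ∫ s in r..t, f s ^ 2) - (t - r) * c ^ 2 := by
    have : ∀ s, ((t - r) * f s - c) ^ 2
        = (t - r) ^ 2 * f s ^ 2 - 2 * (t - r) * c * f s + c ^ 2 := fun s => by ring
    simp_rw [this]
    rw [intervalIntegral.integral_add ((hi2.const_mul _).sub (hi.const_mul _)) (by simp),
      intervalIntegral.integral_sub (hi2.const_mul _) (hi.const_mul _),
      intervalIntegral.integral_const_mul, intervalIntegral.integral_const_mul, ← hc,
      intervalIntegral.integral_const, smul_eq_mul]
    ring
  rcases hrt.eq_or_lt with rfl | hlt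
  · simp [hc]
  · rw [h2, ← mul_sub] at h
    have := nonneg_of_mul_nonneg_right h (sub_pos.2 hlt)
    linarith

theorem SqSumLe.integral {f : ℝ → ℤ → ℝ} {r t A : ℝ} (hrt : r ≤ t)
    (hf : ∀ n, ContinuousOn (fun s => f s n) (Icc r t)) (h : ∀ s ∈ Icc r t, SqSumLe (f s) A) :
    SqSumLe (fun n => ∫ s in r..t, f s n) ((t - r) * A) := by
  have hA : 0 ≤ A := (h r (left_mem_Icc.2 hrt)).1
  refine ⟨mul_nonneg (sub_nonneg.2 hrt) hA, fun F => ?_⟩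
  have hu : uIcc r t = Icc r t := uIcc_of_le hrt
  have hi : ∀ n ∈ F, IntervalIntegrable (fun s => f s n ^ 2) volume r t := fun n _ =>
    (hu ▸ (hf n).pow 2 : ContinuousOn _ (uIcc r t)).intervalIntegrable
  calc ∑ n ∈ F, (∫ s in r..t, f s n) ^ 2
      ≤ ∑ n ∈ F, (t - r) * ∫ s in r..t, f s n ^ 2 :=
        Finset.sum_le_sum fun n _ => sq_integral_le hrt (hf n)
    _ = (t - r) * ∫ s in r..t, ∑ n ∈ F, f s n ^ 2 := by
        rw [← Finset.mul_sum, intervalIntegral.integral_finsetSum hi]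
    _ ≤ (t - r) * ∫ _ in r..t, A ^ 2 := by
        refine mul_le_mul_of_nonneg_left ?_ (sub_nonneg.2 hrt)
        refine intervalIntegral.integral_mono_on hrt ?_ (by simp) fun s hs => (h s hs).2 F
        simpa only [Finset.sum_fn] using IntervalIntegrable.sum F hi
    _ = ((t - r) * A) ^ 2 := by
        rw [intervalIntegral.integral_const, smul_eq_mul]; ring

/-! ### The resonance kernel -/

/-- The kernel `|n|^{-α} |n-m|^{-α} |m|^{-1-α}`, which vanishes when `n`, `m` or `n - m` does. -/
def resKernel (α : ℝ) (n m : ℤ) : ℝ :=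
  |(n : ℝ)| ^ (-α) * |((n - m : ℤ) : ℝ)| ^ (-α) * |(m : ℝ)| ^ (-1 - α)

theorem resKernel_nonneg (α : ℝ) (n m : ℤ) : 0 ≤ resKernel α n m := by
  unfold resKernel; positivity

/-- Cauchy–Schwarz in `n` at fixed `m`, then in `m`. The first needs `∑ |n|^{-2α} |n-m|^{-2α} ≤ ∑
|n|^{-4α} < ∞`, hence `α > 1/4`; the second only `∑ |m|^{-2-2α} < ∞`. That `q` may depend on `m`,
with a uniform `ℓ²` bound in `n`, is used for the cubic sums in the conservation law. -/
theorem exists_resKernel_trilinear {α : ℝ} (hα : 1 / 4 < α) :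
    ∃ C : ℝ, 0 ≤ C ∧ ∀ (d : ℤ → ℝ) (q : ℤ → ℤ → ℝ) (A B : ℝ), (∀ m, 0 ≤ d m) →
      (∀ n m, 0 ≤ q n m) → SqSumLe d A → (∀ m, SqSumLe (fun n => q n m) B) →
      ∀ F : Finset (ℤ × ℤ), ∑ p ∈ F, resKernel α p.1 p.2 * d p.2 * q p.1 p.2 ≤ C * A * B := by
  have hS : Summable fun n : ℤ => |(n : ℝ)| ^ (-(4 * α)) :=
    Real.summable_abs_int_rpow (by linarith)
  have hS' : Summable fun n : ℤ => |(n : ℝ)| ^ (-(2 + 2 * α)) :=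
    Real.summable_abs_int_rpow (by linarith)
  set Z := ∑' n : ℤ, |(n : ℝ)| ^ (-(4 * α)) with hZ
  set Y := ∑' n : ℤ, |(n : ℝ)| ^ (-(2 + 2 * α)) with hY
  have hZ0 : 0 ≤ Z := tsum_nonneg fun n => by positivity
  have hY0 : 0 ≤ Y := tsum_nonneg fun n => by positivity
  refine ⟨√Z * √Y, by positivity, fun d q A B hd hq hdA hqB F => ?_⟩
  have hpow : ∀ (x : ℝ) (a : ℝ), (|x| ^ a) ^ 2 = |x| ^ (2 * a) := fun x a => by
    rw [← Real.rpow_natCast, ← Real.rpow_mul (abs_nonneg x), Nat.cast_ofNat, mul_comm]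
  have hpow' : ∀ (x : ℝ), (|x| ^ (-(2 * α))) ^ 2 = |x| ^ (-(4 * α)) := fun x => by
    rw [hpow]; congr 1; ring
  set G := F.image Prod.fst
  set H := F.image Prod.snd
  have hB : 0 ≤ B := (hqB 0).1
  have inner : ∀ m, ∑ n ∈ G, |(n : ℝ)| ^ (-α) * |((n - m : ℤ) : ℝ)| ^ (-α) * q n m ≤ √Z * B := by
    intro m
    refine sum_mul_le_of_sq_le G (Real.sqrt_nonneg _) hB ?_ ((hqB m).2 G)
    rw [Real.sq_sqrt hZ0]
    have h1 : ∑ n ∈ G, |(n : ℝ)| ^ (-(4 * α)) ≤ Z := hS.sum_le_tsum G fun _ _ => by positivity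
    have h2 : ∑ n ∈ G, |((n - m : ℤ) : ℝ)| ^ (-(4 * α)) ≤ Z := by
      have := hS.sum_le_tsum (G.map (Equiv.subRight m).toEmbedding) fun _ _ => by positivity
      rwa [Finset.sum_map] at this
    -- Arithmetic-geometric mean; by translation invariance both halves are at most `Z`.
    calc ∑ n ∈ G, (|(n : ℝ)| ^ (-α) * |((n - m : ℤ) : ℝ)| ^ (-α)) ^ 2
        ≤ ∑ n ∈ G, (|(n : ℝ)| ^ (-(4 * α)) + |((n - m : ℤ) : ℝ)| ^ (-(4 * α))) / 2 := by
          refine Finset.sum_le_sum fun n _ => ?_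
          rw [← hpow', ← hpow', mul_pow, hpow, hpow, mul_neg]
          nlinarith [sq_nonneg (|(n : ℝ)| ^ (-(2 * α)) - |((n - m : ℤ) : ℝ)| ^ (-(2 * α)))]
      _ ≤ Z := by rw [← Finset.sum_div, Finset.sum_add_distrib]; linarith
  have outer : ∑ m ∈ H, |(m : ℝ)| ^ (-1 - α) * d m ≤ √Y * A := by
    refine sum_mul_le_of_sq_le H (Real.sqrt_nonneg _) hdA.1 ?_ (hdA.2 H)
    rw [Real.sq_sqrt hY0]
    refine le_trans (le_of_eq (Finset.sum_congr rfl fun m _ => ?_))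
      (hS'.sum_le_tsum H fun _ _ => by positivity)
    rw [hpow]; congr 1; ring
  calc ∑ p ∈ F, resKernel α p.1 p.2 * d p.2 * q p.1 p.2
      ≤ ∑ p ∈ G ×ˢ H, resKernel α p.1 p.2 * d p.2 * q p.1 p.2 := by
        refine Finset.sum_le_sum_of_subset_of_nonneg Finset.subset_product fun p _ _ => ?_
        exact mul_nonneg (mul_nonneg (resKernel_nonneg _ _ _) (hd _)) (hq _ _)
    _ = ∑ m ∈ H, |(m : ℝ)| ^ (-1 - α) * d m *
          ∑ n ∈ G, |(n : ℝ)| ^ (-α) * |((n - m : ℤ) : ℝ)| ^ (-α) * q n m := by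
        rw [Finset.sum_product_right]
        refine Finset.sum_congr rfl fun m _ => ?_
        rw [Finset.mul_sum]
        exact Finset.sum_congr rfl fun n _ => by simp only [resKernel]; ring
    _ ≤ ∑ m ∈ H, |(m : ℝ)| ^ (-1 - α) * d m * (√Z * B) :=
        Finset.sum_le_sum fun m _ => mul_le_mul_of_nonneg_left (inner m)
          (mul_nonneg (by positivity) (hd m))
    _ = (∑ m ∈ H, |(m : ℝ)| ^ (-1 - α) * d m) * (√Z * B) := by rw [Finset.sum_mul]
    _ ≤ √Y * A * (√Z * B) := mul_le_mul_of_nonneg_right outer (by positivity)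
    _ = √Z * √Y * A * B := by ring

/-- Duality: the trilinear bound is tested against the output itself, truncated to finite sets so
that no summability is presupposed. -/
theorem exists_resKernel_bound {α : ℝ} (hα : 1 / 4 < α) :
    ∃ C : ℝ, 0 ≤ C ∧ ∀ (d : ℤ → ℝ) (A : ℝ), (∀ m, 0 ≤ d m) → SqSumLe d A →
      (∀ n, Summable fun m => resKernel α n m * d m) ∧
        SqSumLe (fun n => ∑' m, resKernel α n m * d m) (C * A) := by
  obtain ⟨C, hC, h⟩ := exists_resKernel_trilinear hα
  refine ⟨C, hC, fun d A hd hA => ?_⟩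
  have hCA : 0 ≤ C * A := mul_nonneg hC hA.1
  have key : ∀ F G : Finset ℤ, ∑ n ∈ F, (∑ m ∈ G, resKernel α n m * d m) ^ 2 ≤ (C * A) ^ 2 := by
    intro F G
    set y : ℤ → ℝ := fun n => ∑ m ∈ G, resKernel α n m * d m
    have hy : ∀ n, 0 ≤ y n := fun n =>
      Finset.sum_nonneg fun m _ => mul_nonneg (resKernel_nonneg _ _ _) (hd m)
    set S := ∑ n ∈ F, y n ^ 2
    have hS : 0 ≤ S := Finset.sum_nonneg fun _ _ => sq_nonneg _
    have hq : SqSumLe (fun n => if n ∈ F then y n else 0) (√S) := by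
      refine ⟨Real.sqrt_nonneg _, fun G' => ?_⟩
      rw [Real.sq_sqrt hS]
      simp only [ite_pow, ne_eq, OfNat.ofNat_ne_zero, not_false_eq_true, zero_pow]
      rw [Finset.sum_ite_mem]
      exact Finset.sum_le_sum_of_subset_of_nonneg Finset.inter_subset_right
        fun _ _ _ => sq_nonneg _
    -- This choice of `q` gives `S ≤ C A √S`, hence `√S ≤ C A`.
    have h1 := h d (fun n _ => if n ∈ F then y n else 0) A (√S) hd
      (fun n _ => by split_ifs <;> simp [hy]) hA (fun _ => hq) (F ×ˢ G)
    have h2 : ∑ p ∈ F ×ˢ G, resKernel α p.1 p.2 * d p.2 * (if p.1 ∈ F then y p.1 else 0) = S := by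
      rw [Finset.sum_product]
      refine Finset.sum_congr rfl fun n hn => ?_
      simp only [hn, if_true]
      rw [← Finset.sum_mul, sq]
    rw [h2] at h1
    have h3 : √S ≤ C * A := by
      by_contra hlt
      push Not at hlt
      have h4 : √S * √S = S := Real.mul_self_sqrt hS
      have : C * A * √S < √S * √S := mul_lt_mul_of_pos_right hlt (hCA.trans_lt hlt)
      linarith
    calc S = √S ^ 2 := (Real.sq_sqrt hS).symm
      _ ≤ (C * A) ^ 2 := pow_le_pow_left₀ (Real.sqrt_nonneg _) h3 2
  have hsum : ∀ n, Summable fun m => resKernel α n m * d m := fun n =>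
    summable_of_sum_le (c := C * A) (fun m => mul_nonneg (resKernel_nonneg _ _ _) (hd m)) fun G => by
      have := key {n} G
      rw [Finset.sum_singleton] at this
      exact le_of_sq_le_sq this hCA
  refine ⟨hsum, hCA, fun F => ?_⟩
  have ht : Tendsto (fun G : Finset ℤ => ∑ n ∈ F, (∑ m ∈ G, resKernel α n m * d m) ^ 2) atTop
      (𝓝 (∑ n ∈ F, (∑' m, resKernel α n m * d m) ^ 2)) :=
    tendsto_finsetSum F fun n _ => ((hsum n).hasSum).pow 2
  exact le_of_tendsto' ht (key F)

/-! ### Oscillatory integrals -/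

/-- Integration by parts against the primitive of `φ` that vanishes at `r`, so that only the
boundary term at `t` survives. -/
theorem norm_integral_mul_le {φ f f' : ℝ → ℂ} {r t K : ℝ} (hrt : r ≤ t)
    (hφ : ContinuousOn φ (Icc r t)) (hK : ∀ s ∈ Icc r t, ‖∫ x in r..s, φ x‖ ≤ K)
    (hf : ContinuousOn f (Icc r t)) (hf' : ContinuousOn f' (Icc r t))
    (hd : ∀ s ∈ Ioo r t, HasDerivAt f (f' s) s) :
    ‖∫ s in r..t, φ s * f s‖ ≤ K * (‖f t‖ + ∫ s in r..t, ‖f' s‖) := by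
  have hu : uIcc r t = Icc r t := uIcc_of_le hrt
  have hφi : IntervalIntegrable φ volume r t := hφ.intervalIntegrable_of_Icc hrt
  have hΦc : ContinuousOn (fun s => ∫ x in r..s, φ x) (Icc r t) := by
    have := intervalIntegral.continuousOn_primitive_interval (a := r) (b := t) (f := φ)
      (μ := volume) (by rw [hu]; exact hφ.integrableOn_Icc)
    rwa [hu] at this
  have hΦd : ∀ s ∈ Ioo r t, HasDerivAt (fun s => ∫ x in r..s, φ x) (φ s) s := fun s hs => by
    refine intervalIntegral.integral_hasDerivAt_right ?_ ?_ ?_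
    · exact (hφ.mono (Icc_subset_Icc_right hs.2.le)).intervalIntegrable_of_Icc hs.1.le
    · exact (hφ.mono Ioo_subset_Icc_self).stronglyMeasurableAtFilter isOpen_Ioo s hs
    · exact hφ.continuousAt (Icc_mem_nhds hs.1 hs.2)
  have hparts := intervalIntegral.integral_mul_deriv_eq_deriv_mul_of_hasDerivAt
    (a := r) (b := t) (u := f) (v := fun s => ∫ x in r..s, φ x) (u' := f') (v' := φ)
    (by rwa [hu]) (by rwa [hu]) (by rwa [min_eq_left hrt, max_eq_right hrt])
    (by rwa [min_eq_left hrt, max_eq_right hrt]) (hf'.intervalIntegrable_of_Icc hrt) hφi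
  have h1 : ∫ s in r..t, φ s * f s
      = f t * (∫ x in r..t, φ x) - ∫ s in r..t, f' s * ∫ x in r..s, φ x := by
    rw [← sub_zero (f t * _), ← mul_zero (f r),
      ← intervalIntegral.integral_same (a := r) (f := φ) (μ := volume), ← hparts]
    exact intervalIntegral.integral_congr fun s _ => mul_comm _ _
  have h2 : ‖∫ s in r..t, f' s * ∫ x in r..s, φ x‖ ≤ ∫ s in r..t, K * ‖f' s‖ := by
    refine intervalIntegral.norm_integral_le_of_norm_le hrt (ae_of_all _ fun s hs => ?_)
      ((hf'.norm.intervalIntegrable_of_Icc hrt).const_mul K)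
    rw [norm_mul, mul_comm]
    exact mul_le_mul_of_nonneg_right (hK s (Ioc_subset_Icc_self hs)) (norm_nonneg _)
  rw [intervalIntegral.integral_const_mul] at h2
  rw [h1, mul_add]
  refine (norm_sub_le _ _).trans (add_le_add ?_ h2)
  rw [norm_mul, mul_comm]
  exact mul_le_mul_of_nonneg_right (hK t (right_mem_Icc.2 hrt)) (norm_nonneg _)

theorem hasSum_integral_of_sum_norm_le {ι : Type*} [Countable ι] {F : ι → ℝ → ℂ} {r t K : ℝ}
    (hrt : r ≤ t) (hF : ∀ i, ContinuousOn (F i) (Icc r t))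
    (hK : ∀ s ∈ Icc r t, ∀ G : Finset ι, ∑ i ∈ G, ‖F i s‖ ≤ K) :
    HasSum (fun i => ∫ s in r..t, F i s) (∫ s in r..t, ∑' i, F i s) := by
  simp_rw [intervalIntegral.integral_of_le hrt]
  have hi : ∀ i, IntegrableOn (F i) (Ioc r t) := fun i =>
    (hF i).integrableOn_Icc.mono_set Ioc_subset_Icc_self
  refine hasSum_integral_of_summable_integral_norm (fun i => hi i) ?_
  refine summable_of_sum_le (c := K * (t - r)) (fun i => integral_nonneg fun s => norm_nonneg _)
    fun G => ?_
  rw [← integral_finsetSum G fun i _ => (hi i).norm]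
  have h1 : ∫ s in Ioc r t, ∑ i ∈ G, ‖F i s‖ ≤ ∫ _ in Ioc r t, K := by
    refine setIntegral_mono_on (integrable_finsetSum G fun i _ => (hi i).norm) (by simp)
      measurableSet_Ioc fun s hs => hK s (Ioc_subset_Icc_self hs) G
  refine h1.trans_eq ?_
  simp [hrt, mul_comm]

/-- The oscillating factor `exp(-3 i n m (n - m) θ)` of the interaction representation. -/
def resPhase (θ : ℝ) (n m : ℤ) : ℂ :=
  Complex.exp (Complex.I * ((((-(3 * n * m * (n - m)) : ℤ) : ℝ) * θ : ℝ) : ℂ))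

theorem norm_resPhase (θ : ℝ) (n m : ℤ) : ‖resPhase θ n m‖ = 1 := by
  rw [resPhase, mul_comm]
  exact Complex.norm_exp_ofReal_mul_I _

theorem continuous_resPhase (n m : ℤ) : Continuous fun θ => resPhase θ n m := by
  unfold resPhase; fun_prop

/-- The modulus of the resonance function, up to the factor `3`. -/
def resAbs (n m : ℤ) : ℝ := |(n : ℝ)| * |(m : ℝ)| * |((n - m : ℤ) : ℝ)|

/-- The decay of the oscillatory integrals at the resonance function that irregularity provides. -/
structure PhaseDecay (ρ γ T C : ℝ) (w : ℝ → ℝ) : Prop where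
  nonneg : 0 ≤ C
  pos : 0 < γ
  cont : ContinuousOn w (Icc 0 T)
  bound : ∀ r t : ℝ, 0 ≤ r → r ≤ t → t ≤ T → ∀ n m : ℤ, n ≠ 0 → m ≠ 0 → n - m ≠ 0 →
    ‖∫ s in r..t, resPhase (w s) n m‖ ≤ C * resAbs n m ^ (-ρ) * (t - r) ^ γ

theorem one_le_abs_cast {n : ℤ} (hn : n ≠ 0) : 1 ≤ |(n : ℝ)| := by
  exact_mod_cast Int.one_le_abs hn

/-- Irregularity is applied at `a = -3nm(n-m)`. There `a² = 9 (resAbs n m)²`, so the weight `(1 +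
a²)^{ρ/2}` dominates `(resAbs n m)^ρ`. -/
theorem IsIrregular.exists_phaseDecay {ρ γ T : ℝ} {w : ℝ → ℝ} (hρ : 0 < ρ) (hγ : 0 < γ)
    (h : IsIrregular ρ γ T w) : ∃ C, PhaseDecay ρ γ T C w := by
  obtain ⟨hc, C, hC⟩ := h
  refine ⟨|C|, abs_nonneg _, hγ, hc, fun r t h0 hrt htT n m hn hm hnm => ?_⟩
  rcases hrt.eq_or_lt with rfl | hlt
  · simp [Real.zero_rpow hγ.ne']
  set k : ℤ := -(3 * n * m * (n - m)) with hk
  have h1 := hC (k : ℝ) r t h0 hlt htT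
  have h2 : occupation w t r (k : ℝ) = ∫ s in r..t, resPhase (w s) n m := rfl
  rw [h2] at h1
  have hx : 1 ≤ resAbs n m := by
    unfold resAbs
    have := one_le_abs_cast hn
    have := one_le_abs_cast hm
    have := one_le_abs_cast hnm
    exact one_le_mul_of_one_le_of_one_le (one_le_mul_of_one_le_of_one_le ‹_› ‹_›) ‹_›
  have hkx : (k : ℝ) ^ 2 = 9 * resAbs n m ^ 2 := by
    rw [hk]; unfold resAbs; rw [mul_pow, mul_pow, sq_abs, sq_abs, sq_abs]; push_cast; ring
  have hw : resAbs n m ^ ρ ≤ (1 + (k : ℝ) ^ 2) ^ (ρ / 2) := by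
    have h3 : resAbs n m ^ ρ = (resAbs n m ^ 2) ^ (ρ / 2) := by
      rw [← Real.rpow_natCast, ← Real.rpow_mul (by linarith)]; congr 1; push_cast; ring
    rw [h3]
    exact Real.rpow_le_rpow (by positivity) (by rw [hkx]; nlinarith) (by linarith)
  have hd : 0 < (t - r) ^ γ := Real.rpow_pos_of_pos (sub_pos.2 hlt) γ
  have hp : 0 < resAbs n m ^ ρ := Real.rpow_pos_of_pos (by linarith) ρ
  rw [abs_of_pos (sub_pos.2 hlt)] at h1
  have h4 : resAbs n m ^ ρ * (‖∫ s in r..t, resPhase (w s) n m‖ / (t - r) ^ γ) ≤ |C| :=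
    (mul_le_mul_of_nonneg_right hw (by positivity)).trans (h1.trans (le_abs_self C))
  rw [Real.rpow_neg (by linarith)]
  rw [← mul_div_assoc, div_le_iff₀ hd] at h4
  rw [mul_assoc, mul_left_comm, ← div_eq_inv_mul, le_div_iff₀ hp]
  linarith

/-! ### The nonlinearity in the interaction representation -/

/-- The `n`-th coefficient of `U(-θ) ∂ₓ(U(θ)f · U(θ)g)`, where `U(θ) = e^{-θ ∂ₓ³}`. -/
def bil (θ : ℝ) (f g : ℤ → ℂ) (n : ℤ) : ℂ :=
  Complex.I * n * ∑' m, resPhase θ n m * (f m * g (n - m))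

theorem sum_conv_le {f g : ℤ → ℝ} {A B : ℝ} (hf : SqSumLe f A) (hg : SqSumLe g B) (n : ℤ)
    (G : Finset ℤ) : ∑ m ∈ G, f m * g (n - m) ≤ A * B :=
  sum_mul_le_of_sq_le G hf.1 hg.1 (hf.2 G) ((hg.comp_injective sub_right_injective).2 G)

theorem summable_conv {f g : ℤ → ℂ} {A B : ℝ} (hf : SqSumLe (fun n => ‖f n‖) A)
    (hg : SqSumLe (fun n => ‖g n‖) B) (n : ℤ) : Summable fun m => ‖f m * g (n - m)‖ :=
  summable_of_sum_le (fun _ => norm_nonneg _) fun G => by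
    simp_rw [norm_mul]; exact sum_conv_le hf hg n G

theorem summable_bil {f g : ℤ → ℂ} {A B : ℝ} (hf : SqSumLe (fun n => ‖f n‖) A)
    (hg : SqSumLe (fun n => ‖g n‖) B) (θ : ℝ) (n : ℤ) :
    Summable fun m => resPhase θ n m * (f m * g (n - m)) :=
  Summable.of_norm (by simpa [norm_mul, norm_resPhase] using summable_conv hf hg n)

/-- Cauchy–Schwarz on the convolution. This crude bound, with its loss of one factor `|n|`, is the
only information on time derivatives that the unweighted theory uses. -/
theorem norm_bil_le {f g : ℤ → ℂ} {A B : ℝ} (hf : SqSumLe (fun n => ‖f n‖) A)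
    (hg : SqSumLe (fun n => ‖g n‖) B) (θ : ℝ) (n : ℤ) :
    ‖bil θ f g n‖ ≤ A * B * |(n : ℝ)| := by
  rw [bil, norm_mul, norm_mul, Complex.norm_I, one_mul, Complex.norm_intCast, mul_comm]
  refine mul_le_mul_of_nonneg_right ?_ (abs_nonneg _)
  refine (norm_tsum_le_tsum_norm ?_).trans (Real.tsum_le_of_sum_le (fun _ => norm_nonneg _) ?_)
  · simpa [norm_mul, norm_resPhase] using summable_conv hf hg n
  · intro G
    simp_rw [norm_mul, norm_resPhase, one_mul]
    exact sum_conv_le hf hg n G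

/-- The triangle inequality together with `a + b ≤ 2ab` for `a, b ≥ 1`. -/
theorem abs_cast_le_two_mul {n m : ℤ} (hm : m ≠ 0) (hnm : n - m ≠ 0) :
    |(n : ℝ)| ≤ 2 * |(m : ℝ)| * |((n - m : ℤ) : ℝ)| := by
  have h1 := one_le_abs_cast hm
  have h2 := one_le_abs_cast hnm
  have h3 : |(n : ℝ)| ≤ |(m : ℝ)| + |((n - m : ℤ) : ℝ)| := by
    have : (n : ℝ) = m + ((n - m : ℤ) : ℝ) := by push_cast; ring
    calc |(n : ℝ)| = |(m : ℝ) + ((n - m : ℤ) : ℝ)| := by rw [← this]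
      _ ≤ _ := abs_add_le _ _
  nlinarith

/-- Here `x = |n|`, `y = |m|`, `z = |n-m|`; the last factor `z` on the left is the derivative lost
to the time derivative of the mode `n - m`. Only the part `x^{s+σ/2}` of the output weight is moved
to the inputs through `x ≤ 2yz`. Keeping the other `x^{σ/2}` leaves equal exponents on `x` and `z`,
as the kernel requires. -/
theorem rpow_weight_le {x y z s σ ρ : ℝ} (hx : 0 < x) (hy : 0 < y) (hz : 0 < z) (hs : 0 ≤ s)
    (hσ : 0 ≤ σ) (hxyz : x ≤ 2 * y * z) :
    x ^ (s + σ) * (x * (x * y * z) ^ (-ρ)) * z ≤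
      2 ^ (s + σ / 2) * (x ^ (-(ρ - 1 - σ / 2)) * z ^ (-(ρ - 1 - σ / 2)) *
        y ^ (-1 - (ρ - 1 - σ / 2))) * (y ^ s * z ^ s) := by
  have hβ : 0 ≤ s + σ / 2 := by linarith
  have h1 : x ^ (s + σ / 2) ≤ 2 ^ (s + σ / 2) * y ^ (s + σ / 2) * z ^ (s + σ / 2) := by
    rw [← Real.mul_rpow (by norm_num) hy.le, ← Real.mul_rpow (by positivity) hz.le]
    exact Real.rpow_le_rpow hx.le hxyz hβ
  have e0 : ∀ {a : ℝ}, 0 < a → a * a ^ (-ρ) = a ^ (1 + -ρ) := fun ha => by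
    rw [Real.rpow_add ha, Real.rpow_one]
  have e1 : x ^ (s + σ) * (x * x ^ (-ρ)) = x ^ (-(ρ - 1 - σ / 2)) * x ^ (s + σ / 2) := by
    rw [e0 hx, ← Real.rpow_add hx, ← Real.rpow_add hx]; congr 1; ring
  have e2 : y ^ (s + σ / 2) * y ^ (-ρ) = y ^ (-1 - (ρ - 1 - σ / 2)) * y ^ s := by
    rw [← Real.rpow_add hy, ← Real.rpow_add hy]; congr 1; ring
  have e3 : z ^ (s + σ / 2) * (z * z ^ (-ρ)) = z ^ (-(ρ - 1 - σ / 2)) * z ^ s := by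
    rw [e0 hz, ← Real.rpow_add hz, ← Real.rpow_add hz]; congr 1; ring
  rw [Real.mul_rpow (by positivity) hz.le, Real.mul_rpow hx.le hy.le]
  calc x ^ (s + σ) * (x * (x ^ (-ρ) * y ^ (-ρ) * z ^ (-ρ))) * z
      = x ^ (s + σ) * (x * x ^ (-ρ)) * y ^ (-ρ) * (z * z ^ (-ρ)) := by ring
    _ = x ^ (-(ρ - 1 - σ / 2)) * x ^ (s + σ / 2) * y ^ (-ρ) * (z * z ^ (-ρ)) := by rw [e1]
    _ ≤ x ^ (-(ρ - 1 - σ / 2)) * (2 ^ (s + σ / 2) * y ^ (s + σ / 2) * z ^ (s + σ / 2)) *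
          y ^ (-ρ) * (z * z ^ (-ρ)) := by gcongr
    _ = x ^ (-(ρ - 1 - σ / 2)) * 2 ^ (s + σ / 2) * (y ^ (s + σ / 2) * y ^ (-ρ)) *
          (z ^ (s + σ / 2) * (z * z ^ (-ρ))) := by ring
    _ = _ := by rw [e2, e3]; ring

/-! ### The main estimate -/

/-- On `[a,b]`, `f` takes values in the ball of radius `A` of the homogeneous Sobolev space of order
`s`, and its time derivative `g` satisfies `|n|^s |gₙ| ≤ L |n|`. -/
structure Controlled (s a b : ℝ) (f g : ℝ → ℤ → ℂ) (A L : ℝ) : Prop where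
  nonneg : 0 ≤ L
  zero : ∀ t ∈ Icc a b, f t 0 = 0
  cont : ∀ n, ContinuousOn (fun t => f t n) (Icc a b)
  contDeriv : ∀ n, ContinuousOn (fun t => g t n) (Icc a b)
  deriv : ∀ n, ∀ t ∈ Ioo a b, HasDerivAt (fun t => f t n) (g t n) t
  bound : ∀ t ∈ Icc a b, SqSumLe (fun n => |(n : ℝ)| ^ s * ‖f t n‖) A
  derivBound : ∀ t ∈ Icc a b, ∀ n : ℤ, |(n : ℝ)| ^ s * ‖g t n‖ ≤ L * |(n : ℝ)|

theorem Controlled.mono {s a b a' b' A L : ℝ} {f g : ℝ → ℤ → ℂ} (h : Controlled s a b f g A L)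
    (ha : a ≤ a') (hb : b' ≤ b) : Controlled s a' b' f g A L where
  nonneg := h.nonneg
  zero t ht := h.zero t (Icc_subset_Icc ha hb ht)
  cont n := (h.cont n).mono (Icc_subset_Icc ha hb)
  contDeriv n := (h.contDeriv n).mono (Icc_subset_Icc ha hb)
  deriv n t ht := h.deriv n t (Ioo_subset_Ioo ha hb ht)
  bound t ht := h.bound t (Icc_subset_Icc ha hb ht)
  derivBound t ht := h.derivBound t (Icc_subset_Icc ha hb ht)

theorem norm_le_weighted {s : ℝ} (hs : 0 ≤ s) {f : ℤ → ℂ} (h0 : f 0 = 0) (n : ℤ) :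
    ‖f n‖ ≤ |(n : ℝ)| ^ s * ‖f n‖ := by
  rcases eq_or_ne n 0 with rfl | hn
  · simp [h0]
  · exact le_mul_of_one_le_left (norm_nonneg _) (Real.one_le_rpow (one_le_abs_cast hn) hs)

theorem sqSumLe_norm_of_weighted {s A : ℝ} (hs : 0 ≤ s) {f : ℤ → ℂ} (h0 : f 0 = 0)
    (h : SqSumLe (fun n => |(n : ℝ)| ^ s * ‖f n‖) A) : SqSumLe (fun n => ‖f n‖) A :=
  h.mono fun n => by
    rw [abs_norm, abs_of_nonneg (by positivity)]; exact norm_le_weighted hs h0 n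

/-- If `P z ≤ D y^s z^s`, `z^s G ≤ L z`, then `P F G ≤ D (y^s F) L`. -/
theorem weight_transfer {P z Z D Y F G L : ℝ} (hP : 0 ≤ P) (hF : 0 ≤ F) (hL : 0 ≤ L) (hZ : 0 < Z)
    (hPz : P * z ≤ D * (Y * Z)) (hG : Z * G ≤ L * z) : P * (F * G) ≤ D * (Y * F) * L := by
  refine le_of_mul_le_mul_right ?_ hZ
  calc P * (F * G) * Z = P * F * (Z * G) := by ring
    _ ≤ P * F * (L * z) := mul_le_mul_of_nonneg_left hG (mul_nonneg hP hF)
    _ = P * z * (F * L) := by ring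
    _ ≤ D * (Y * Z) * (F * L) := mul_le_mul_of_nonneg_right hPz (mul_nonneg hF hL)
    _ = D * (Y * F) * L * Z := by ring

theorem resKernel_weight_le {s σ ρ : ℝ} (hs : 0 ≤ s) (hσ : 0 ≤ σ) {n m : ℤ} (hn : n ≠ 0)
    (hm : m ≠ 0) (hnm : n - m ≠ 0) :
    |(n : ℝ)| ^ (s + σ) * (|(n : ℝ)| * resAbs n m ^ (-ρ)) * |((n - m : ℤ) : ℝ)| ≤
      2 ^ (s + σ / 2) * resKernel (ρ - 1 - σ / 2) n m *
        (|(m : ℝ)| ^ s * |((n - m : ℤ) : ℝ)| ^ s) :=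
  rpow_weight_le (by linarith [one_le_abs_cast hn]) (by linarith [one_le_abs_cast hm])
    (by linarith [one_le_abs_cast hnm]) hs hσ (abs_cast_le_two_mul hm hnm)

theorem resAbs_sub (n m : ℤ) : resAbs n (n - m) = resAbs n m := by
  unfold resAbs; rw [sub_sub_cancel]; ring

/-- A single interaction of the frequencies `m` and `n - m`. -/
theorem Controlled.interaction_le {ρ γ T C : ℝ} {w : ℝ → ℝ} (hw : PhaseDecay ρ γ T C w)
    {s σ : ℝ} (hs : 0 ≤ s) (hσ : 0 ≤ σ) {f f' g g' : ℝ → ℤ → ℂ} {A L A' L' r t : ℝ} (hr : 0 ≤ r)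
    (hrt : r ≤ t) (ht : t ≤ T) (hf : Controlled s r t f f' A L) (hg : Controlled s r t g g' A' L')
    (n m : ℤ) :
    |(n : ℝ)| ^ (s + σ) * (|(n : ℝ)| *
        ‖∫ x in r..t, resPhase (w x) n m * (f x m * g x (n - m))‖) ≤
      C * (t - r) ^ γ * 2 ^ (s + σ / 2) *
        (resKernel (ρ - 1 - σ / 2) n m * (A' * (|(m : ℝ)| ^ s * ‖f t m‖) +
            L' * ∫ x in r..t, |(m : ℝ)| ^ s * ‖f x m‖) +
          resKernel (ρ - 1 - σ / 2) n (n - m) *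
            (L * ∫ x in r..t, |((n - m : ℤ) : ℝ)| ^ s * ‖g x (n - m)‖)) := by
  have htm : t ∈ Icc r t := right_mem_Icc.2 hrt
  have hA' : 0 ≤ A' := (hg.bound t htm).1
  have hL := hf.nonneg
  have hL' := hg.nonneg
  have hC := hw.nonneg
  have hk1 := resKernel_nonneg (ρ - 1 - σ / 2) n m
  have hk2 := resKernel_nonneg (ρ - 1 - σ / 2) n (n - m)
  have hF0 : 0 ≤ ∫ x in r..t, |(m : ℝ)| ^ s * ‖f x m‖ :=
    intervalIntegral.integral_nonneg hrt fun x _ => by positivity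
  have hG0 : 0 ≤ ∫ x in r..t, |((n - m : ℤ) : ℝ)| ^ s * ‖g x (n - m)‖ :=
    intervalIntegral.integral_nonneg hrt fun x _ => by positivity
  have hd : 0 ≤ (t - r) ^ γ := Real.rpow_nonneg (sub_nonneg.2 hrt) γ
  have hRHS : 0 ≤ C * (t - r) ^ γ * 2 ^ (s + σ / 2) *
        (resKernel (ρ - 1 - σ / 2) n m * (A' * (|(m : ℝ)| ^ s * ‖f t m‖) +
            L' * ∫ x in r..t, |(m : ℝ)| ^ s * ‖f x m‖) +
          resKernel (ρ - 1 - σ / 2) n (n - m) *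
            (L * ∫ x in r..t, |((n - m : ℤ) : ℝ)| ^ s * ‖g x (n - m)‖)) := by positivity
  -- In the three degenerate cases the left side vanishes, because of the factor `|n|` or the zero
  -- modes of `f` and `g`. Oscillation is needed only off resonance.
  rcases eq_or_ne n 0 with rfl | hn
  · simpa using hRHS
  rcases eq_or_ne m 0 with rfl | hm
  · rw [intervalIntegral.integral_congr (g := fun _ => (0 : ℂ)) fun x hx => by
      simp [hf.zero x (uIcc_of_le hrt ▸ hx)]]
    simpa using hRHS
  rcases eq_or_ne (n - m) 0 with hnm | hnm
  · rw [intervalIntegral.integral_congr (g := fun _ => (0 : ℂ)) fun x hx => by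
      simp [hnm, hg.zero x (uIcc_of_le hrt ▸ hx)]]
    simpa using hRHS
  have hsub : ∀ x ∈ Icc r t, Icc r x ⊆ Icc r t := fun x hx => Icc_subset_Icc_right hx.2
  have hwc : ContinuousOn w (Icc r t) := hw.cont.mono (Icc_subset_Icc hr ht)
  set N := resAbs n m ^ (-ρ) with hN
  have hN0 : 0 ≤ N := Real.rpow_nonneg (by unfold resAbs; positivity) _
  have hosc := norm_integral_mul_le (φ := fun x => resPhase (w x) n m)
    (f := fun x => f x m * g x (n - m))
    (f' := fun x => f' x m * g x (n - m) + f x m * g' x (n - m)) (K := C * N * (t - r) ^ γ) hrt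
    ((continuous_resPhase n m).comp_continuousOn hwc)
    (fun x hx => (hw.bound r x hr hx.1 (hx.2.trans ht) n m hn hm hnm).trans <|
      mul_le_mul_of_nonneg_left (Real.rpow_le_rpow (sub_nonneg.2 hx.1) (by linarith [hx.2])
        hw.pos.le) (by positivity))
    ((hf.cont m).mul (hg.cont (n - m)))
    (((hf.contDeriv m).mul (hg.cont (n - m))).add ((hf.cont m).mul (hg.contDeriv (n - m))))
    (fun x hx => (hf.deriv m x hx).mul (hg.deriv (n - m) x hx))
  set P := |(n : ℝ)| ^ (s + σ) * (|(n : ℝ)| * N) with hP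
  have hP0 : 0 ≤ P := by positivity
  set D := (2 : ℝ) ^ (s + σ / 2) with hD
  set κ := resKernel (ρ - 1 - σ / 2) n m with hκ
  set κ' := resKernel (ρ - 1 - σ / 2) n (n - m) with hκ'
  set y := |(m : ℝ)| with hy
  set z := |((n - m : ℤ) : ℝ)| with hz
  have hy1 : 1 ≤ y := one_le_abs_cast hm
  have hz1 : 1 ≤ z := one_le_abs_cast hnm
  have hys : 0 < y ^ s := Real.rpow_pos_of_pos (by linarith) s
  have hzs : 0 < z ^ s := Real.rpow_pos_of_pos (by linarith) s
  have hW : P * z ≤ D * κ * (y ^ s * z ^ s) := resKernel_weight_le hs hσ hn hm hnm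
  -- When the time derivative falls on the mode `m`, the roles of `m` and `n - m` are exchanged;
  -- `resAbs` is symmetric under this.
  have hW' : P * y ≤ D * κ' * (z ^ s * y ^ s) := by
    have := resKernel_weight_le (ρ := ρ) hs hσ hn hnm (by rwa [sub_sub_cancel])
    rwa [resAbs_sub, sub_sub_cancel] at this
  -- The boundary term loses no derivative, but since `|n-m| ≥ 1` it fits the same weight
  -- inequality.
  have hbdry : P * ‖f t m * g t (n - m)‖ ≤ D * κ * (y ^ s * ‖f t m‖) * A' := by
    rw [norm_mul]
    refine weight_transfer hP0 (norm_nonneg _) hA' hzs hW ?_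
    have := (hg.bound t htm).abs_le (n - m)
    rw [abs_of_nonneg (by positivity)] at this
    exact this.trans (le_mul_of_one_le_right hA' hz1)
  have hint : ∀ x ∈ Icc r t, P * ‖f' x m * g x (n - m) + f x m * g' x (n - m)‖ ≤
      D * κ' * (z ^ s * ‖g x (n - m)‖) * L + D * κ * (y ^ s * ‖f x m‖) * L' := fun x hx => by
    refine (mul_le_mul_of_nonneg_left (norm_add_le _ _) hP0).trans ?_
    rw [mul_add, norm_mul, norm_mul]
    refine add_le_add ?_ ?_
    · rw [mul_comm ‖f' x m‖]
      exact weight_transfer hP0 (norm_nonneg _) hL hys hW' (hf.derivBound x hx m)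
    · exact weight_transfer hP0 (norm_nonneg _) hL' hzs hW (hg.derivBound x hx (n - m))
  have hfi : IntervalIntegrable (fun x => y ^ s * ‖f x m‖) volume r t :=
    ((hf.cont m).norm.intervalIntegrable_of_Icc hrt).const_mul _
  have hgi : IntervalIntegrable (fun x => z ^ s * ‖g x (n - m)‖) volume r t :=
    ((hg.cont (n - m)).norm.intervalIntegrable_of_Icc hrt).const_mul _
  have hint' : P * ∫ x in r..t, ‖f' x m * g x (n - m) + f x m * g' x (n - m)‖ ≤
      D * κ' * (∫ x in r..t, z ^ s * ‖g x (n - m)‖) * L +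
        D * κ * (∫ x in r..t, y ^ s * ‖f x m‖) * L' := by
    rw [← intervalIntegral.integral_const_mul, ← intervalIntegral.integral_const_mul,
      ← intervalIntegral.integral_const_mul, ← intervalIntegral.integral_mul_const,
      ← intervalIntegral.integral_mul_const, ← intervalIntegral.integral_add
        ((hgi.const_mul _).mul_const _) ((hfi.const_mul _).mul_const _)]
    refine intervalIntegral.integral_mono_on hrt ?_
      (((hgi.const_mul _).mul_const _).add ((hfi.const_mul _).mul_const _)) hint
    exact ((((hf.contDeriv m).mul (hg.cont (n - m))).add
      ((hf.cont m).mul (hg.contDeriv (n - m)))).norm.intervalIntegrable_of_Icc hrt).const_mul _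
  calc |(n : ℝ)| ^ (s + σ) * (|(n : ℝ)| *
        ‖∫ x in r..t, resPhase (w x) n m * (f x m * g x (n - m))‖)
      ≤ |(n : ℝ)| ^ (s + σ) * (|(n : ℝ)| * (C * N * (t - r) ^ γ * (‖f t m * g t (n - m)‖ +
          ∫ x in r..t, ‖f' x m * g x (n - m) + f x m * g' x (n - m)‖))) := by gcongr
    _ = C * (t - r) ^ γ * (P * ‖f t m * g t (n - m)‖ +
          P * ∫ x in r..t, ‖f' x m * g x (n - m) + f x m * g' x (n - m)‖) := by rw [hP]; ring
    _ ≤ C * (t - r) ^ γ * (D * κ * (y ^ s * ‖f t m‖) * A' +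
          (D * κ' * (∫ x in r..t, z ^ s * ‖g x (n - m)‖) * L +
            D * κ * (∫ x in r..t, y ^ s * ‖f x m‖) * L')) := by gcongr
    _ = _ := by ring

theorem Controlled.integral_bil_eq {T : ℝ} {w : ℝ → ℝ} (hw : ContinuousOn w (Icc 0 T))
    {s : ℝ} (hs : 0 ≤ s) {f f' g g' : ℝ → ℤ → ℂ} {A L A' L' r t : ℝ} (hr : 0 ≤ r)
    (hrt : r ≤ t) (ht : t ≤ T) (hf : Controlled s r t f f' A L) (hg : Controlled s r t g g' A' L')
    (n : ℤ) :
    HasSum (fun m => Complex.I * n * ∫ x in r..t, resPhase (w x) n m * (f x m * g x (n - m)))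
      (∫ x in r..t, bil (w x) (f x) (g x) n) := by
  unfold bil
  rw [intervalIntegral.integral_const_mul]
  refine (hasSum_integral_of_sum_norm_le (K := A * A') hrt (fun m => ?_)
    fun x hx G => ?_).mul_left _
  · exact ((continuous_resPhase n m).comp_continuousOn (hw.mono (Icc_subset_Icc hr ht))).mul
      ((hf.cont m).mul (hg.cont (n - m)))
  · simp_rw [norm_mul, norm_resPhase, one_mul]
    exact sum_conv_le (sqSumLe_norm_of_weighted hs (hf.zero x hx) (hf.bound x hx))
      (sqSumLe_norm_of_weighted hs (hg.zero x hx) (hg.bound x hx)) n G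

/-- The time integral of the nonlinearity gains `σ` derivatives. -/
theorem PhaseDecay.exists_integral_bil_bound {ρ γ T C : ℝ} {w : ℝ → ℝ}
    (hw : PhaseDecay ρ γ T C w) {s σ : ℝ} (hs : 0 ≤ s) (hσ : 0 ≤ σ) (hσρ : σ < 2 * ρ - 5 / 2) :
    ∃ C₀ : ℝ, 0 ≤ C₀ ∧ ∀ (f f' g g' : ℝ → ℤ → ℂ) (A L A' L' r t : ℝ), 0 ≤ r → r ≤ t → t ≤ T →
      Controlled s r t f f' A L → Controlled s r t g g' A' L' →
      SqSumLe (fun n => |(n : ℝ)| ^ (s + σ) * ‖∫ x in r..t, bil (w x) (f x) (g x) n‖)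
        (C₀ * (t - r) ^ γ * (A * A' + (t - r) * (A * L' + L * A'))) := by
  -- The condition `α > 1/4` is exactly `σ < 2ρ - 5/2`.
  obtain ⟨Ck, hCk, hker⟩ := exists_resKernel_bound (α := ρ - 1 - σ / 2) (by linarith)
  have hC := hw.nonneg
  refine ⟨C * 2 ^ (s + σ / 2) * Ck, by positivity, ?_⟩
  intro f f' g g' A L A' L' r t hr hrt ht hf hg
  set α := ρ - 1 - σ / 2
  have htm : t ∈ Icc r t := right_mem_Icc.2 hrt
  have hd : 0 ≤ (t - r) ^ γ := Real.rpow_nonneg (sub_nonneg.2 hrt) γ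
  have hA' : 0 ≤ A' := (hg.bound t htm).1
  set E := C * (t - r) ^ γ * 2 ^ (s + σ / 2) with hE
  have hE0 : 0 ≤ E := by positivity
  set F : ℤ → ℝ := fun m => ∫ x in r..t, |(m : ℝ)| ^ s * ‖f x m‖ with hF
  set G : ℤ → ℝ := fun m => ∫ x in r..t, |(m : ℝ)| ^ s * ‖g x m‖ with hG
  have hF0 : ∀ m, 0 ≤ F m := fun m =>
    intervalIntegral.integral_nonneg hrt fun x _ => by positivity
  have hG0 : ∀ m, 0 ≤ G m := fun m =>
    intervalIntegral.integral_nonneg hrt fun x _ => by positivity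
  have hFA : SqSumLe F ((t - r) * A) :=
    SqSumLe.integral hrt (fun n => continuousOn_const.mul (hf.cont n).norm) hf.bound
  have hGA : SqSumLe G ((t - r) * A') :=
    SqSumLe.integral hrt (fun n => continuousOn_const.mul (hg.cont n).norm) hg.bound
  -- `d₁` collects the boundary term and the derivative of `g`; `d₂` belongs to the derivative of
  -- `f` and meets the reflected kernel, which the substitution `m ↦ n - m` turns back into the
  -- original one.
  set d₁ : ℤ → ℝ := fun m => A' * (|(m : ℝ)| ^ s * ‖f t m‖) + L' * F m with hd₁
  set d₂ : ℤ → ℝ := fun m => L * G m with hd₂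
  have h₁ : SqSumLe d₁ (A' * A + L' * ((t - r) * A)) :=
    ((hf.bound t htm).const_mul hA').add (hFA.const_mul hg.nonneg)
  have h₂ : SqSumLe d₂ (L * ((t - r) * A')) := hGA.const_mul hf.nonneg
  have hd₁0 : ∀ m, 0 ≤ d₁ m := fun m => by
    have := hF0 m; have := hg.nonneg; simp only [hd₁]; positivity
  have hd₂0 : ∀ m, 0 ≤ d₂ m := fun m => mul_nonneg hf.nonneg (hG0 m)
  obtain ⟨s₁, b₁⟩ := hker d₁ _ hd₁0 h₁
  obtain ⟨s₂, b₂⟩ := hker d₂ _ hd₂0 h₂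
  refine (((b₁.add b₂).const_mul hE0).mono fun n => ?_).mono_right (le_of_eq (by rw [hE]; ring))
  have s₂' : Summable fun m => resKernel α n (n - m) * d₂ (n - m) :=
    (Equiv.subLeft n).summable_iff.2 (s₂ n)
  have e₂ : ∑' m, resKernel α n (n - m) * d₂ (n - m) = ∑' m, resKernel α n m * d₂ m :=
    (Equiv.subLeft n).tsum_eq fun m => resKernel α n m * d₂ m
  have hterm := Controlled.interaction_le hw hs hσ hr hrt ht hf hg n
  have hnonneg : 0 ≤ ∑' m, resKernel α n m * d₁ m + ∑' m, resKernel α n m * d₂ m :=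
    add_nonneg (tsum_nonneg fun m => mul_nonneg (resKernel_nonneg _ _ _) (hd₁0 m))
      (tsum_nonneg fun m => mul_nonneg (resKernel_nonneg _ _ _) (hd₂0 m))
  rw [abs_of_nonneg (mul_nonneg hE0 hnonneg),
    abs_of_nonneg (a := |(n : ℝ)| ^ (s + σ) * ‖_‖) (by positivity)]
  have hsum : HasSum (fun m => ((|(n : ℝ)| ^ (s + σ) : ℝ) : ℂ) *
      (Complex.I * n * ∫ x in r..t, resPhase (w x) n m * (f x m * g x (n - m)))) _ :=
    (Controlled.integral_bil_eq hw.cont hs hr hrt ht hf hg n).mul_left _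
  have hbd : HasSum (fun m => E * (resKernel α n m * d₁ m + resKernel α n (n - m) * d₂ (n - m)))
      (E * (∑' m, resKernel α n m * d₁ m + ∑' m, resKernel α n m * d₂ m)) := by
    rw [← e₂]; exact ((s₁ n).hasSum.add s₂'.hasSum).mul_left _
  have := tsum_of_norm_bounded hbd (f := fun m => ((|(n : ℝ)| ^ (s + σ) : ℝ) : ℂ) *
      (Complex.I * n * ∫ x in r..t, resPhase (w x) n m * (f x m * g x (n - m)))) fun m => by
    rw [norm_mul, norm_mul, norm_mul, Complex.norm_I, one_mul, Complex.norm_intCast,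
      Complex.norm_real, Real.norm_of_nonneg (by positivity)]
    exact hterm m
  rw [hsum.tsum_eq, norm_mul, Complex.norm_real, Real.norm_of_nonneg (by positivity)] at this
  exact this

/-! ### Solutions with values in `ℓ²` -/

/-- `ℓ²(ℤ; ℂ)`. -/
abbrev SeqL2 : Type := lp (fun _ : ℤ => ℂ) 2

theorem SeqL2.sqSumLe (x : SeqL2) : SqSumLe (fun n => ‖x n‖) ‖x‖ := by
  refine ⟨norm_nonneg _, fun F => ?_⟩
  have := lp.sum_rpow_le_norm_rpow (p := 2) (by norm_num) x F
  simpa using this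

theorem SeqL2.norm_le_of_sqSumLe {x : SeqL2} {A : ℝ} (h : SqSumLe (fun n => ‖x n‖) A) :
    ‖x‖ ≤ A := by
  refine lp.norm_le_of_forall_sum_le (p := 2) (by norm_num) h.1 fun F => ?_
  simpa using h.2 F

theorem SeqL2.sqSumLe_of_norm_le {x : SeqL2} {A : ℝ} (h : ‖x‖ ≤ A) :
    SqSumLe (fun n => ‖x n‖) A :=
  x.sqSumLe.mono_right h

theorem SeqL2.norm_apply_le (x : SeqL2) (n : ℤ) : ‖x n‖ ≤ ‖x‖ :=
  lp.norm_apply_le_norm (by norm_num) x n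

theorem SeqL2.continuous_apply (n : ℤ) : Continuous fun x : SeqL2 => x n := by
  refine (LipschitzWith.of_dist_le_mul (K := 1) fun x y => ?_).continuous
  rw [dist_eq_norm, dist_eq_norm, NNReal.coe_one, one_mul]
  exact (x - y).norm_apply_le n

theorem SqSumLe.memℓp {f : ℤ → ℂ} {A : ℝ} (h : SqSumLe (fun n => ‖f n‖) A) : Memℓp f 2 := by
  rw [memℓp_gen_iff (by norm_num)]
  simpa using h.summable

open Classical in
/-- A sequence as an element of `ℓ²`, by convention `0` if it does not belong to `ℓ²`. -/
def toSeq (f : ℤ → ℂ) : SeqL2 := if h : Memℓp f 2 then ⟨f, h⟩ else 0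

theorem toSeq_apply {f : ℤ → ℂ} (h : Memℓp f 2) (n : ℤ) : toSeq f n = f n := by
  simp [toSeq, h]

theorem bil_sub_left {f f' g : ℤ → ℂ} {A A' B : ℝ} (hf : SqSumLe (fun n => ‖f n‖) A)
    (hf' : SqSumLe (fun n => ‖f' n‖) A') (hg : SqSumLe (fun n => ‖g n‖) B) (θ : ℝ) (n : ℤ) :
    bil θ (fun k => f k - f' k) g n = bil θ f g n - bil θ f' g n := by
  unfold bil
  rw [← mul_sub, ← (summable_bil hf hg θ n).tsum_sub (summable_bil hf' hg θ n)]
  congr 1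
  exact tsum_congr fun m => by ring

theorem bil_sub_right {f g g' : ℤ → ℂ} {A B B' : ℝ} (hf : SqSumLe (fun n => ‖f n‖) A)
    (hg : SqSumLe (fun n => ‖g n‖) B) (hg' : SqSumLe (fun n => ‖g' n‖) B') (θ : ℝ) (n : ℤ) :
    bil θ f (fun k => g k - g' k) n = bil θ f g n - bil θ f g' n := by
  unfold bil
  rw [← mul_sub, ← (summable_bil hf hg θ n).tsum_sub (summable_bil hf hg' θ n)]
  congr 1
  exact tsum_congr fun m => by ring

theorem bil_self_sub_self (x y : SeqL2) (θ : ℝ) (n : ℤ) :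
    bil θ x x n - bil θ y y n = bil θ ⇑(x - y) x n + bil θ y ⇑(x - y) n := by
  have h1 := bil_sub_left x.sqSumLe y.sqSumLe x.sqSumLe θ n
  have h2 := bil_sub_right y.sqSumLe x.sqSumLe y.sqSumLe θ n
  have h3 : (⇑(x - y) : ℤ → ℂ) = fun k => x k - y k := rfl
  rw [h3, h1, h2]; ring

theorem norm_bil_self_sub_self_le {x y : SeqL2} {M D : ℝ} (hx : ‖x‖ ≤ M) (hy : ‖y‖ ≤ M)
    (hxy : ‖x - y‖ ≤ D) (θ : ℝ) (n : ℤ) :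
    ‖bil θ x x n - bil θ y y n‖ ≤ 2 * M * D * |(n : ℝ)| := by
  rw [bil_self_sub_self]
  refine (norm_add_le _ _).trans ?_
  have h1 := norm_bil_le (SeqL2.sqSumLe_of_norm_le hxy) (SeqL2.sqSumLe_of_norm_le hx) θ n
  have h2 := norm_bil_le (SeqL2.sqSumLe_of_norm_le hy) (SeqL2.sqSumLe_of_norm_le hxy) θ n
  linarith

theorem continuous_bil_fst (x y : SeqL2) (n : ℤ) : Continuous fun θ => bil θ x y n := by
  unfold bil
  refine continuous_const.mul (continuous_tsum (fun m => (continuous_resPhase n m).mul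
    continuous_const) (summable_conv x.sqSumLe y.sqSumLe n) fun m θ => ?_)
  rw [norm_mul, norm_resPhase, one_mul]

/-- Increments of the two `ℓ²` arguments are small by `norm_bil_le`, uniformly in the phase; the
increment of the phase is taken at frozen arguments. -/
theorem continuousOn_bil {S : Set ℝ} {w : ℝ → ℝ} {f g : ℝ → SeqL2} (hw : ContinuousOn w S)
    (hf : ContinuousOn f S) (hg : ContinuousOn g S) (n : ℤ) :
    ContinuousOn (fun t => bil (w t) (f t) (g t) n) S := by
  intro t ht
  have e : ∀ x, bil (w x) (f x) (g x) n = bil (w x) ⇑(f x - f t) (g x) n +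
      bil (w x) (f t) ⇑(g x - g t) n + bil (w x) (f t) (g t) n := fun x => by
    have h1 := bil_sub_left (f x).sqSumLe (f t).sqSumLe (g x).sqSumLe (w x) n
    have h2 := bil_sub_right (f t).sqSumLe (g x).sqSumLe (g t).sqSumLe (w x) n
    have h3 : (⇑(f x - f t) : ℤ → ℂ) = fun k => f x k - f t k := rfl
    have h4 : (⇑(g x - g t) : ℤ → ℂ) = fun k => g x k - g t k := rfl
    rw [h3, h4, h1, h2]; ring
  have hft : Tendsto (fun x => ‖f x - f t‖) (𝓝[S] t) (𝓝 0) := by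
    simpa using ((hf t ht).sub_const (f t)).norm
  have hgt : Tendsto (fun x => ‖g x - g t‖) (𝓝[S] t) (𝓝 0) := by
    simpa using ((hg t ht).sub_const (g t)).norm
  have hgn : Tendsto (fun x => ‖g x‖) (𝓝[S] t) (𝓝 ‖g t‖) := (hg t ht).norm
  have t1 : Tendsto (fun x => bil (w x) ⇑(f x - f t) (g x) n) (𝓝[S] t) (𝓝 0) := by
    refine squeeze_zero_norm (fun x => norm_bil_le (f x - f t).sqSumLe (g x).sqSumLe (w x) n) ?_
    simpa using (hft.mul hgn).mul_const |(n : ℝ)|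
  have t2 : Tendsto (fun x => bil (w x) (f t) ⇑(g x - g t) n) (𝓝[S] t) (𝓝 0) := by
    refine squeeze_zero_norm (fun x => norm_bil_le (f t).sqSumLe (g x - g t).sqSumLe (w x) n) ?_
    simpa using (hgt.const_mul ‖f t‖).mul_const |(n : ℝ)|
  have t3 : Tendsto (fun x => bil (w x) (f t) (g t) n) (𝓝[S] t)
      (𝓝 (bil (w t) (f t) (g t) n)) :=
    ((continuous_bil_fst (f t) (g t) n).tendsto (w t)).comp (hw t ht)
  have := (t1.add t2).add t3
  rw [zero_add, zero_add] at this
  exact this.congr fun x => (e x).symm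

/-- `v` solves the modulated KdV equation on `[a,b]` in the interaction representation. -/
structure IsMild (w : ℝ → ℝ) (a b : ℝ) (v : ℝ → SeqL2) : Prop where
  cont : ContinuousOn v (Icc a b)
  zero : ∀ t ∈ Icc a b, v t 0 = 0
  eq : ∀ t ∈ Icc a b, ∀ n, v t n = v a n + ∫ x in a..t, bil (w x) (v x) (v x) n

theorem hasDerivAt_of_eq_integral {f g : ℝ → ℂ} {a b : ℝ} (hg : ContinuousOn g (Icc a b))
    (h : ∀ t ∈ Icc a b, f t = f a + ∫ x in a..t, g x) {t : ℝ} (ht : t ∈ Ioo a b) :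
    HasDerivAt f (g t) t := by
  have h1 : HasDerivAt (fun s => f a + ∫ x in a..s, g x) (g t) t := by
    refine (intervalIntegral.integral_hasDerivAt_right ?_ ?_ ?_).const_add _
    · exact (hg.mono (Icc_subset_Icc_right ht.2.le)).intervalIntegrable_of_Icc ht.1.le
    · exact (hg.mono Ioo_subset_Icc_self).stronglyMeasurableAtFilter isOpen_Ioo t ht
    · exact hg.continuousAt (Icc_mem_nhds ht.1 ht.2)
  exact h1.congr_of_eventuallyEq (Filter.mem_of_superset (Icc_mem_nhds ht.1 ht.2) h)

theorem controlled_zero_of_integral {f : ℝ → SeqL2} {g : ℝ → ℤ → ℂ} {a b A L : ℝ} (hL : 0 ≤ L)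
    (hf : ContinuousOn f (Icc a b)) (h0 : ∀ t ∈ Icc a b, f t 0 = 0)
    (hg : ∀ n, ContinuousOn (fun t => g t n) (Icc a b))
    (h : ∀ t ∈ Icc a b, ∀ n, f t n = f a n + ∫ x in a..t, g x n)
    (hA : ∀ t ∈ Icc a b, ‖f t‖ ≤ A) (hgL : ∀ t ∈ Icc a b, ∀ n : ℤ, ‖g t n‖ ≤ L * |(n : ℝ)|) :
    Controlled 0 a b (fun t => f t) g A L where
  nonneg := hL
  zero := h0
  cont n := (SeqL2.continuous_apply n).comp_continuousOn hf
  contDeriv := hg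
  deriv n _ ht := hasDerivAt_of_eq_integral (hg n) (fun t ht => h t ht n) ht
  bound t ht := by simpa using SeqL2.sqSumLe_of_norm_le (hA t ht)
  derivBound t ht n := by simpa using hgL t ht n

theorem Controlled.norm_le {f : ℝ → SeqL2} {g : ℝ → ℤ → ℂ} {a b A L : ℝ}
    (h : Controlled 0 a b (fun t => f t) g A L) {t : ℝ} (ht : t ∈ Icc a b) : ‖f t‖ ≤ A :=
  SeqL2.norm_le_of_sqSumLe (by simpa using h.bound t ht)

/-- The source of unconditional uniqueness: continuity in `ℓ²` alone places a solution in the class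
where the main estimate applies. -/
theorem IsMild.controlled {w : ℝ → ℝ} {a b M : ℝ} {v : ℝ → SeqL2} (h : IsMild w a b v)
    (hw : ContinuousOn w (Icc a b)) (hM : ∀ t ∈ Icc a b, ‖v t‖ ≤ M) :
    Controlled 0 a b (fun t => v t) (fun t => bil (w t) (v t) (v t)) M (M ^ 2) :=
  controlled_zero_of_integral (sq_nonneg M) h.cont h.zero
    (fun n => continuousOn_bil hw h.cont h.cont n) h.eq hM fun t ht n => by
      have := norm_bil_le (SeqL2.sqSumLe_of_norm_le (hM t ht))
        (SeqL2.sqSumLe_of_norm_le (hM t ht)) (w t) n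
      rwa [← sq] at this

/-- The bilinear estimate without weights, with the constant `C₀`. -/
def BilBound (γ T C₀ : ℝ) (w : ℝ → ℝ) : Prop :=
  0 ≤ C₀ ∧ ∀ (f f' g g' : ℝ → ℤ → ℂ) (A L A' L' r t : ℝ), 0 ≤ r → r ≤ t → t ≤ T →
      Controlled 0 r t f f' A L → Controlled 0 r t g g' A' L' →
      SqSumLe (fun n => ‖∫ x in r..t, bil (w x) (f x) (g x) n‖)
        (C₀ * (t - r) ^ γ * (A * A' + (t - r) * (A * L' + L * A')))

theorem PhaseDecay.exists_bilBound {ρ γ T C : ℝ} {w : ℝ → ℝ}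
    (hw : PhaseDecay ρ γ T C w) (hρ : 5 / 4 < ρ) : ∃ C₀ : ℝ, BilBound γ T C₀ w := by
  simpa [BilBound] using hw.exists_integral_bil_bound (s := 0) (σ := 0) le_rfl le_rfl (by linarith)

theorem exists_small_time {γ : ℝ} (hγ : 0 < γ) (K : ℝ) {ε : ℝ} (hε : 0 < ε) :
    ∃ h : ℝ, 0 < h ∧ h ≤ 1 ∧ ∀ d : ℝ, 0 ≤ d → d ≤ h → K * d ^ γ ≤ ε := by
  have ht : Tendsto (fun d : ℝ => K * d ^ γ) (𝓝 0) (𝓝 0) := by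
    have := ((Real.continuousAt_rpow_const 0 γ (Or.inr hγ.le)).tendsto).const_mul K
    simpa [Real.zero_rpow hγ.ne'] using this
  obtain ⟨δ, hδ, h⟩ := Metric.eventually_nhds_iff.1 (ht.eventually (gt_mem_nhds hε))
  refine ⟨min 1 (δ / 2), by positivity, min_le_left _ _, fun d hd hdh => (h ?_).le⟩
  rw [Real.dist_eq, sub_zero, abs_of_nonneg hd]
  linarith [hdh.trans (min_le_right _ _)]

/-- The difference of two Duhamel integrals over a short time interval. -/
theorem BilBound.diff_le {γ T C₀ : ℝ} {w : ℝ → ℝ} (hB : BilBound γ T C₀ w)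
    (hw : ContinuousOn w (Icc 0 T)) {M D a t : ℝ}
    {v v' : ℝ → SeqL2} {g g' : ℝ → ℤ → ℂ} (ha : 0 ≤ a) (hat : a ≤ t) (ht : t ≤ T) (h1 : t - a ≤ 1)
    (hM : 0 ≤ M) (hsmall : C₀ * (2 * M + 10 * M ^ 2) * (t - a) ^ γ ≤ 1 / 2)
    (hvc : ContinuousOn v (Icc a t)) (hvc' : ContinuousOn v' (Icc a t))
    (hv : Controlled 0 a t (fun t => v t) g M (M ^ 2))
    (hv' : Controlled 0 a t (fun t => v' t) g' M (M ^ 2))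
    (hd : Controlled 0 a t (fun t => ⇑(v t - v' t)) (fun t n => g t n - g' t n) D (4 * M * D)) :
    SqSumLe (fun n => ‖(∫ x in a..t, bil (w x) (v x) (v x) n) -
      ∫ x in a..t, bil (w x) (v' x) (v' x) n‖) (D / 2) := by
  have hwc : ContinuousOn w (Icc a t) := hw.mono (Icc_subset_Icc ha ht)
  have e : ∀ n, (∫ x in a..t, bil (w x) (v x) (v x) n) - ∫ x in a..t, bil (w x) (v' x) (v' x) n
      = (∫ x in a..t, bil (w x) ⇑(v x - v' x) (v x) n) +
        ∫ x in a..t, bil (w x) (v' x) ⇑(v x - v' x) n := fun n => by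
    have hs : ContinuousOn (fun x => v x - v' x) (Icc a t) := hvc.sub hvc'
    have i1 := (continuousOn_bil hwc hs hvc n).intervalIntegrable_of_Icc (μ := volume) hat
    have i2 := (continuousOn_bil hwc hvc' hs n).intervalIntegrable_of_Icc (μ := volume) hat
    rw [← intervalIntegral.integral_sub
      ((continuousOn_bil hwc hvc hvc n).intervalIntegrable_of_Icc hat)
      ((continuousOn_bil hwc hvc' hvc' n).intervalIntegrable_of_Icc hat),
      ← intervalIntegral.integral_add i1 i2]
    exact intervalIntegral.integral_congr fun x _ => bil_self_sub_self _ _ _ _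
  have hD : 0 ≤ D := (hd.bound t (right_mem_Icc.2 hat)).1
  -- For `t - a ≤ 1` each of the two bilinear terms contributes at most `M D + 5 M² D`, whence `2M +
  -- 10M²` in `hsmall`.
  have b1 := hB.2 _ _ _ _ _ _ _ _ _ _ ha hat ht hd hv
  have b2 := hB.2 _ _ _ _ _ _ _ _ _ _ ha hat ht hv' hd
  have hC := hB.1
  have hp : 0 ≤ (t - a) ^ γ := Real.rpow_nonneg (sub_nonneg.2 hat) γ
  refine ((b1.add b2).mono_right ?_).mono fun n => ?_
  · have hq : (t - a) * (D * M ^ 2 + 4 * M * D * M) ≤ D * M ^ 2 + 4 * M * D * M :=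
      mul_le_of_le_one_left (by positivity) h1
    have hq' : (t - a) * (M * (4 * M * D) + M ^ 2 * D) ≤ M * (4 * M * D) + M ^ 2 * D :=
      mul_le_of_le_one_left (by positivity) h1
    have hCp : 0 ≤ C₀ * (t - a) ^ γ := by positivity
    have h2 := mul_le_mul_of_nonneg_left hq hCp
    have h3 := mul_le_mul_of_nonneg_left hq' hCp
    have h4 := mul_le_mul_of_nonneg_right hsmall hD
    nlinarith
  · rw [abs_norm, e]
    exact (norm_add_le _ _).trans (le_abs_self _)

/-! ### Uniqueness -/

theorem IsMild.mono {w : ℝ → ℝ} {a b a' b' : ℝ} {v : ℝ → SeqL2} (h : IsMild w a b v)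
    (hw : ContinuousOn w (Icc a b)) (ha : a ≤ a') (hab : a' ≤ b') (hb : b' ≤ b) :
    IsMild w a' b' v where
  cont := h.cont.mono (Icc_subset_Icc ha hb)
  zero t ht := h.zero t (Icc_subset_Icc ha hb ht)
  eq t ht n := by
    rw [h.eq t (Icc_subset_Icc ha hb ht) n, h.eq a' ⟨ha, hab.trans hb⟩ n, add_assoc,
      intervalIntegral.integral_add_adjacent_intervals]
    · exact ((continuousOn_bil hw h.cont h.cont n).mono
        (Icc_subset_Icc_right (hab.trans hb))).intervalIntegrable_of_Icc ha
    · exact ((continuousOn_bil hw h.cont h.cont n).mono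
        (Icc_subset_Icc ha (ht.2.trans hb))).intervalIntegrable_of_Icc ht.1

/-- Starting from the trivial bound `2M`, each use of `BilBound.diff_le` halves the bound for the
difference. -/
theorem BilBound.eq_of_short {γ T C₀ : ℝ} {w : ℝ → ℝ} (hB : BilBound γ T C₀ w)
    (hw : ContinuousOn w (Icc 0 T)) {M a b : ℝ} {v v' : ℝ → SeqL2} (ha : 0 ≤ a)
    (hb : b ≤ T) (h1 : b - a ≤ 1) (hM : 0 ≤ M)
    (hsmall : ∀ d, 0 ≤ d → d ≤ b - a → C₀ * (2 * M + 10 * M ^ 2) * d ^ γ ≤ 1 / 2)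
    (hv : IsMild w a b v) (hv' : IsMild w a b v') (hvM : ∀ t ∈ Icc a b, ‖v t‖ ≤ M)
    (hvM' : ∀ t ∈ Icc a b, ‖v' t‖ ≤ M) (hinit : v a = v' a) : ∀ t ∈ Icc a b, v t = v' t := by
  have hwc : ContinuousOn w (Icc a b) := hw.mono (Icc_subset_Icc ha hb)
  have hc := hv.controlled hwc hvM
  have hc' := hv'.controlled hwc hvM'
  have key : ∀ k : ℕ, ∀ t ∈ Icc a b, ‖v t - v' t‖ ≤ 2 * M / 2 ^ k := by
    intro k
    induction k with
    | zero =>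
      intro t ht
      refine (norm_sub_le _ _).trans ?_
      rw [pow_zero, div_one]
      linarith [hvM t ht, hvM' t ht]
    | succ k ih =>
      intro t ht
      set D := 2 * M / 2 ^ k with hD
      have hD0 : 0 ≤ D := by positivity
      -- For two solutions `2 * M * D` would do; `4 * M * D` is the form of `BilBound.diff_le`,
      -- shared with the Picard iteration.
      have hcd : Controlled 0 a b (fun t => ⇑(v t - v' t))
          (fun t n => bil (w t) (v t) (v t) n - bil (w t) (v' t) (v' t) n) D (4 * M * D) := by
        refine controlled_zero_of_integral (f := fun t => v t - v' t) (by positivity)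
          (hv.cont.sub hv'.cont) (fun t ht => ?_) (fun n =>
            (hc.contDeriv n).sub (hc'.contDeriv n)) (fun t ht n => ?_) ih fun t ht n => ?_
        · rw [lp.coeFn_sub, Pi.sub_apply, hv.zero t ht, hv'.zero t ht, sub_zero]
        · rw [lp.coeFn_sub, Pi.sub_apply, lp.coeFn_sub, Pi.sub_apply, hv.eq t ht n, hv'.eq t ht n,
            intervalIntegral.integral_sub]
          · ring
          · exact ((hc.contDeriv n).mono
              (Icc_subset_Icc_right ht.2)).intervalIntegrable_of_Icc ht.1
          · exact ((hc'.contDeriv n).mono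
              (Icc_subset_Icc_right ht.2)).intervalIntegrable_of_Icc ht.1
        · refine (norm_bil_self_sub_self_le (hvM t ht) (hvM' t ht) (ih t ht) _ n).trans ?_
          gcongr
          norm_num
      have hsub : Icc a t ⊆ Icc a b := Icc_subset_Icc_right ht.2
      have := hB.diff_le hw ha ht.1 (ht.2.trans hb) (by linarith [ht.2]) hM
        (hsmall _ (by linarith [ht.1]) (by linarith [ht.2])) (hv.cont.mono hsub)
        (hv'.cont.mono hsub) (hc.mono le_rfl ht.2) (hc'.mono le_rfl ht.2) (hcd.mono le_rfl ht.2)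
      have e : 2 * M / 2 ^ (k + 1) = D / 2 := by rw [hD, pow_succ]; field_simp
      rw [e]
      refine SeqL2.norm_le_of_sqSumLe (this.mono fun n => ?_)
      rw [abs_norm, abs_norm, lp.coeFn_sub, Pi.sub_apply, hv.eq t ht n, hv'.eq t ht n, hinit,
        add_sub_add_left_eq_sub]
  intro t ht
  rw [← sub_eq_zero, ← norm_le_zero_iff]
  refine ge_of_tendsto' (x := atTop) ?_ fun k => key k t ht
  simpa [div_eq_mul_inv] using ((tendsto_pow_atTop_nhds_zero_of_lt_one (r := (2 : ℝ)⁻¹)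
    (by norm_num) (by norm_num)).const_mul (2 * M))

/-- Both solutions are bounded on the compact interval, which fixes one step length for the whole
induction. -/
theorem IsMild.unique {ρ γ T C : ℝ} {w : ℝ → ℝ} (hw : PhaseDecay ρ γ T C w) (hρ : 5 / 4 < ρ)
    {τ : ℝ} (hτ : τ ≤ T) {v v' : ℝ → SeqL2} (hv : IsMild w 0 τ v) (hv' : IsMild w 0 τ v')
    (hinit : v 0 = v' 0) : EqOn v v' (Icc 0 τ) := by
  obtain ⟨C₀, hB⟩ := hw.exists_bilBound hρ
  obtain ⟨M₁, hM₁⟩ := isCompact_Icc.exists_bound_of_continuousOn hv.cont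
  obtain ⟨M₂, hM₂⟩ := isCompact_Icc.exists_bound_of_continuousOn hv'.cont
  set M := max 0 (max M₁ M₂)
  have hM : 0 ≤ M := le_max_left _ _
  have hvM : ∀ t ∈ Icc 0 τ, ‖v t‖ ≤ M := fun t ht =>
    (hM₁ t ht).trans ((le_max_left _ _).trans (le_max_right _ _))
  have hvM' : ∀ t ∈ Icc 0 τ, ‖v' t‖ ≤ M := fun t ht =>
    (hM₂ t ht).trans ((le_max_right _ _).trans (le_max_right _ _))
  obtain ⟨h, hh0, hh1, hsmall⟩ := exists_small_time hw.pos (C₀ * (2 * M + 10 * M ^ 2))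
    (ε := 1 / 2) (by norm_num)
  have hwc : ContinuousOn w (Icc 0 τ) := hw.cont.mono (Icc_subset_Icc_right hτ)
  have key : ∀ k : ℕ, ∀ t ∈ Icc 0 τ, t ≤ k * h → v t = v' t := by
    intro k
    induction k with
    | zero =>
      intro t ht htk
      have : t = 0 := le_antisymm (by simpa using htk) ht.1
      rw [this, hinit]
    | succ k ih =>
      intro t ht htk
      rcases le_total t (k * h) with hle | hle
      · exact ih t ht hle
      have ha : (0 : ℝ) ≤ k * h := by positivity
      push_cast at htk
      refine hB.eq_of_short hw.cont ha (ht.2.trans hτ) (by linarith) hM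
        (fun d hd hdt => hsmall d hd (by linarith)) (hv.mono hwc ha hle ht.2)
        (hv'.mono hwc ha hle ht.2) (fun s hs => hvM s ⟨ha.trans hs.1, hs.2.trans ht.2⟩)
        (fun s hs => hvM' s ⟨ha.trans hs.1, hs.2.trans ht.2⟩)
        (ih _ ⟨ha, hle.trans ht.2⟩ le_rfl) t (right_mem_Icc.2 hle)
  intro t ht
  obtain ⟨k, hk⟩ := exists_nat_ge (t / h)
  exact key k t ht ((div_le_iff₀ hh0).1 hk)

/-! ### Local existence -/

/-- The symmetry of the Fourier coefficients of a real-valued function. -/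
def IsRealSeq (f : ℤ → ℂ) : Prop := ∀ n, f (-n) = (starRingEnd ℂ) (f n)

theorem conj_resPhase (θ : ℝ) (n m : ℤ) :
    (starRingEnd ℂ) (resPhase θ n m) = resPhase θ (-n) (-m) := by
  rw [resPhase, resPhase, ← Complex.exp_conj, map_mul, Complex.conj_I, Complex.conj_ofReal]
  congr 1
  push_cast
  ring

theorem IsRealSeq.bil {f : ℤ → ℂ} (hf : IsRealSeq f) (θ : ℝ) : IsRealSeq (bil θ f f) := by
  intro n
  unfold ModulatedKdV.bil
  rw [map_mul, map_mul, Complex.conj_I, map_intCast, Complex.conj_tsum,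
    ← (Equiv.neg ℤ).tsum_eq fun m => resPhase θ (-n) m * (f m * f (-n - m))]
  push_cast
  rw [mul_neg, neg_mul, neg_mul, neg_mul]
  congr 2
  refine tsum_congr fun m => ?_
  rw [map_mul, map_mul, conj_resPhase, ← hf, ← hf, Equiv.neg_apply, neg_sub_neg, neg_sub]

/-- The Duhamel operator with initial time `a` and initial condition `x`. -/
def duhamel (w : ℝ → ℝ) (a : ℝ) (x : SeqL2) (v : ℝ → SeqL2) (t : ℝ) : SeqL2 :=
  toSeq fun n => x n + ∫ s in a..t, bil (w s) (v s) (v s) n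

/-- The class of functions in which the Duhamel operator is a contraction. -/
structure IsAdmissible (a b : ℝ) (x : SeqL2) (M : ℝ) (v : ℝ → SeqL2) (g : ℝ → ℤ → ℂ) : Prop where
  cont : ContinuousOn v (Icc a b)
  contDeriv : ∀ n, ContinuousOn (fun t => g t n) (Icc a b)
  eq : ∀ t ∈ Icc a b, ∀ n, v t n = x n + ∫ s in a..t, g s n
  control : Controlled 0 a b (fun t => v t) g M (M ^ 2)

theorem toSeq_apply_of_sqSumLe {f : ℤ → ℂ} {A : ℝ} (h : SqSumLe (fun n => ‖f n‖) A) (n : ℤ) :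
    toSeq f n = f n :=
  toSeq_apply h.memℓp n

theorem continuousOn_of_norm_sub_le {E : Type*} [NormedAddCommGroup E] {f : ℝ → E} {a b K γ : ℝ}
    (hγ : 0 < γ) (h : ∀ r t, a ≤ r → r ≤ t → t ≤ b → ‖f t - f r‖ ≤ K * (t - r) ^ γ) :
    ContinuousOn f (Icc a b) := by
  intro r hr
  rw [ContinuousWithinAt, tendsto_iff_norm_sub_tendsto_zero]
  have ht : Tendsto (fun t => K * |t - r| ^ γ) (𝓝[Icc a b] r) (𝓝 0) := by
    have h2 : Continuous fun t : ℝ => K * |t - r| ^ γ :=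
      continuous_const.mul ((continuous_abs.comp (continuous_id.sub continuous_const)).rpow_const
        fun _ => Or.inr hγ.le)
    have := (h2.tendsto r).mono_left (nhdsWithin_le_nhds (s := Icc a b))
    simpa [Real.zero_rpow hγ.ne'] using this
  refine squeeze_zero' (Eventually.of_forall fun _ => norm_nonneg _) ?_ ht
  filter_upwards [self_mem_nhdsWithin] with t ht
  rcases le_total r t with hrt | htr
  · rw [abs_of_nonneg (sub_nonneg.2 hrt)]
    exact h r t hr.1 hrt ht.2
  · rw [abs_of_nonpos (sub_nonpos.2 htr), neg_sub, norm_sub_rev]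
    exact h t r ht.1 htr hr.2

/-- The derivative of the output is the nonlinearity at the input, so the class carries the
derivative `g` as separate data. Half of the radius `M` is spent on `x`, half on the integral; the
factor `(t - r)^γ` gives continuity in time. -/
theorem IsAdmissible.duhamel_step {γ T C₀ : ℝ} {w : ℝ → ℝ} (hB : BilBound γ T C₀ w) (hγ : 0 < γ)
    (hw : ContinuousOn w (Icc 0 T)) {M a b : ℝ} (ha : 0 ≤ a) (hb : b ≤ T)
    (h1 : b - a ≤ 1) (hM : 0 ≤ M) {x : SeqL2} (hx : ‖x‖ ≤ M / 2) (hx0 : x 0 = 0)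
    (hsmall : ∀ d, 0 ≤ d → d ≤ b - a → C₀ * (M ^ 2 + 2 * M ^ 3) * d ^ γ ≤ M / 2)
    {v : ℝ → SeqL2} {g : ℝ → ℤ → ℂ} (hv : IsAdmissible a b x M v g) :
    IsAdmissible a b x M (duhamel w a x v) fun t => bil (w t) (v t) (v t) := by
  have hwc : ContinuousOn w (Icc a b) := hw.mono (Icc_subset_Icc ha hb)
  have hbc : ∀ n, ContinuousOn (fun t => bil (w t) (v t) (v t) n) (Icc a b) := fun n =>
    continuousOn_bil hwc hv.cont hv.cont n
  have hC := hB.1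
  have hint : ∀ r t, a ≤ r → r ≤ t → t ≤ b →
      SqSumLe (fun n => ‖∫ s in r..t, bil (w s) (v s) (v s) n‖)
        (C₀ * (M ^ 2 + 2 * M ^ 3) * (t - r) ^ γ) := fun r t har hrt htb => by
    have hc := hv.control.mono har htb
    refine (hB.2 _ _ _ _ _ _ _ _ _ _ (ha.trans har) hrt (htb.trans hb) hc hc).mono_right ?_
    have hp : 0 ≤ (t - r) ^ γ := Real.rpow_nonneg (sub_nonneg.2 hrt) γ
    have hq : (t - r) * (M * M ^ 2 + M ^ 2 * M) ≤ M * M ^ 2 + M ^ 2 * M :=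
      mul_le_of_le_one_left (by positivity) (by linarith)
    have := mul_le_mul_of_nonneg_left hq (mul_nonneg hC hp)
    nlinarith
  have hsq : ∀ t ∈ Icc a b, SqSumLe (fun n => ‖x n + ∫ s in a..t, bil (w s) (v s) (v s) n‖) M :=
    fun t ht => by
    refine ((x.sqSumLe.add (hint a t le_rfl ht.1 ht.2)).mono fun n => ?_).mono_right ?_
    · rw [abs_norm]; exact (norm_add_le _ _).trans (le_abs_self _)
    · linarith [hsmall (t - a) (by linarith [ht.1]) (by linarith [ht.2])]
  have heq : ∀ t ∈ Icc a b, ∀ n,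
      duhamel w a x v t n = x n + ∫ s in a..t, bil (w s) (v s) (v s) n := fun t ht n =>
    toSeq_apply_of_sqSumLe (hsq t ht) n
  have hstep : ∀ r t, a ≤ r → r ≤ t → t ≤ b → ‖duhamel w a x v t - duhamel w a x v r‖ ≤
      C₀ * (M ^ 2 + 2 * M ^ 3) * (t - r) ^ γ := fun r t har hrt htb => by
    refine SeqL2.norm_le_of_sqSumLe ((hint r t har hrt htb).mono fun n => ?_)
    rw [abs_norm, abs_norm, lp.coeFn_sub, Pi.sub_apply, heq t ⟨har.trans hrt, htb⟩,
      heq r ⟨har, hrt.trans htb⟩, add_sub_add_left_eq_sub,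
      intervalIntegral.integral_interval_sub_left]
    · exact ((hbc n).mono (Icc_subset_Icc_right htb)).intervalIntegrable_of_Icc (har.trans hrt)
    · exact ((hbc n).mono (Icc_subset_Icc_right (hrt.trans htb))).intervalIntegrable_of_Icc har
  have hcont : ContinuousOn (duhamel w a x v) (Icc a b) :=
    continuousOn_of_norm_sub_le hγ hstep
  refine ⟨hcont, hbc, heq, controlled_zero_of_integral (sq_nonneg M) hcont (fun t ht => ?_) hbc
    (fun t ht n => ?_) (fun t ht => SeqL2.norm_le_of_sqSumLe ?_) fun t ht n => ?_⟩
  · rw [heq t ht, hx0]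
    simp [bil]
  · rw [heq t ht, heq a ⟨le_rfl, ht.1.trans ht.2⟩, intervalIntegral.integral_same, add_zero]
  · simpa only [heq t ht] using hsq t ht
  · have := norm_bil_le (SeqL2.sqSumLe_of_norm_le (hv.control.norm_le ht))
        (SeqL2.sqSumLe_of_norm_le (hv.control.norm_le ht)) (w t) n
    rwa [← sq] at this

theorem IsAdmissible.sub_controlled {a b M D : ℝ} {x : SeqL2} {v v' : ℝ → SeqL2}
    {g g' : ℝ → ℤ → ℂ} (hM : 0 ≤ M) (hD : 0 ≤ D) (hv : IsAdmissible a b x M v g)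
    (hv' : IsAdmissible a b x M v' g') (h : ∀ t ∈ Icc a b, ‖v t - v' t‖ ≤ D)
    (hg : ∀ t ∈ Icc a b, ∀ n : ℤ, ‖g t n - g' t n‖ ≤ 4 * M * D * |(n : ℝ)|) :
    Controlled 0 a b (fun t => ⇑(v t - v' t)) (fun t n => g t n - g' t n) D (4 * M * D) := by
  refine controlled_zero_of_integral (f := fun t => v t - v' t) (by positivity)
    (hv.cont.sub hv'.cont) (fun t ht => ?_) (fun n => (hv.contDeriv n).sub (hv'.contDeriv n))
    (fun t ht n => ?_) h hg
  · have h1 := hv.control.zero t ht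
    have h2 := hv'.control.zero t ht
    rw [lp.coeFn_sub, Pi.sub_apply, h1, h2, sub_zero]
  · have ha : a ∈ Icc a b := ⟨le_rfl, ht.1.trans ht.2⟩
    rw [lp.coeFn_sub, Pi.sub_apply, lp.coeFn_sub, Pi.sub_apply, hv.eq t ht n, hv'.eq t ht n,
      hv.eq a ha n, hv'.eq a ha n, intervalIntegral.integral_sub, intervalIntegral.integral_same,
      intervalIntegral.integral_same]
    · ring
    · exact ((hv.contDeriv n).mono (Icc_subset_Icc_right ht.2)).intervalIntegrable_of_Icc ht.1
    · exact ((hv'.contDeriv n).mono (Icc_subset_Icc_right ht.2)).intervalIntegrable_of_Icc ht.1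

theorem BilBound.exists_isMild_short {γ T C₀ : ℝ} {w : ℝ → ℝ} (hB : BilBound γ T C₀ w)
    (hγ : 0 < γ) (hw : ContinuousOn w (Icc 0 T)) {M a b : ℝ} (ha : 0 ≤ a) (hab : a ≤ b)
    (hb : b ≤ T) (h1 : b - a ≤ 1) (hM : 0 ≤ M) {x : SeqL2} (hx : ‖x‖ ≤ M / 2) (hx0 : x 0 = 0)
    (hsmall : ∀ d, 0 ≤ d → d ≤ b - a → C₀ * (M ^ 2 + 2 * M ^ 3) * d ^ γ ≤ M / 2)
    (hsmall' : ∀ d, 0 ≤ d → d ≤ b - a → C₀ * (2 * M + 10 * M ^ 2) * d ^ γ ≤ 1 / 2) :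
    ∃ v : ℝ → SeqL2, IsMild w a b v ∧ v a = x ∧
      (IsRealSeq x → ∀ t ∈ Icc a b, IsRealSeq (v t)) := by
  have hwc : ContinuousOn w (Icc a b) := hw.mono (Icc_subset_Icc ha hb)
  set V : ℕ → ℝ → SeqL2 := fun k => (duhamel w a x)^[k] fun _ => x with hV
  have hVs : ∀ k, V (k + 1) = duhamel w a x (V k) := fun k => Function.iterate_succ_apply' _ _ _
  -- `G k` is the time derivative of `V k`: zero for the constant initial iterate, afterwards the
  -- nonlinearity at the previous iterate.
  set G : ℕ → ℝ → ℤ → ℂ := fun k => Nat.casesOn k (fun _ _ => 0)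
    fun k t => bil (w t) (V k t) (V k t) with hG
  have hG0 : ∀ t n, G 0 t n = 0 := fun _ _ => rfl
  have hadm : ∀ k, IsAdmissible a b x M (V k) (G k) := by
    intro k
    induction k with
    | zero =>
      refine ⟨continuousOn_const, fun n => continuousOn_const, fun t ht n => ?_,
        controlled_zero_of_integral (sq_nonneg M) continuousOn_const (fun _ _ => hx0)
          (fun n => continuousOn_const) (fun t ht n => ?_) (fun t ht => ?_) fun t ht n => ?_⟩
      · simp [hV, hG]
      · simp [hV, hG]
      · exact hx.trans (by linarith)
      · rw [hG0, norm_zero]; positivity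
    | succ k ih =>
      rw [hVs]
      exact ih.duhamel_step hB hγ hw ha hb h1 hM hx hx0 hsmall
  have hVM : ∀ k, ∀ t ∈ Icc a b, ‖V k t‖ ≤ M := fun k t ht => (hadm k).control.norm_le ht
  -- Iterates and derivatives are compared together. The derivatives lag one step: their difference
  -- is bounded through the previous `D` by `2M D = 4M (D/2)`, which explains the factor `4`.
  have hdiff : ∀ k : ℕ, (∀ t ∈ Icc a b, ‖V (k + 1) t - V k t‖ ≤ 2 * M / 2 ^ k) ∧
      ∀ t ∈ Icc a b, ∀ n : ℤ, ‖G (k + 1) t n - G k t n‖ ≤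
        4 * M * (2 * M / 2 ^ k) * |(n : ℝ)| := by
    intro k
    induction k with
    | zero =>
      refine ⟨fun t ht => ?_, fun t ht n => ?_⟩
      · rw [pow_zero, div_one]
        exact (norm_sub_le _ _).trans (by linarith [hVM 1 t ht, hVM 0 t ht])
      · have := (hadm 1).control.derivBound t ht n
        rw [Real.rpow_zero, one_mul] at this
        rw [pow_zero, div_one]
        rw [hG0, sub_zero]
        refine this.trans (mul_le_mul_of_nonneg_right ?_ (abs_nonneg _))
        nlinarith [sq_nonneg M]
    | succ k ih =>
      set D := 2 * M / 2 ^ k with hD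
      have hD0 : 0 ≤ D := by positivity
      have e : 2 * M / 2 ^ (k + 1) = D / 2 := by rw [hD, pow_succ]; field_simp
      rw [e]
      refine ⟨fun t ht => ?_, fun t ht n => ?_⟩
      · have hsub : Icc a t ⊆ Icc a b := Icc_subset_Icc_right ht.2
        have hcd := (hadm (k + 1)).sub_controlled hM hD0 (hadm k) ih.1 ih.2
        have := hB.diff_le hw ha ht.1 (ht.2.trans hb) (by linarith [ht.2]) hM
          (hsmall' _ (by linarith [ht.1]) (by linarith [ht.2])) ((hadm (k + 1)).cont.mono hsub)
          ((hadm k).cont.mono hsub) ((hadm (k + 1)).control.mono le_rfl ht.2)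
          ((hadm k).control.mono le_rfl ht.2) (hcd.mono le_rfl ht.2)
        refine SeqL2.norm_le_of_sqSumLe (this.mono fun n => ?_)
        rw [abs_norm, abs_norm, lp.coeFn_sub, Pi.sub_apply, (hadm (k + 2)).eq t ht n,
          (hadm (k + 1)).eq t ht n, add_sub_add_left_eq_sub]
      · refine (norm_bil_self_sub_self_le (hVM (k + 1) t ht) (hVM k t ht) (ih.1 t ht) _ n).trans
          (le_of_eq (by ring))
  have hdist : ∀ t ∈ Icc a b, ∀ k, dist (V k t) (V (k + 1) t) ≤ 4 * M / 2 / 2 ^ k :=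
    fun t ht k => by
    rw [dist_comm, dist_eq_norm]
    exact ((hdiff k).1 t ht).trans (le_of_eq (by ring))
  have hex : ∀ t, ∃ y, t ∈ Icc a b → Tendsto (fun k => V k t) atTop (𝓝 y) := fun t => by
    by_cases ht : t ∈ Icc a b
    · obtain ⟨y, hy⟩ := cauchySeq_tendsto_of_complete (cauchySeq_of_le_geometric_two (hdist t ht))
      exact ⟨y, fun _ => hy⟩
    · exact ⟨0, fun h => absurd h ht⟩
  choose v hv using hex
  have hlim : ∀ t ∈ Icc a b, ∀ k, dist (V k t) (v t) ≤ 4 * M / 2 ^ k := fun t ht k =>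
    dist_le_of_le_geometric_two_of_tendsto (hdist t ht) (hv t ht) k
  have hpow : Tendsto (fun k : ℕ => 4 * M / 2 ^ k) atTop (𝓝 0) := by
    simpa [div_eq_mul_inv] using ((tendsto_pow_atTop_nhds_zero_of_lt_one (r := (2 : ℝ)⁻¹)
      (by norm_num) (by norm_num)).const_mul (4 * M))
  have hcont : ContinuousOn v (Icc a b) := by
    refine TendstoUniformlyOn.continuousOn (F := V) (p := atTop) ?_
      (Eventually.of_forall fun k => (hadm k).cont).frequently
    rw [Metric.tendstoUniformlyOn_iff]
    intro ε hε
    filter_upwards [hpow.eventually (gt_mem_nhds hε)] with k hk t ht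
    rw [dist_comm]
    exact (hlim t ht k).trans_lt hk
  have hvM : ∀ t ∈ Icc a b, ‖v t‖ ≤ M := fun t ht =>
    le_of_tendsto' (hv t ht).norm fun k => hVM k t ht
  have hcoord : ∀ t ∈ Icc a b, ∀ n, Tendsto (fun k => V k t n) atTop (𝓝 (v t n)) :=
    fun t ht n => ((SeqL2.continuous_apply n).tendsto _).comp (hv t ht)
  have heq : ∀ t ∈ Icc a b, ∀ n, v t n = x n + ∫ s in a..t, bil (w s) (v s) (v s) n := by
    intro t ht n
    refine tendsto_nhds_unique ((tendsto_add_atTop_iff_nat 1).2 (hcoord t ht n)) ?_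
    have e : ∀ k, V (k + 1) t n = x n + ∫ s in a..t, bil (w s) (V k s) (V k s) n := fun k =>
      (hadm (k + 1)).eq t ht n
    simp_rw [e]
    refine tendsto_const_nhds.add ?_
    rw [tendsto_iff_norm_sub_tendsto_zero]
    have hz : Tendsto (fun k : ℕ => 2 * M * (4 * M / 2 ^ k) * |(n : ℝ)| * |t - a|) atTop (𝓝 0) := by
      simpa using ((hpow.const_mul (2 * M)).mul_const |(n : ℝ)|).mul_const |t - a|
    refine squeeze_zero (fun _ => norm_nonneg _) (fun k => ?_) hz
    have hsub : Icc a t ⊆ Icc a b := Icc_subset_Icc_right ht.2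
    rw [← intervalIntegral.integral_sub
      (((continuousOn_bil hwc (hadm k).cont (hadm k).cont n).mono hsub).intervalIntegrable_of_Icc
        ht.1) (((continuousOn_bil hwc hcont hcont n).mono hsub).intervalIntegrable_of_Icc ht.1)]
    refine intervalIntegral.norm_integral_le_of_norm_le_const fun s hs => ?_
    rw [uIoc_of_le ht.1] at hs
    have hs' : s ∈ Icc a b := ⟨hs.1.le, hs.2.trans ht.2⟩
    refine norm_bil_self_sub_self_le (hVM k s hs') (hvM s hs') ?_ _ n
    rw [← dist_eq_norm]
    exact hlim s hs' k
  have haI : a ∈ Icc a b := left_mem_Icc.2 hab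
  have hva : v a = x := by
    ext n
    rw [heq a haI n, intervalIntegral.integral_same, add_zero]
  refine ⟨v, ⟨hcont, fun t ht => ?_, fun t ht n => ?_⟩, hva, fun hxr t ht n => ?_⟩
  · rw [heq t ht, hx0]; simp [bil]
  · rw [hva]; exact heq t ht n
  · have hr : ∀ k, ∀ t ∈ Icc a b, IsRealSeq (V k t) := by
      intro k
      induction k with
      | zero => exact fun _ _ => hxr
      | succ k ih =>
        intro t ht n
        rw [(hadm (k + 1)).eq t ht, (hadm (k + 1)).eq t ht, map_add, hxr n,
          ← intervalIntegral.intervalIntegral_conj]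
        congr 1
        refine intervalIntegral.integral_congr fun s hs => ?_
        rw [uIcc_of_le ht.1] at hs
        exact (ih s ⟨hs.1, hs.2.trans ht.2⟩).bil (w s) n
    refine tendsto_nhds_unique (hcoord t ht (-n)) ?_
    have := (Complex.continuous_conj.tendsto _).comp (hcoord t ht n)
    exact this.congr fun k => (hr k t ht n).symm

/-- Local existence, on a time interval whose length depends only on the size of the data. -/
theorem PhaseDecay.exists_isMild {ρ γ T C : ℝ} {w : ℝ → ℝ} (hw : PhaseDecay ρ γ T C w)
    (hρ : 5 / 4 < ρ) (R : ℝ) : ∃ h : ℝ, 0 < h ∧ ∀ a b : ℝ, 0 ≤ a → a ≤ b → b ≤ T → b - a ≤ h →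
      ∀ x : SeqL2, ‖x‖ ≤ R → x 0 = 0 → ∃ v : ℝ → SeqL2, IsMild w a b v ∧ v a = x ∧
        (IsRealSeq x → ∀ t ∈ Icc a b, IsRealSeq (v t)) := by
  obtain ⟨C₀, hB⟩ := hw.exists_bilBound hρ
  -- This ensures `‖x‖ ≤ M / 2`; the summand `1` keeps `M` positive when `R = 0`.
  set M := 2 * |R| + 1 with hM
  have hM0 : 0 < M := by positivity
  obtain ⟨h, hh0, hh1, hs⟩ := exists_small_time hw.pos (C₀ * (M ^ 2 + 2 * M ^ 3)) (half_pos hM0)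
  obtain ⟨h', hh0', -, hs'⟩ := exists_small_time hw.pos (C₀ * (2 * M + 10 * M ^ 2))
    (ε := 1 / 2) (by norm_num)
  refine ⟨min h h', lt_min hh0 hh0', fun a b ha hab hb hba x hx hx0 => ?_⟩
  have h1 := hba.trans (min_le_left _ _)
  have h2 := hba.trans (min_le_right _ _)
  exact hB.exists_isMild_short hw.pos hw.cont ha hab hb (h1.trans hh1) hM0.le
    (by rw [hM]; linarith [le_abs_self R]) hx0 (fun d hd hdb => hs d hd (hdb.trans h1))
    fun d hd hdb => hs' d hd (hdb.trans h2)

/-! ### Conservation of the `L²` norm -/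

/-- The contribution of the frequencies `m` and `n - m` to the change of `vₙ v₋ₙ`. -/
def cubicTerm (w : ℝ → ℝ) (a t : ℝ) (v : ℝ → SeqL2) (n m : ℤ) : ℂ :=
  ∫ s in a..t, resPhase (w s) n m * (v s m * v s (n - m) * v s (-n))

/-- The majorant of `cubicTerm` at a fixed time. -/
def cubicMajorant (α : ℝ) (x : SeqL2) (n m : ℤ) : ℝ :=
  resKernel α n m * ‖x m‖ * (‖x (-n)‖ + ‖x (n - m)‖)

theorem cubicMajorant_nonneg (α : ℝ) (x : SeqL2) (n m : ℤ) : 0 ≤ cubicMajorant α x n m :=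
  mul_nonneg (mul_nonneg (resKernel_nonneg _ _ _) (norm_nonneg _)) (by positivity)

theorem exists_sum_cubicMajorant_le {α : ℝ} (hα : 1 / 4 < α) :
    ∃ C : ℝ, 0 ≤ C ∧ ∀ (x : SeqL2) (M : ℝ), ‖x‖ ≤ M → ∀ F : Finset (ℤ × ℤ),
      ∑ p ∈ F, cubicMajorant α x p.1 p.2 ≤ C * M ^ 2 := by
  obtain ⟨C, hC, h⟩ := exists_resKernel_trilinear hα
  refine ⟨2 * C, by positivity, fun x M hM F => ?_⟩
  have hx := SeqL2.sqSumLe_of_norm_le hM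
  refine (h (fun m => ‖x m‖) (fun n m => ‖x (-n)‖ + ‖x (n - m)‖) M (M + M)
    (fun _ => norm_nonneg _) (fun _ _ => by positivity) hx (fun m => ?_) F).trans (le_of_eq (by ring))
  exact (hx.comp_injective neg_injective).add (hx.comp_injective (sub_left_injective (b := m)))

/-- The integration by parts of the main estimate, now with three factors. The derivative costs
`|m|`, `|n-m|` or `|n|`, according to the factor it hits. -/
theorem IsMild.cubicTerm_le {ρ γ T C : ℝ} {w : ℝ → ℝ} (hw : PhaseDecay ρ γ T C w) {M a t : ℝ}
    (ha : 0 ≤ a) (hat : a ≤ t) (htT : t ≤ T) {v : ℝ → SeqL2} (hv : IsMild w a t v)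
    (hM : ∀ s ∈ Icc a t, ‖v s‖ ≤ M) (n m : ℤ) :
    |(n : ℝ)| * ‖cubicTerm w a t v n m‖ ≤ C * (t - a) ^ γ * (M * cubicMajorant (ρ - 1) (v t) n m +
      M ^ 2 * ∫ s in a..t,
        (cubicMajorant (ρ - 1) (v s) n m + cubicMajorant (ρ - 1) (v s) n (n - m))) := by
  have htm : t ∈ Icc a t := right_mem_Icc.2 hat
  have hM0 : 0 ≤ M := (norm_nonneg _).trans (hM t htm)
  have hC := hw.nonneg
  have hd : 0 ≤ (t - a) ^ γ := Real.rpow_nonneg (sub_nonneg.2 hat) γ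
  have hS0 := cubicMajorant_nonneg (ρ - 1) (v t) n m
  have hI0 : 0 ≤ ∫ s in a..t,
      (cubicMajorant (ρ - 1) (v s) n m + cubicMajorant (ρ - 1) (v s) n (n - m)) :=
    intervalIntegral.integral_nonneg hat fun s _ =>
      add_nonneg (cubicMajorant_nonneg _ _ _ _) (cubicMajorant_nonneg _ _ _ _)
  have hRHS : 0 ≤ C * (t - a) ^ γ * (M * cubicMajorant (ρ - 1) (v t) n m +
      M ^ 2 * ∫ s in a..t,
        (cubicMajorant (ρ - 1) (v s) n m + cubicMajorant (ρ - 1) (v s) n (n - m))) := by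
    positivity
  rcases eq_or_ne n 0 with rfl | hn
  · simpa using hRHS
  rcases eq_or_ne m 0 with rfl | hm
  · rw [cubicTerm, intervalIntegral.integral_congr (g := fun _ => (0 : ℂ)) fun x hx => by
      simp [hv.zero x (uIcc_of_le hat ▸ hx)]]
    simpa using hRHS
  rcases eq_or_ne (n - m) 0 with hnm | hnm
  · rw [cubicTerm, intervalIntegral.integral_congr (g := fun _ => (0 : ℂ)) fun x hx => by
      simp [hnm, hv.zero x (uIcc_of_le hat ▸ hx)]]
    simpa using hRHS
  have hwc : ContinuousOn w (Icc a t) := hw.cont.mono (Icc_subset_Icc ha htT)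
  have hc := hv.controlled hwc hM
  set g : ℝ → ℤ → ℂ := fun s => bil (w s) (v s) (v s)
  have hvc : ∀ k, ContinuousOn (fun s => v s k) (Icc a t) := hc.cont
  have hgc : ∀ k, ContinuousOn (fun s => g s k) (Icc a t) := hc.contDeriv
  set N := resAbs n m ^ (-ρ) with hN
  have hN0 : 0 ≤ N := Real.rpow_nonneg (by unfold resAbs; positivity) _
  have hf'c : ContinuousOn (fun s => (g s m * v s (n - m) + v s m * g s (n - m)) * v s (-n) +
      v s m * v s (n - m) * g s (-n)) (Icc a t) :=
    ((((hgc m).mul (hvc (n - m))).add ((hvc m).mul (hgc (n - m)))).mul (hvc (-n))).add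
      (((hvc m).mul (hvc (n - m))).mul (hgc (-n)))
  have hosc := norm_integral_mul_le (φ := fun x => resPhase (w x) n m)
    (f := fun s => v s m * v s (n - m) * v s (-n))
    (f' := fun s => (g s m * v s (n - m) + v s m * g s (n - m)) * v s (-n) +
      v s m * v s (n - m) * g s (-n)) (K := C * N * (t - a) ^ γ) hat
    ((continuous_resPhase n m).comp_continuousOn hwc)
    (fun x hx => (hw.bound a x ha hx.1 (hx.2.trans htT) n m hn hm hnm).trans <|
      mul_le_mul_of_nonneg_left (Real.rpow_le_rpow (sub_nonneg.2 hx.1) (by linarith [hx.2])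
        hw.pos.le) (by positivity))
    (((hvc m).mul (hvc (n - m))).mul (hvc (-n))) hf'c
    (fun x hx => ((hc.deriv m x hx).mul (hc.deriv (n - m) x hx)).mul (hc.deriv (-n) x hx))
  set P := |(n : ℝ)| * N with hP
  have hP0 : 0 ≤ P := by positivity
  set κ := resKernel (ρ - 1) n m with hκ
  set κ' := resKernel (ρ - 1) n (n - m) with hκ'
  have hκ0 : 0 ≤ κ := resKernel_nonneg _ _ _
  have hκ0' : 0 ≤ κ' := resKernel_nonneg _ _ _
  have hW : P * |((n - m : ℤ) : ℝ)| ≤ κ := by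
    simpa using resKernel_weight_le (ρ := ρ) (s := 0) (σ := 0) le_rfl le_rfl hn hm hnm
  have hW' : P * |(m : ℝ)| ≤ κ' := by
    have := resKernel_weight_le (ρ := ρ) (s := 0) (σ := 0) le_rfl le_rfl hn hnm
      (by rwa [sub_sub_cancel])
    rw [resAbs_sub, sub_sub_cancel] at this
    simpa using this
  -- A derivative on `v₋ₙ` costs `|n| ≤ |m| + |n-m|`, hence both kernels. This term has no factor
  -- `v₋ₙ` left, which is why `cubicMajorant` also contains `‖x (n - m)‖`.
  have hWn : P * |(n : ℝ)| ≤ κ + κ' := by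
    have : |(n : ℝ)| ≤ |((n - m : ℤ) : ℝ)| + |(m : ℝ)| := by
      have e : (n : ℝ) = ((n - m : ℤ) : ℝ) + m := by push_cast; ring
      calc |(n : ℝ)| = |((n - m : ℤ) : ℝ) + (m : ℝ)| := by rw [← e]
        _ ≤ _ := abs_add_le _ _
    calc P * |(n : ℝ)| ≤ P * (|((n - m : ℤ) : ℝ)| + |(m : ℝ)|) := by gcongr
      _ ≤ κ + κ' := by rw [mul_add]; exact add_le_add hW hW'
  have hP1 : P ≤ κ := (le_mul_of_one_le_right hP0 (one_le_abs_cast hnm)).trans hW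
  have hbdry : P * ‖v t m * v t (n - m) * v t (-n)‖ ≤ M * cubicMajorant (ρ - 1) (v t) n m := by
    rw [norm_mul, norm_mul]
    have h1 : ‖v t (n - m)‖ ≤ M := ((v t).norm_apply_le _).trans (hM t htm)
    calc P * (‖v t m‖ * ‖v t (n - m)‖ * ‖v t (-n)‖)
        ≤ κ * (‖v t m‖ * M * ‖v t (-n)‖) := by gcongr
      _ = M * (κ * ‖v t m‖ * (‖v t (-n)‖ + 0)) := by ring
      _ ≤ M * (κ * ‖v t m‖ * (‖v t (-n)‖ + ‖v t (n - m)‖)) := by gcongr; exact norm_nonneg _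
  have hint : ∀ s ∈ Icc a t, P * ‖(g s m * v s (n - m) + v s m * g s (n - m)) * v s (-n) +
      v s m * v s (n - m) * g s (-n)‖ ≤
      M ^ 2 * (cubicMajorant (ρ - 1) (v s) n m + cubicMajorant (ρ - 1) (v s) n (n - m)) := by
    intro s hs
    have hg : ∀ k : ℤ, ‖g s k‖ ≤ M ^ 2 * |(k : ℝ)| := fun k => by
      simpa using hc.derivBound s hs k
    have hgn : ‖g s (-n)‖ ≤ M ^ 2 * |(n : ℝ)| := by simpa using hg (-n)
    calc P * ‖(g s m * v s (n - m) + v s m * g s (n - m)) * v s (-n) +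
          v s m * v s (n - m) * g s (-n)‖
        ≤ P * ((‖g s m‖ * ‖v s (n - m)‖ + ‖v s m‖ * ‖g s (n - m)‖) * ‖v s (-n)‖ +
          ‖v s m‖ * ‖v s (n - m)‖ * ‖g s (-n)‖) := by
          gcongr
          refine (norm_add_le _ _).trans ?_
          rw [norm_mul, norm_mul (v s m * _), norm_mul (v s m)]
          gcongr
          refine (norm_add_le _ _).trans ?_
          rw [norm_mul, norm_mul]
      _ ≤ P * ((M ^ 2 * |(m : ℝ)| * ‖v s (n - m)‖ + ‖v s m‖ * (M ^ 2 * |((n - m : ℤ) : ℝ)|)) *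
          ‖v s (-n)‖ + ‖v s m‖ * ‖v s (n - m)‖ * (M ^ 2 * |(n : ℝ)|)) := by
          gcongr
          · exact hg m
          · exact hg (n - m)
      _ = M ^ 2 * (P * |(m : ℝ)| * (‖v s (n - m)‖ * ‖v s (-n)‖) +
          P * |((n - m : ℤ) : ℝ)| * (‖v s m‖ * ‖v s (-n)‖) +
          P * |(n : ℝ)| * (‖v s m‖ * ‖v s (n - m)‖)) := by ring
      _ ≤ M ^ 2 * (κ' * (‖v s (n - m)‖ * ‖v s (-n)‖) + κ * (‖v s m‖ * ‖v s (-n)‖) +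
          (κ + κ') * (‖v s m‖ * ‖v s (n - m)‖)) := by gcongr
      _ = _ := by rw [cubicMajorant, cubicMajorant, sub_sub_cancel]; ring
  have hSc : ∀ k, ContinuousOn (fun s => cubicMajorant (ρ - 1) (v s) n k) (Icc a t) := fun k =>
    (continuousOn_const.mul (hvc k).norm).mul ((hvc (-n)).norm.add (hvc (n - k)).norm)
  have hint' : P * ∫ s in a..t, ‖(g s m * v s (n - m) + v s m * g s (n - m)) * v s (-n) +
      v s m * v s (n - m) * g s (-n)‖ ≤ M ^ 2 * ∫ s in a..t,
        (cubicMajorant (ρ - 1) (v s) n m + cubicMajorant (ρ - 1) (v s) n (n - m)) := by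
    rw [← intervalIntegral.integral_const_mul, ← intervalIntegral.integral_const_mul]
    exact intervalIntegral.integral_mono_on hat
      ((hf'c.norm.intervalIntegrable_of_Icc hat).const_mul _)
      ((((hSc m).add (hSc (n - m))).intervalIntegrable_of_Icc hat).const_mul _) hint
  calc |(n : ℝ)| * ‖cubicTerm w a t v n m‖
      ≤ |(n : ℝ)| * (C * N * (t - a) ^ γ * (‖v t m * v t (n - m) * v t (-n)‖ +
        ∫ s in a..t, ‖(g s m * v s (n - m) + v s m * g s (n - m)) * v s (-n) +
          v s m * v s (n - m) * g s (-n)‖)) := mul_le_mul_of_nonneg_left hosc (abs_nonneg _)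
    _ = C * (t - a) ^ γ * (P * ‖v t m * v t (n - m) * v t (-n)‖ +
        P * ∫ s in a..t, ‖(g s m * v s (n - m) + v s m * g s (n - m)) * v s (-n) +
          v s m * v s (n - m) * g s (-n)‖) := by rw [hP]; ring
    _ ≤ _ := mul_le_mul_of_nonneg_left (add_le_add hbdry hint') (by positivity)

/-- Absolute convergence over pairs of frequencies is what permits the rearrangement behind
conservation at `L²` regularity. -/
theorem IsMild.summable_cubicTerm {ρ γ T C : ℝ} {w : ℝ → ℝ} (hw : PhaseDecay ρ γ T C w)
    (hρ : 5 / 4 < ρ) {a t : ℝ} (ha : 0 ≤ a) (hat : a ≤ t) (htT : t ≤ T) {v : ℝ → SeqL2}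
    (hv : IsMild w a t v) : Summable fun p : ℤ × ℤ => (p.1 : ℂ) * cubicTerm w a t v p.1 p.2 := by
  obtain ⟨M, hM⟩ := isCompact_Icc.exists_bound_of_continuousOn hv.cont
  obtain ⟨B, hB0, hB⟩ := exists_sum_cubicMajorant_le (α := ρ - 1) (by linarith)
  have hM0 : 0 ≤ M := (norm_nonneg _).trans (hM t (right_mem_Icc.2 hat))
  have hC := hw.nonneg
  have hd : 0 ≤ (t - a) ^ γ := Real.rpow_nonneg (sub_nonneg.2 hat) γ
  have hvc : ∀ k, ContinuousOn (fun s => v s k) (Icc a t) := fun k =>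
    (SeqL2.continuous_apply k).comp_continuousOn hv.cont
  have hSc : ∀ n k, ContinuousOn (fun s => cubicMajorant (ρ - 1) (v s) n k) (Icc a t) := fun n k =>
    (continuousOn_const.mul (hvc k).norm).mul ((hvc (-n)).norm.add (hvc (n - k)).norm)
  refine Summable.of_norm (summable_of_sum_le (c := C * (t - a) ^ γ * (M * (B * M ^ 2) +
    M ^ 2 * ((t - a) * (B * M ^ 2 + B * M ^ 2)))) (fun _ => norm_nonneg _) fun F => ?_)
  have hrefl : ∀ s ∈ Icc a t,
      ∑ p ∈ F, cubicMajorant (ρ - 1) (v s) p.1 (p.1 - p.2) ≤ B * M ^ 2 := fun s hs => by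
    have hinj : Function.Injective fun p : ℤ × ℤ => (p.1, p.1 - p.2) := fun p q h => by
      simp only [Prod.mk.injEq] at h
      exact Prod.ext h.1 (by have := h.2; rw [h.1] at this; exact sub_right_injective this)
    have := hB (v s) M (hM s hs) (F.map ⟨_, hinj⟩)
    rwa [Finset.sum_map] at this
  have hi : ∀ p ∈ F, IntervalIntegrable (fun s => cubicMajorant (ρ - 1) (v s) p.1 p.2 +
      cubicMajorant (ρ - 1) (v s) p.1 (p.1 - p.2)) volume a t := fun p _ =>
    ((hSc p.1 p.2).add (hSc p.1 (p.1 - p.2))).intervalIntegrable_of_Icc hat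
  have hsumint : ∑ p ∈ F, ∫ s in a..t, (cubicMajorant (ρ - 1) (v s) p.1 p.2 +
      cubicMajorant (ρ - 1) (v s) p.1 (p.1 - p.2)) ≤ (t - a) * (B * M ^ 2 + B * M ^ 2) := by
    rw [← intervalIntegral.integral_finsetSum hi, ← smul_eq_mul,
      ← intervalIntegral.integral_const]
    refine intervalIntegral.integral_mono_on hat ?_ (by simp) fun s hs => ?_
    · simpa only [Finset.sum_fn] using IntervalIntegrable.sum F hi
    · rw [Finset.sum_add_distrib]
      exact add_le_add (hB (v s) M (hM s hs) F) (hrefl s hs)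
  calc ∑ p ∈ F, ‖(p.1 : ℂ) * cubicTerm w a t v p.1 p.2‖
      ≤ ∑ p ∈ F, C * (t - a) ^ γ * (M * cubicMajorant (ρ - 1) (v t) p.1 p.2 +
        M ^ 2 * ∫ s in a..t, (cubicMajorant (ρ - 1) (v s) p.1 p.2 +
          cubicMajorant (ρ - 1) (v s) p.1 (p.1 - p.2))) := by
        refine Finset.sum_le_sum fun p _ => ?_
        rw [norm_mul, Complex.norm_intCast]
        exact hv.cubicTerm_le hw ha hat htT hM p.1 p.2
    _ = C * (t - a) ^ γ * (M * ∑ p ∈ F, cubicMajorant (ρ - 1) (v t) p.1 p.2 +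
        M ^ 2 * ∑ p ∈ F, ∫ s in a..t, (cubicMajorant (ρ - 1) (v s) p.1 p.2 +
          cubicMajorant (ρ - 1) (v s) p.1 (p.1 - p.2))) := by
        rw [← Finset.mul_sum, Finset.sum_add_distrib, Finset.mul_sum, Finset.mul_sum]
    _ ≤ _ := by
        gcongr
        exact hB (v t) M (hM t (right_mem_Icc.2 hat)) F

/-- The cyclic permutation of the three frequencies `m`, `n - m`, `-n`. -/
def cyclicEquiv : ℤ × ℤ ≃ ℤ × ℤ where
  toFun p := (-p.2, p.1 - p.2)
  invFun p := (p.2 - p.1, -p.1)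
  left_inv p := by ext <;> simp
  right_inv p := by ext <;> simp

/-- The phase depends only on the product of the three frequencies `m`, `n - m`, `-n`. -/
theorem cubicTerm_cyclic (w : ℝ → ℝ) (a t : ℝ) (v : ℝ → SeqL2) (p : ℤ × ℤ) :
    cubicTerm w a t v (cyclicEquiv p).1 (cyclicEquiv p).2 = cubicTerm w a t v p.1 p.2 := by
  obtain ⟨n, m⟩ := p
  simp only [cyclicEquiv, Equiv.coe_fn_mk, cubicTerm]
  refine intervalIntegral.integral_congr fun s _ => ?_
  have e1 : resPhase (w s) (-m) (n - m) = resPhase (w s) n m := by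
    unfold resPhase; congr 3; push_cast; ring
  have e2 : -m - (n - m) = -n := by ring
  simp only [e1, e2, neg_neg]
  ring

/-- Adding the sum to its two cyclic rearrangements gives the coefficient `n - m - (n - m) = 0`, so
three times the sum vanishes. -/
theorem hasSum_cubicTerm_zero {w : ℝ → ℝ} {a t : ℝ} {v : ℝ → SeqL2}
    (h : Summable fun p : ℤ × ℤ => (p.1 : ℂ) * cubicTerm w a t v p.1 p.2) :
    HasSum (fun p : ℤ × ℤ => (p.1 : ℂ) * cubicTerm w a t v p.1 p.2) 0 := by
  obtain ⟨Z, hZ⟩ := h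
  have h1 := cyclicEquiv.hasSum_iff.2 hZ
  have h2 := cyclicEquiv.hasSum_iff.2 h1
  have h3 := (hZ.add h1).add h2
  have h4 : HasSum (fun _ : ℤ × ℤ => (0 : ℂ)) (Z + Z + Z) := by
    refine h3.congr_fun ?_
    intro p
    simp only [Function.comp_apply, cubicTerm_cyclic]
    simp only [cyclicEquiv, Equiv.coe_fn_mk]
    push_cast
    ring
  have h5 : Z + Z + Z = 0 := h4.unique hasSum_zero
  have h6 : Z = 0 := by linear_combination h5 / 3
  rwa [h6] at hZ

/-- For a real-valued function `|vₙ|² = vₙ v₋ₙ`, whose increment is `Q n + Q (-n)`; the sum of `Q`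
over `n` is, up to the factor `i`, the vanishing cubic sum. -/
theorem IsMild.norm_eq {ρ γ T C : ℝ} {w : ℝ → ℝ} (hw : PhaseDecay ρ γ T C w)
    (hρ : 5 / 4 < ρ) {a t : ℝ} (ha : 0 ≤ a) (hat : a ≤ t) (htT : t ≤ T) {v : ℝ → SeqL2}
    (hv : IsMild w a t v) (hr : ∀ s ∈ Icc a t, IsRealSeq (v s)) : ‖v t‖ = ‖v a‖ := by
  obtain ⟨M, hM⟩ := isCompact_Icc.exists_bound_of_continuousOn hv.cont
  have hwc : ContinuousOn w (Icc a t) := hw.cont.mono (Icc_subset_Icc ha htT)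
  have hc := hv.controlled hwc hM
  have hvc : ∀ k, ContinuousOn (fun s => v s k) (Icc a t) := hc.cont
  have hgc : ∀ k, ContinuousOn (fun s => bil (w s) (v s) (v s) k) (Icc a t) := hc.contDeriv
  set Q : ℤ → ℂ := fun n => ∫ s in a..t, bil (w s) (v s) (v s) n * v s (-n) with hQ
  have hQs : ∀ n, HasSum (fun m => Complex.I * (n * cubicTerm w a t v n m)) (Q n) := by
    intro n
    have h1 := hasSum_integral_of_sum_norm_le
      (F := fun m s => resPhase (w s) n m * (v s m * v s (n - m) * v s (-n))) (K := M * M * M) hat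
      (fun m => ((continuous_resPhase n m).comp_continuousOn hwc).mul
        (((hvc m).mul (hvc (n - m))).mul (hvc (-n)))) fun s hs G => ?_
    · have h2 : Q n = Complex.I * (n * ∫ s in a..t,
          ∑' m, resPhase (w s) n m * (v s m * v s (n - m) * v s (-n))) := by
        rw [hQ, ← mul_assoc, ← intervalIntegral.integral_const_mul]
        refine intervalIntegral.integral_congr fun s _ => ?_
        simp only [bil, mul_assoc, ← tsum_mul_right]
      rw [h2]
      exact (h1.mul_left _).mul_left _
    · have hs' := SeqL2.sqSumLe_of_norm_le (hM s hs)
      simp_rw [norm_mul, norm_resPhase, one_mul]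
      rw [← Finset.sum_mul]
      exact mul_le_mul (sum_conv_le hs' hs' n G) (((v s).norm_apply_le _).trans (hM s hs))
        (norm_nonneg _) (mul_nonneg hs'.1 hs'.1)
  have hQ0 : HasSum Q 0 := by
    have h1 := (hasSum_cubicTerm_zero (hv.summable_cubicTerm hw hρ ha hat htT)).mul_left Complex.I
    rw [mul_zero] at h1
    exact h1.prod_fiberwise hQs
  have hQ0' : HasSum (fun n => Q (-n)) 0 := (Equiv.neg ℤ).hasSum_iff.2 hQ0
  have hFTC : ∀ n, v t n * v t (-n) - v a n * v a (-n) = Q n + Q (-n) := by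
    intro n
    have h1 : ContinuousOn (fun s => bil (w s) (v s) (v s) n * v s (-n)) (Icc a t) :=
      (hgc n).mul (hvc (-n))
    have h2 : ContinuousOn (fun s => v s n * bil (w s) (v s) (v s) (-n)) (Icc a t) :=
      (hvc n).mul (hgc (-n))
    have h3 := intervalIntegral.integral_eq_sub_of_hasDerivAt_of_le
      (f := fun s => v s n * v s (-n)) hat ((hvc n).mul (hvc (-n)))
      (fun s hs => (hc.deriv n s hs).mul (hc.deriv (-n) s hs))
      ((h1.add h2).intervalIntegrable_of_Icc hat)
    rw [← h3, intervalIntegral.integral_add (h1.intervalIntegrable_of_Icc hat)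
      (h2.intervalIntegrable_of_Icc hat), hQ]
    congr 1
    refine intervalIntegral.integral_congr fun s _ => ?_
    simp only [neg_neg, mul_comm]
  have hns : ∀ x : SeqL2, HasSum (fun n => ((‖x n‖ ^ 2 : ℝ) : ℂ)) ((‖x‖ ^ 2 : ℝ) : ℂ) := fun x => by
    have := lp.hasSum_norm (p := 2) (by norm_num) x
    rw [Complex.hasSum_ofReal]
    simpa using this
  have hreal : ∀ s ∈ Icc a t, ∀ n, ((‖v s n‖ ^ 2 : ℝ) : ℂ) = v s n * v s (-n) := fun s hs n => by
    rw [hr s hs n, Complex.mul_conj, Complex.normSq_eq_norm_sq]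
  have h1 := (hns (v t)).sub (hns (v a))
  have h2 : HasSum (fun n => ((‖v t n‖ ^ 2 : ℝ) : ℂ) - ((‖v a n‖ ^ 2 : ℝ) : ℂ)) (0 + 0) := by
    refine (hQ0.add hQ0').congr_fun fun n => ?_
    rw [hreal t (right_mem_Icc.2 hat), hreal a (left_mem_Icc.2 hat), hFTC]
  have h3 := h1.unique h2
  rw [add_zero, sub_eq_zero, Complex.ofReal_inj] at h3
  exact (sq_eq_sq₀ (norm_nonneg _) (norm_nonneg _)).1 h3

/-! ### Global existence for real-valued data -/

theorem IsMild.congr {w : ℝ → ℝ} {a b : ℝ} {v v' : ℝ → SeqL2} (h : IsMild w a b v)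
    (hvv' : EqOn v' v (Icc a b)) : IsMild w a b v' where
  cont := h.cont.congr hvv'
  zero t ht := by rw [hvv' ht]; exact h.zero t ht
  eq t ht n := by
    rw [hvv' ht, hvv' (left_mem_Icc.2 (ht.1.trans ht.2)), h.eq t ht n]
    congr 1
    refine intervalIntegral.integral_congr fun s hs => ?_
    rw [uIcc_of_le ht.1] at hs
    simp only [hvv' ⟨hs.1, hs.2.trans ht.2⟩]

theorem IsMild.glue {w : ℝ → ℝ} {a b c : ℝ} {v v' : ℝ → SeqL2} (hw : ContinuousOn w (Icc a c))
    (hab : a ≤ b) (hbc : b ≤ c) (h : IsMild w a b v) (h' : IsMild w b c v') (hb : v b = v' b) :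
    IsMild w a c fun t => if t ≤ b then v t else v' t := by
  set V : ℝ → SeqL2 := fun t => if t ≤ b then v t else v' t with hV
  have e1 : EqOn V v (Icc a b) := fun t ht => if_pos ht.2
  have e2 : EqOn V v' (Icc b c) := fun t ht => by
    rcases ht.1.eq_or_lt with rfl | hlt
    · rw [← hb]; exact if_pos le_rfl
    · exact if_neg hlt.not_ge
  have g1 := h.congr e1
  have g2 := h'.congr e2
  have hcont : ContinuousOn V (Icc a c) := by
    rw [← Icc_union_Icc_eq_Icc hab hbc]
    exact g1.cont.union_of_isClosed g2.cont isClosed_Icc isClosed_Icc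
  refine ⟨hcont, fun t ht => ?_, fun t ht n => ?_⟩
  · rcases le_total t b with htb | hbt
    · exact g1.zero t ⟨ht.1, htb⟩
    · exact g2.zero t ⟨hbt, ht.2⟩
  · rcases le_total t b with htb | hbt
    · exact g1.eq t ⟨ht.1, htb⟩ n
    · have hbil := continuousOn_bil hw hcont hcont n
      rw [g2.eq t ⟨hbt, ht.2⟩ n, g1.eq b ⟨hab, le_rfl⟩ n, add_assoc,
        intervalIntegral.integral_add_adjacent_intervals]
      · exact (hbil.mono (Icc_subset_Icc_right hbc)).intervalIntegrable_of_Icc hab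
      · exact (hbil.mono (Icc_subset_Icc hab ht.2)).intervalIntegrable_of_Icc hbt

theorem PhaseDecay.exists_isMild_of_isRealSeq {ρ γ T C : ℝ} {w : ℝ → ℝ}
    (hw : PhaseDecay ρ γ T C w) (hρ : 5 / 4 < ρ) (hT : 0 ≤ T) {x : SeqL2} (hx0 : x 0 = 0)
    (hx : IsRealSeq x) :
    ∃ v : ℝ → SeqL2, IsMild w 0 T v ∧ v 0 = x ∧ ∀ t ∈ Icc 0 T, IsRealSeq (v t) := by
  obtain ⟨h, hh, hex⟩ := hw.exists_isMild hρ ‖x‖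
  have key : ∀ k : ℕ, ∃ v : ℝ → SeqL2, IsMild w 0 (min (k * h) T) v ∧ v 0 = x ∧
      ∀ t ∈ Icc 0 (min (k * h) T), IsRealSeq (v t) := by
    intro k
    induction k with
    | zero =>
      refine ⟨fun _ => x, ⟨continuousOn_const, fun _ _ => hx0, fun t ht n => ?_⟩, rfl,
        fun _ _ => hx⟩
      rw [Nat.cast_zero, zero_mul, min_eq_left hT] at ht
      rw [le_antisymm ht.2 ht.1, intervalIntegral.integral_same, add_zero]
    | succ k ih =>
      obtain ⟨v, hv, hvx, hvr⟩ := ih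
      set b := min (k * h) T with hb
      set c := min ((k + 1 : ℕ) * h) T with hc
      have hb0 : 0 ≤ b := le_min (by positivity) hT
      have hbT : b ≤ T := min_le_right _ _
      have hcT : c ≤ T := min_le_right _ _
      have hbc : b ≤ c := min_le_min_right _ (by push_cast; linarith)
      have hcb : c - b ≤ h := by
        rw [sub_le_iff_le_add, hc, hb]
        rcases le_total (k * h) T with hle | hle
        · rw [min_eq_left hle]
          exact (min_le_left _ _).trans (by push_cast; linarith)
        · rw [min_eq_right hle]
          exact (min_le_right _ _).trans (by linarith)
      have hbm : b ∈ Icc 0 b := right_mem_Icc.2 hb0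
      -- Conservation makes the step length `h`, chosen for the initial norm, valid at every
      -- restart.
      have hnorm : ‖v b‖ = ‖x‖ := by
        rw [hv.norm_eq hw hρ le_rfl hb0 hbT hvr, hvx]
      obtain ⟨v', hv', hvb', hvr'⟩ := hex b c hb0 hbc hcT hcb (v b) hnorm.le (hv.zero b hbm)
      refine ⟨_, hv.glue (hw.cont.mono (Icc_subset_Icc_right hcT)) hb0 hbc hv' hvb'.symm,
        (if_pos hb0).trans hvx, fun t ht => ?_⟩
      by_cases htb : t ≤ b
      · simp only [htb, if_true]
        exact hvr t ⟨ht.1, htb⟩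
      · simp only [htb, if_false]
        exact hvr' (hvr b hbm) t ⟨(not_le.1 htb).le, ht.2⟩
  obtain ⟨k, hk⟩ := exists_nat_ge (T / h)
  have := key k
  rwa [min_eq_right ((div_le_iff₀ hh).1 hk)] at this

theorem exists_isMild_halfLine {ρ γ : ℝ} {w : ℝ → ℝ} (hw : ∀ T, 0 < T → ∃ C, PhaseDecay ρ γ T C w)
    (hρ : 5 / 4 < ρ) {x : SeqL2} (hx0 : x 0 = 0) (hx : IsRealSeq x) :
    ∃ v : ℝ → SeqL2, v 0 = x ∧ ∀ T, 0 ≤ T → IsMild w 0 T v ∧ ∀ t ∈ Icc 0 T, IsRealSeq (v t) := by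
  have hex : ∀ N : ℕ, ∃ v : ℝ → SeqL2, IsMild w 0 (N + 1) v ∧ v 0 = x ∧
      ∀ t ∈ Icc (0 : ℝ) (N + 1), IsRealSeq (v t) := fun N => by
    obtain ⟨C, hC⟩ := hw (N + 1) (by positivity)
    exact hC.exists_isMild_of_isRealSeq hρ (by positivity) hx0 hx
  choose v hv hvx hvr using hex
  -- By uniqueness the solutions on different intervals agree where both exist, so evaluating the
  -- one with index `⌈t⌉₊` at time `t` is consistent.
  have hloc : ∀ N : ℕ, EqOn (fun t => v ⌈t⌉₊ t) (v N) (Icc 0 N) := fun N t ht => by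
    obtain ⟨C, hC⟩ := hw (⌈t⌉₊ + 1) (by positivity)
    obtain ⟨C', hC'⟩ := hw (N + 1) (by positivity)
    have htc : t ≤ ⌈t⌉₊ := Nat.le_ceil t
    have hcN : ⌈t⌉₊ ≤ N := Nat.ceil_le.2 ht.2
    have hcN' : ((⌈t⌉₊ : ℕ) : ℝ) ≤ N := by exact_mod_cast hcN
    have m1 := (hv ⌈t⌉₊).mono hC.cont le_rfl ht.1 (htc.trans (by linarith))
    have m2 := (hv N).mono hC'.cont le_rfl ht.1 (by linarith [ht.2])
    exact IsMild.unique hC hρ (by linarith) m1 m2 ((hvx _).trans (hvx N).symm) ⟨ht.1, le_rfl⟩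
  refine ⟨fun t => v ⌈t⌉₊ t, by simp [hvx], fun T hT => ?_⟩
  obtain ⟨N, hN⟩ := exists_nat_ge T
  have hsub : Icc 0 T ⊆ Icc 0 (N : ℝ) := Icc_subset_Icc_right hN
  obtain ⟨C, hC⟩ := hw (N + 1) (by positivity)
  have m := (hv N).mono hC.cont le_rfl hT (by linarith : T ≤ (N : ℝ) + 1)
  refine ⟨m.congr ((hloc N).mono hsub), fun t ht => ?_⟩
  have e : v ⌈t⌉₊ t = v N t := hloc N (hsub ht)
  change IsRealSeq (v ⌈t⌉₊ t)
  rw [e]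
  exact hvr N t ⟨ht.1, by linarith [ht.2]⟩

/-! ### Smoothing in the interaction representation -/

theorem norm_bil_weighted_le {s : ℝ} (hs : 0 ≤ s) {f : ℤ → ℂ} (h0 : f 0 = 0) {A : ℝ}
    (hf : SqSumLe (fun n => |(n : ℝ)| ^ s * ‖f n‖) A) (θ : ℝ) (n : ℤ) :
    |(n : ℝ)| ^ s * ‖bil θ f f n‖ ≤ 2 ^ s * A ^ 2 * |(n : ℝ)| := by
  have hf' := sqSumLe_norm_of_weighted hs h0 hf
  have hterm : ∀ m, |(n : ℝ)| ^ s * ‖resPhase θ n m * (f m * f (n - m))‖ ≤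
      2 ^ s * ((|(m : ℝ)| ^ s * ‖f m‖) * (|((n - m : ℤ) : ℝ)| ^ s * ‖f (n - m)‖)) := fun m => by
    rw [norm_mul, norm_resPhase, one_mul, norm_mul]
    rcases eq_or_ne m 0 with rfl | hm
    · simp [h0]
    rcases eq_or_ne (n - m) 0 with hnm | hnm
    · simp [hnm, h0]
    have h1 : |(n : ℝ)| ^ s ≤ 2 ^ s * |(m : ℝ)| ^ s * |((n - m : ℤ) : ℝ)| ^ s := by
      rw [← Real.mul_rpow (by norm_num) (abs_nonneg _), ← Real.mul_rpow (by positivity)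
        (abs_nonneg _)]
      exact Real.rpow_le_rpow (abs_nonneg _) (abs_cast_le_two_mul hm hnm) hs
    calc |(n : ℝ)| ^ s * (‖f m‖ * ‖f (n - m)‖)
        ≤ 2 ^ s * |(m : ℝ)| ^ s * |((n - m : ℤ) : ℝ)| ^ s * (‖f m‖ * ‖f (n - m)‖) := by gcongr
      _ = _ := by ring
  have hsum := (summable_bil hf' hf' θ n).norm
  have hkey : |(n : ℝ)| ^ s * ‖∑' m, resPhase θ n m * (f m * f (n - m))‖ ≤ 2 ^ s * (A * A) := by
    refine (mul_le_mul_of_nonneg_left (norm_tsum_le_tsum_norm hsum) (by positivity)).trans ?_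
    rw [← tsum_mul_left]
    refine Real.tsum_le_of_sum_le (fun _ => by positivity) fun G => ?_
    refine (Finset.sum_le_sum fun m _ => hterm m).trans ?_
    rw [← Finset.mul_sum]
    exact mul_le_mul_of_nonneg_left (sum_conv_le hf hf n G) (by positivity)
  rw [bil, norm_mul, norm_mul, Complex.norm_I, one_mul, Complex.norm_intCast]
  calc |(n : ℝ)| ^ s * (|(n : ℝ)| * ‖∑' m, resPhase θ n m * (f m * f (n - m))‖)
      = |(n : ℝ)| ^ s * ‖∑' m, resPhase θ n m * (f m * f (n - m))‖ * |(n : ℝ)| := by ring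
    _ ≤ 2 ^ s * (A * A) * |(n : ℝ)| := mul_le_mul_of_nonneg_right hkey (abs_nonneg _)
    _ = _ := by ring

theorem IsMild.controlled_weighted {w : ℝ → ℝ} {a b s A : ℝ} {v : ℝ → SeqL2} (h : IsMild w a b v)
    (hw : ContinuousOn w (Icc a b)) (hs : 0 ≤ s)
    (hA : ∀ t ∈ Icc a b, SqSumLe (fun n => |(n : ℝ)| ^ s * ‖v t n‖) A) :
    Controlled s a b (fun t => v t) (fun t => bil (w t) (v t) (v t)) A (2 ^ s * A ^ 2) where
  nonneg := by positivity
  zero := h.zero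
  cont n := (SeqL2.continuous_apply n).comp_continuousOn h.cont
  contDeriv n := continuousOn_bil hw h.cont h.cont n
  deriv n _ ht := hasDerivAt_of_eq_integral (continuousOn_bil hw h.cont h.cont n)
    (fun t ht => h.eq t ht n) ht
  bound := hA
  derivBound t ht n := norm_bil_weighted_le hs (h.zero t ht) (hA t ht) (w t) n

/-- Mere boundedness in the space of order `s` yields Hölder increments of order `s + σ`, as
increments of `v` are integrals of the nonlinearity. -/
theorem IsMild.exists_weighted_sub_le {ρ γ T C : ℝ} {w : ℝ → ℝ} (hw : PhaseDecay ρ γ T C w)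
    {s σ τ A : ℝ} (hs : 0 ≤ s) (hσ : 0 ≤ σ) (hσρ : σ < 2 * ρ - 5 / 2) (hτ : τ ≤ T)
    {v : ℝ → SeqL2} (hv : IsMild w 0 τ v)
    (hA : ∀ t ∈ Icc 0 τ, SqSumLe (fun n => |(n : ℝ)| ^ s * ‖v t n‖) A) :
    ∃ K, ∀ r t, 0 ≤ r → r ≤ t → t ≤ τ →
      SqSumLe (fun n => |(n : ℝ)| ^ (s + σ) * ‖v t n - v r n‖) (K * (t - r) ^ γ) := by
  obtain ⟨C₀, hC₀, h⟩ := hw.exists_integral_bil_bound hs hσ hσρ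
  have hwc : ContinuousOn w (Icc 0 τ) := hw.cont.mono (Icc_subset_Icc_right hτ)
  refine ⟨C₀ * (A * A + T * (A * (2 ^ s * A ^ 2) + 2 ^ s * A ^ 2 * A)),
    fun r t hr hrt ht => ?_⟩
  have hc := (hv.controlled_weighted hwc hs hA).mono hr ht
  have hA0 : 0 ≤ A := (hA r ⟨hr, hrt.trans ht⟩).1
  have hd : 0 ≤ (t - r) ^ γ := Real.rpow_nonneg (sub_nonneg.2 hrt) γ
  have hm := hv.mono hwc hr hrt ht
  have := h _ _ _ _ _ _ _ _ _ _ hr hrt (ht.trans hτ) hc hc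
  refine (this.mono_right ?_).mono fun n => ?_
  · rw [mul_right_comm]
    gcongr
    linarith
  · rw [hm.eq t (right_mem_Icc.2 hrt) n, add_sub_cancel_left]

/-! ### Fourier coefficients -/

theorem repr_apply (f : L2) (n : ℤ) : fourierBasis.repr f n = fourierCoeff f n :=
  fourierBasis_repr f n

theorem ext_fourierCoeff {f g : L2} (h : ∀ n, fourierCoeff f n = fourierCoeff g n) : f = g :=
  fourierBasis.repr.injective (lp.ext (funext fun n => by
    rw [repr_apply, repr_apply]; exact h n))

theorem fourierCoeff_sub' (f g : L2) (n : ℤ) :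
    fourierCoeff (f - g : L2) n = fourierCoeff f n - fourierCoeff g n := by
  rw [← repr_apply, ← repr_apply, ← repr_apply, map_sub]; rfl

theorem fourierCoeff_add' (f g : L2) (n : ℤ) :
    fourierCoeff (f + g : L2) n = fourierCoeff f n + fourierCoeff g n := by
  rw [← repr_apply, ← repr_apply, ← repr_apply, map_add]; rfl

theorem fourierCoeff_symm (x : SeqL2) (n : ℤ) :
    fourierCoeff (fourierBasis.repr.symm x : L2) n = x n := by
  rw [← repr_apply, LinearIsometryEquiv.apply_symm_apply]

theorem meanZero_iff (f : L2) : MeanZero f ↔ fourierCoeff f 0 = 0 := by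
  simp [MeanZero, fourierCoeff]

/-- Parseval's identity for the pair `conj f · eₙ` and `f`, so that `f² ∈ L¹` needs no Fourier
series of its own. -/
theorem hasSum_fourierCoeff_sq (f : L2) (n : ℤ) :
    HasSum (fun m => fourierCoeff f m * fourierCoeff f (n - m))
      (fourierCoeff (fun x => f x ^ 2) n) := by
  have hm : MemLp (fun x : Torus => (starRingEnd ℂ) (f x) * fourier n x) 2
      AddCircle.haarAddCircle := by
    refine (Lp.memLp f).mono ?_ (ae_of_all _ fun x => ?_)
    · exact (Complex.continuous_conj.comp_aestronglyMeasurable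
        (Lp.memLp f).aestronglyMeasurable).mul (map_continuous (fourier n)).aestronglyMeasurable
    · rw [norm_mul, RCLike.norm_conj, fourier_apply, Circle.norm_coe, mul_one]
  set h : L2 := hm.toLp with hh
  have hx : (h : Torus → ℂ) =ᵐ[AddCircle.haarAddCircle]
      fun x : Torus => (starRingEnd ℂ) (f x) * fourier n x := hm.coeFn_toLp
  have h1 := fourierBasis.hasSum_inner_mul_inner h f
  have e1 : inner ℂ h f = fourierCoeff (fun x => f x ^ 2) n := by
    rw [L2.inner_def, fourierCoeff]
    refine integral_congr_ae ?_
    filter_upwards [hx] with x hx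
    rw [hx, RCLike.inner_apply, map_mul, Complex.conj_conj, fourier_neg, smul_eq_mul]
    ring
  have e2 : ∀ m, inner ℂ h (fourierBasis m : L2) = fourierCoeff f (n - m) := fun m => by
    rw [L2.inner_def, fourierCoeff, coe_fourierBasis]
    refine integral_congr_ae ?_
    filter_upwards [hx, coeFn_fourierLp 2 m] with x hx hx'
    rw [hx, hx', RCLike.inner_apply, map_mul, Complex.conj_conj, neg_sub, sub_eq_add_neg,
      fourier_add, fourier_neg, smul_eq_mul]
    ring
  rw [e1] at h1
  refine h1.congr_fun fun m => ?_
  rw [e2, ← HilbertBasis.repr_apply_apply, repr_apply, mul_comm]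

theorem airySymbol_ne_zero (a : ℝ) (n : ℤ) : airySymbol a n ≠ 0 := Complex.exp_ne_zero _

theorem airySymbol_neg (a : ℝ) (n : ℤ) : airySymbol (-a) n = (airySymbol a n)⁻¹ := by
  rw [airySymbol, airySymbol, ← Complex.exp_neg]
  congr 1; push_cast; ring

theorem conj_airySymbol (a : ℝ) (n : ℤ) :
    (starRingEnd ℂ) (airySymbol a n) = airySymbol a (-n) := by
  rw [airySymbol, airySymbol, ← Complex.exp_conj, map_mul, Complex.conj_I, Complex.conj_ofReal]
  congr 1; push_cast; ring

theorem continuous_airySymbol (n : ℤ) : Continuous fun a => airySymbol a n := by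
  unfold airySymbol; fun_prop

theorem resPhase_mul_airySymbol (θ : ℝ) (n m : ℤ) :
    resPhase θ n m * (airySymbol (-θ) m * airySymbol (-θ) (n - m)) = airySymbol (-θ) n := by
  rw [resPhase, airySymbol, airySymbol, airySymbol, ← Complex.exp_add, ← Complex.exp_add]
  congr 1; push_cast; ring

theorem inv_airySymbol_mul_nonlinearity (θ : ℝ) (f : L2) {c : ℤ → ℂ}
    (hc : ∀ n, c n = airySymbol (-θ) n * fourierCoeff f n) (n : ℤ) :
    (airySymbol θ n)⁻¹ * nonlinearity f n = bil θ c c n := by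
  rw [nonlinearity, bil, ← (hasSum_fourierCoeff_sq f n).tsum_eq, ← airySymbol_neg, mul_left_comm,
    ← tsum_mul_left]
  congr 1
  refine tsum_congr fun m => ?_
  rw [hc, hc, ← resPhase_mul_airySymbol θ n m]
  ring

theorem IsRealValued.isRealSeq {f : L2} (h : IsRealValued f) : IsRealSeq (fourierCoeff f) := by
  intro n
  rw [fourierCoeff, fourierCoeff, ← integral_conj]
  refine integral_congr_ae ?_
  filter_upwards [h] with x hx
  rw [smul_eq_mul, smul_eq_mul, map_mul, fourier_neg, fourier_neg, Complex.conj_conj,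
    Complex.conj_eq_iff_im.2 hx]

/-- `f` and its conjugate have the same Fourier coefficients, hence coincide. -/
theorem isRealValued_of_isRealSeq {f : L2} (h : IsRealSeq (fourierCoeff f)) :
    IsRealValued f := by
  have hs : ((star f : L2) : Torus → ℂ) =ᵐ[AddCircle.haarAddCircle] star (f : Torus → ℂ) :=
    Lp.coeFn_star f
  have e : star f = f := by
    refine ext_fourierCoeff fun n => ?_
    rw [fourierCoeff_congr_ae hs, ← neg_neg n, h (-n), fourierCoeff, fourierCoeff, ← integral_conj]
    refine integral_congr_ae (ae_of_all _ fun x => ?_)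
    simp only [smul_eq_mul, map_mul, ← fourier_neg, neg_neg, Pi.star_apply]
    rfl
  rw [e] at hs
  filter_upwards [hs] with x hx
  exact Complex.conj_eq_iff_im.1 hx.symm

/-! ### Sobolev spaces and the linear propagator on sequences -/

/-- The sequence `⟨n⟩^s cₙ` as an element of `ℓ²`. -/
def weightSeq (s : ℝ) (c : ℤ → ℂ) : SeqL2 :=
  toSeq fun n => (((1 + (n : ℝ) ^ 2) ^ (s / 2) : ℝ) : ℂ) * c n

theorem weight_sq (s : ℝ) (n : ℤ) (z : ℂ) :
    ‖(((1 + (n : ℝ) ^ 2) ^ (s / 2) : ℝ) : ℂ) * z‖ ^ 2 = (1 + (n : ℝ) ^ 2) ^ s * ‖z‖ ^ 2 := by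
  rw [norm_mul, Complex.norm_real, Real.norm_of_nonneg (by positivity), mul_pow,
    ← Real.rpow_natCast, ← Real.rpow_mul (by positivity)]
  congr 2; push_cast; ring

theorem memSobolev_iff {s : ℝ} {f : L2} : MemSobolev s f ↔
    Memℓp (fun n : ℤ => (((1 + (n : ℝ) ^ 2) ^ (s / 2) : ℝ) : ℂ) * fourierCoeff f n) 2 := by
  rw [memℓp_gen_iff (by norm_num), MemSobolev]
  simp only [ENNReal.toReal_ofNat, Real.rpow_ofNat, weight_sq]

theorem MemSobolev.weightSeq_apply {s : ℝ} {f : L2} (h : MemSobolev s f) (n : ℤ) :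
    weightSeq s (fourierCoeff f) n =
      (((1 + (n : ℝ) ^ 2) ^ (s / 2) : ℝ) : ℂ) * fourierCoeff f n :=
  toSeq_apply (memSobolev_iff.1 h) n

theorem MemSobolev.sub {s : ℝ} {f g : L2} (hf : MemSobolev s f) (hg : MemSobolev s g) :
    MemSobolev s (f - g) := by
  rw [memSobolev_iff] at *
  have h := hf.sub hg
  convert h using 1
  funext n
  simp only [fourierCoeff_sub', mul_sub, Pi.sub_apply]

theorem SeqL2.norm_eq_sqrt (x : SeqL2) : ‖x‖ = √(∑' n, ‖x n‖ ^ 2) := by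
  have := lp.norm_rpow_eq_tsum (p := 2) (by norm_num) x
  simp only [ENNReal.toReal_ofNat, Real.rpow_ofNat] at this
  rw [← this, Real.sqrt_sq (norm_nonneg _)]

theorem sobolevNorm_sub_eq {s : ℝ} {f g : L2} (hf : MemSobolev s f) (hg : MemSobolev s g) :
    sobolevNorm s (f - g) =
      ‖weightSeq s (fourierCoeff f) - weightSeq s (fourierCoeff g)‖ := by
  rw [SeqL2.norm_eq_sqrt, sobolevNorm]
  congr 1
  refine tsum_congr fun n => ?_
  rw [lp.coeFn_sub, Pi.sub_apply, hf.weightSeq_apply, hg.weightSeq_apply, ← mul_sub, weight_sq,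
    fourierCoeff_sub']

theorem continuousInSobolev_iff {s : ℝ} {J : Set ℝ} {u : ℝ → L2} : ContinuousInSobolev s J u ↔
    (∀ t ∈ J, MemSobolev s (u t)) ∧
      ContinuousOn (fun t => weightSeq s (fourierCoeff (u t))) J := by
  refine and_congr_right fun h => forall₂_congr fun t ht => ?_
  rw [ContinuousWithinAt,
    tendsto_iff_norm_sub_tendsto_zero (b := weightSeq s (fourierCoeff (u t)))]
  refine tendsto_congr' ?_
  filter_upwards [self_mem_nhdsWithin] with t' ht'
  exact sobolevNorm_sub_eq (h t' ht') (h t ht)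

/-- The linear propagator on sequences. -/
def airySeq (θ : ℝ) (x : SeqL2) : SeqL2 :=
  fourierBasis.repr (airy θ (fourierBasis.repr.symm x))

theorem airySeq_apply (θ : ℝ) (x : SeqL2) (n : ℤ) : airySeq θ x n = airySymbol θ n * x n := by
  rw [airySeq, repr_apply, fourierCoeff_airy, fourierCoeff_symm]

theorem norm_airySeq_sub (θ : ℝ) (x y : SeqL2) : ‖airySeq θ x - airySeq θ y‖ = ‖x - y‖ := by
  rw [SeqL2.norm_eq_sqrt, SeqL2.norm_eq_sqrt]
  congr 1
  refine tsum_congr fun n => ?_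
  rw [lp.coeFn_sub, lp.coeFn_sub, Pi.sub_apply, Pi.sub_apply, airySeq_apply, airySeq_apply,
    ← mul_sub, norm_mul, norm_airySymbol, one_mul]

/-- Dominated convergence with majorant `4 ‖x n‖²`. Continuity is only strong, so the isometry
property is used next to treat a moving argument. -/
theorem continuous_airySeq_fst (x : SeqL2) : Continuous fun θ => airySeq θ x := by
  refine continuous_iff_continuousAt.2 fun θ₀ => ?_
  rw [ContinuousAt, tendsto_iff_norm_sub_tendsto_zero]
  have hs : Summable fun n => ‖x n‖ ^ 2 := x.sqSumLe.summable
  have h : Tendsto (fun θ => ∑' n, ‖airySeq θ x n - airySeq θ₀ x n‖ ^ 2) (𝓝 θ₀)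
      (𝓝 (∑' _ : ℤ, (0 : ℝ))) := by
    refine tendsto_tsum_of_dominated_convergence (hs.mul_left 4) (fun n => ?_)
      (Eventually.of_forall fun θ n => ?_)
    · have h1 : Tendsto (fun θ => airySymbol θ n) (𝓝 θ₀) (𝓝 (airySymbol θ₀ n)) :=
        (continuous_airySymbol n).tendsto θ₀
      have h2 := (((h1.mul_const (x n)).sub_const (airySymbol θ₀ n * x n)).norm).pow 2
      simp only [airySeq_apply]
      simpa using h2
    · rw [Real.norm_of_nonneg (by positivity), airySeq_apply, airySeq_apply]
      have h1 := norm_sub_le (airySymbol θ n * x n) (airySymbol θ₀ n * x n)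
      rw [norm_mul, norm_mul, norm_airySymbol, norm_airySymbol, one_mul] at h1
      calc ‖airySymbol θ n * x n - airySymbol θ₀ n * x n‖ ^ 2
          ≤ (‖x n‖ + ‖x n‖) ^ 2 := pow_le_pow_left₀ (norm_nonneg _) h1 2
        _ = 4 * ‖x n‖ ^ 2 := by ring
  rw [tsum_zero] at h
  have h2 := h.sqrt
  rw [Real.sqrt_zero] at h2
  refine h2.congr fun θ => ?_
  rw [SeqL2.norm_eq_sqrt]
  rfl

theorem continuousOn_airySeq {J : Set ℝ} {w : ℝ → ℝ} {x : ℝ → SeqL2} (hw : ContinuousOn w J)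
    (hx : ContinuousOn x J) : ContinuousOn (fun t => airySeq (w t) (x t)) J := by
  intro t ht
  rw [ContinuousWithinAt, tendsto_iff_norm_sub_tendsto_zero]
  have h1 : Tendsto (fun t' => ‖x t' - x t‖) (𝓝[J] t) (𝓝 0) := by
    simpa using ((hx t ht).sub_const (x t)).norm
  have h2 : Tendsto (fun t' => ‖airySeq (w t') (x t) - airySeq (w t) (x t)‖) (𝓝[J] t) (𝓝 0) := by
    have := ((continuous_airySeq_fst (x t)).tendsto (w t)).comp (hw t ht)
    simpa using (this.sub_const (airySeq (w t) (x t))).norm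
  have h3 := h1.add h2
  rw [zero_add] at h3
  refine squeeze_zero (fun _ => norm_nonneg _) (fun t' => ?_) h3
  have := norm_sub_le_norm_sub_add_norm_sub (airySeq (w t') (x t')) (airySeq (w t') (x t))
    (airySeq (w t) (x t))
  rwa [norm_airySeq_sub] at this

theorem MemSobolev.airy {s : ℝ} {f : L2} (h : MemSobolev s f) (θ : ℝ) :
    MemSobolev s (airy θ f) := by
  simpa only [MemSobolev, fourierCoeff_airy, norm_mul, norm_airySymbol, one_mul] using h

theorem MemSobolev.weightSeq_airy {s : ℝ} {f : L2} (h : MemSobolev s f) (θ : ℝ) :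
    weightSeq s (fourierCoeff (ModulatedKdV.airy θ f)) =
      airySeq θ (weightSeq s (fourierCoeff f)) := by
  refine lp.ext (funext fun n => ?_)
  rw [(h.airy θ).weightSeq_apply, airySeq_apply, h.weightSeq_apply, fourierCoeff_airy]
  ring

theorem ContinuousInSobolev.airy {s : ℝ} {J : Set ℝ} {w : ℝ → ℝ} {u : ℝ → L2}
    (hw : ContinuousOn w J) (h : ContinuousInSobolev s J u) :
    ContinuousInSobolev s J fun t => airy (w t) (u t) := by
  rw [continuousInSobolev_iff] at *
  refine ⟨fun t ht => (h.1 t ht).airy _, (continuousOn_airySeq hw h.2).congr fun t ht => ?_⟩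
  exact (h.1 t ht).weightSeq_airy _

theorem continuousInSobolev_const {s : ℝ} {J : Set ℝ} {f : L2} (h : MemSobolev s f) :
    ContinuousInSobolev s J fun _ => f := by
  rw [continuousInSobolev_iff]
  exact ⟨fun _ _ => h, continuousOn_const⟩

theorem MemSobolev.add {s : ℝ} {f g : L2} (hf : MemSobolev s f) (hg : MemSobolev s g) :
    MemSobolev s (f + g) := by
  rw [memSobolev_iff] at *
  have h := hf.add hg
  convert h using 1
  funext n
  simp only [fourierCoeff_add', mul_add, Pi.add_apply]

theorem ContinuousInSobolev.add {s : ℝ} {J : Set ℝ} {u v : ℝ → L2}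
    (hu : ContinuousInSobolev s J u) (hv : ContinuousInSobolev s J v) :
    ContinuousInSobolev s J fun t => u t + v t := by
  rw [continuousInSobolev_iff] at *
  refine ⟨fun t ht => (hu.1 t ht).add (hv.1 t ht), (hu.2.add hv.2).congr fun t ht => ?_⟩
  change weightSeq s (fourierCoeff (u t + v t : L2)) =
    weightSeq s (fourierCoeff (u t)) + weightSeq s (fourierCoeff (v t))
  refine lp.ext (funext fun n => ?_)
  rw [((hu.1 t ht).add (hv.1 t ht)).weightSeq_apply, lp.coeFn_add, Pi.add_apply,
    (hu.1 t ht).weightSeq_apply, (hv.1 t ht).weightSeq_apply, fourierCoeff_add', mul_add]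

theorem rpow_weight_mono {s s' : ℝ} (h : s' ≤ s) (n : ℤ) :
    (1 + (n : ℝ) ^ 2) ^ s' ≤ (1 + (n : ℝ) ^ 2) ^ s :=
  Real.rpow_le_rpow_of_exponent_le (by nlinarith [sq_nonneg (n : ℝ)]) h

theorem MemSobolev.mono {s s' : ℝ} (h : s' ≤ s) {f : L2} (hf : MemSobolev s f) :
    MemSobolev s' f :=
  Summable.of_nonneg_of_le (fun _ => by positivity)
    (fun n => mul_le_mul_of_nonneg_right (rpow_weight_mono h n) (sq_nonneg _)) hf

theorem sobolevNorm_mono {s s' : ℝ} (h : s' ≤ s) {f : L2} (hf : MemSobolev s f) :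
    sobolevNorm s' f ≤ sobolevNorm s f :=
  Real.sqrt_le_sqrt ((hf.mono h).tsum_le_tsum
    (fun n => mul_le_mul_of_nonneg_right (rpow_weight_mono h n) (sq_nonneg _)) hf)

theorem ContinuousInSobolev.mono {s s' : ℝ} (h : s' ≤ s) {J : Set ℝ} {u : ℝ → L2}
    (hu : ContinuousInSobolev s J u) : ContinuousInSobolev s' J u := by
  refine ⟨fun t ht => (hu.1 t ht).mono h, fun t ht => ?_⟩
  refine squeeze_zero' (Eventually.of_forall fun _ => Real.sqrt_nonneg _) ?_ (hu.2 t ht)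
  filter_upwards [self_mem_nhdsWithin] with t' ht'
  exact sobolevNorm_mono h ((hu.1 t' ht').sub (hu.1 t ht))

theorem memSobolev_zero (f : L2) : MemSobolev 0 f := by
  rw [memSobolev_iff]
  have := lp.memℓp (fourierBasis.repr f)
  simp only [zero_div, Real.rpow_zero, Complex.ofReal_one, one_mul, ← repr_apply]
  exact this

theorem weightSeq_zero (f : L2) : weightSeq 0 (fourierCoeff f) = fourierBasis.repr f := by
  refine lp.ext (funext fun n => ?_)
  rw [(memSobolev_zero f).weightSeq_apply, repr_apply]
  simp

theorem continuousInSobolev_zero_iff {J : Set ℝ} {u : ℝ → L2} :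
    ContinuousInSobolev 0 J u ↔ ContinuousOn (fun t => fourierBasis.repr (u t)) J := by
  rw [continuousInSobolev_iff]
  simp only [weightSeq_zero]
  exact and_iff_right fun t _ => memSobolev_zero _

/-! ### Solutions of the modulated KdV equation in the interaction representation -/

/-- The coefficients of `U^w(t)⁻¹ u(t)`. -/
def interaction (w : ℝ → ℝ) (u : ℝ → L2) (t : ℝ) : SeqL2 :=
  airySeq (-w t) (fourierBasis.repr (u t))

theorem interaction_apply (w : ℝ → ℝ) (u : ℝ → L2) (t : ℝ) (n : ℤ) :
    interaction w u t n = airySymbol (-w t) n * fourierCoeff (u t) n := by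
  rw [interaction, airySeq_apply, repr_apply]

theorem fourierCoeff_eq_interaction (w : ℝ → ℝ) (u : ℝ → L2) (t : ℝ) (n : ℤ) :
    fourierCoeff (u t) n = airySymbol (w t) n * interaction w u t n := by
  rw [interaction_apply, airySymbol_neg, mul_inv_cancel_left₀ (airySymbol_ne_zero _ _)]

theorem IsSolution.interaction_eq {w : ℝ → ℝ} {s : ℝ} {u₀ : L2} {J : Set ℝ} {u : ℝ → L2}
    (h : IsSolution w s u₀ J u) {t : ℝ} (ht : t ∈ J) (n : ℤ) :
    interaction w u t n = fourierCoeff u₀ n +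
      ∫ x in (0 : ℝ)..t, bil (w x) (interaction w u x) (interaction w u x) n := by
  rw [interaction_apply, h.2 t ht n, ← mul_add, airySymbol_neg,
    inv_mul_cancel_left₀ (airySymbol_ne_zero _ _)]
  congr 1
  exact intervalIntegral.integral_congr fun x _ =>
    inv_airySymbol_mul_nonlinearity _ _ (interaction_apply w u x) n

theorem IsSolution.interaction_zero {w : ℝ → ℝ} {s : ℝ} {u₀ : L2} {J : Set ℝ} {u : ℝ → L2}
    (h : IsSolution w s u₀ J u) (h0 : (0 : ℝ) ∈ J) :
    interaction w u 0 = fourierBasis.repr u₀ := by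
  refine lp.ext (funext fun n => ?_)
  rw [h.interaction_eq h0, intervalIntegral.integral_same, add_zero, repr_apply]

theorem IsSolution.isMild {w : ℝ → ℝ} {s τ : ℝ} {u₀ : L2} {u : ℝ → L2}
    (hw : ContinuousOn w (Icc 0 τ)) (hs : 0 ≤ s) (hτ : 0 ≤ τ)
    (h : IsSolution w s u₀ (Icc 0 τ) u) (hm : MeanZero u₀) : IsMild w 0 τ (interaction w u) where
  cont := continuousOn_airySeq hw.neg (continuousInSobolev_zero_iff.1 (h.1.mono hs))
  zero t ht := by
    rw [h.interaction_eq ht, (meanZero_iff u₀).1 hm]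
    simp [bil]
  eq t ht n := by
    rw [h.interaction_eq ht, h.interaction_zero (left_mem_Icc.2 hτ), repr_apply]

/-- The function of time and space with interaction representation `v`. -/
def ofInteraction (w : ℝ → ℝ) (v : ℝ → SeqL2) (t : ℝ) : L2 :=
  fourierBasis.repr.symm (airySeq (w t) (v t))

theorem interaction_ofInteraction (w : ℝ → ℝ) (v : ℝ → SeqL2) (t : ℝ) :
    interaction w (ofInteraction w v) t = v t := by
  refine lp.ext (funext fun n => ?_)
  rw [interaction_apply, ofInteraction, fourierCoeff_symm, airySeq_apply, airySymbol_neg,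
    inv_mul_cancel_left₀ (airySymbol_ne_zero _ _)]

theorem isSolution_ofInteraction {w : ℝ → ℝ} {u₀ : L2} {J : Set ℝ} {v : ℝ → SeqL2}
    (hw : ContinuousOn w J) (hv : ContinuousOn v J) (h : ∀ t ∈ J, ∀ n, v t n =
      fourierCoeff u₀ n + ∫ x in (0 : ℝ)..t, bil (w x) (v x) (v x) n) :
    IsSolution w 0 u₀ J (ofInteraction w v) := by
  refine ⟨continuousInSobolev_zero_iff.2 ?_, fun t ht n => ?_⟩
  · simp only [ofInteraction, LinearIsometryEquiv.apply_symm_apply]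
    exact continuousOn_airySeq hw hv
  · rw [fourierCoeff_eq_interaction w, interaction_ofInteraction, h t ht n, mul_add]
    congr 2
    refine intervalIntegral.integral_congr fun x _ => ?_
    rw [← interaction_ofInteraction w v x]
    exact (inv_airySymbol_mul_nonlinearity _ _ (interaction_apply w _ x) n).symm

theorem isRealValued_ofInteraction {w : ℝ → ℝ} {v : ℝ → SeqL2} {t : ℝ} (h : IsRealSeq (v t)) :
    IsRealValued (ofInteraction w v t) := by
  refine isRealValued_of_isRealSeq fun n => ?_
  rw [fourierCoeff_eq_interaction w, fourierCoeff_eq_interaction w, interaction_ofInteraction,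
    map_mul, conj_airySymbol, h n]

theorem IsSolution.unique {ρ γ T C : ℝ} {w : ℝ → ℝ} (hw : PhaseDecay ρ γ T C w) (hρ : 5 / 4 < ρ)
    {s τ : ℝ} (hs : 0 ≤ s) (hτ : 0 ≤ τ) (hτT : τ ≤ T) {u₀ : L2} (hm : MeanZero u₀)
    {u v : ℝ → L2} (hu : IsSolution w s u₀ (Icc 0 τ) u) (hv : IsSolution w s u₀ (Icc 0 τ) v) :
    EqOn u v (Icc 0 τ) := by
  have hwc : ContinuousOn w (Icc 0 τ) := hw.cont.mono (Icc_subset_Icc_right hτT)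
  have h0 : (0 : ℝ) ∈ Icc 0 τ := left_mem_Icc.2 hτ
  intro t ht
  have := IsMild.unique hw hρ hτT (hu.isMild hwc hs hτ hm) (hv.isMild hwc hs hτ hm)
    ((hu.interaction_zero h0).trans (hv.interaction_zero h0).symm) ht
  refine ext_fourierCoeff fun n => ?_
  rw [fourierCoeff_eq_interaction w, fourierCoeff_eq_interaction w v, this]

/-! ### Nonlinear smoothing -/

theorem abs_rpow_le_weight {s : ℝ} (hs : 0 ≤ s) (n : ℤ) :
    |(n : ℝ)| ^ s ≤ (1 + (n : ℝ) ^ 2) ^ (s / 2) := by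
  have h : |(n : ℝ)| ^ s = ((n : ℝ) ^ 2) ^ (s / 2) := by
    rw [← sq_abs, ← Real.rpow_natCast, ← Real.rpow_mul (abs_nonneg _)]
    congr 1; push_cast; ring
  rw [h]
  exact Real.rpow_le_rpow (sq_nonneg _) (by linarith) (by linarith)

theorem weight_le_abs_rpow {s : ℝ} (hs : 0 ≤ s) {n : ℤ} (hn : n ≠ 0) :
    (1 + (n : ℝ) ^ 2) ^ (s / 2) ≤ 2 ^ (s / 2) * |(n : ℝ)| ^ s := by
  have h : |(n : ℝ)| ^ s = ((n : ℝ) ^ 2) ^ (s / 2) := by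
    rw [← sq_abs, ← Real.rpow_natCast, ← Real.rpow_mul (abs_nonneg _)]
    congr 1; push_cast; ring
  rw [h, ← Real.mul_rpow (by norm_num) (sq_nonneg _)]
  refine Real.rpow_le_rpow (by positivity) ?_ (by linarith)
  have h1 := one_le_abs_cast hn
  have h2 : 1 ≤ (n : ℝ) ^ 2 := by rw [← sq_abs]; nlinarith
  linarith

theorem sqSumLe_weight {s A : ℝ} (hs : 0 ≤ s) {z : ℤ → ℂ} (h0 : z 0 = 0)
    (h : SqSumLe (fun n => |(n : ℝ)| ^ s * ‖z n‖) A) :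
    SqSumLe (fun n => ‖(((1 + (n : ℝ) ^ 2) ^ (s / 2) : ℝ) : ℂ) * z n‖) (2 ^ (s / 2) * A) := by
  refine (h.const_mul (by positivity : (0 : ℝ) ≤ 2 ^ (s / 2))).mono fun n => ?_
  rw [abs_norm, norm_mul, Complex.norm_real, Real.norm_of_nonneg (by positivity),
    abs_of_nonneg (by positivity), ← mul_assoc]
  rcases eq_or_ne n 0 with rfl | hn
  · simp [h0]
  · exact mul_le_mul_of_nonneg_right (weight_le_abs_rpow hs hn) (norm_nonneg _)

/-- `u - U^w u₀ = U^w (v - v(0))`, and `v - v(0)` is Hölder continuous with values in `H^{s₀}`.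
Vanishing zero modes make homogeneous and inhomogeneous weights interchangeable. -/
theorem IsSolution.smoothing {ρ γ T C : ℝ} {w : ℝ → ℝ} (hw : PhaseDecay ρ γ T C w) {s s₀ τ : ℝ}
    (hs : 0 ≤ s) (hs₀ : s ≤ s₀) (hs₀ρ : s₀ < s + 2 * ρ - 5 / 2) (hτ : 0 ≤ τ) (hτT : τ ≤ T)
    {u₀ : L2} (hm : MeanZero u₀) {u : ℝ → L2} (hu : IsSolution w s u₀ (Icc 0 τ) u) :
    ContinuousInSobolev s₀ (Icc 0 τ) fun t => u t - airy (w t) u₀ := by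
  have hwc : ContinuousOn w (Icc 0 τ) := hw.cont.mono (Icc_subset_Icc_right hτT)
  have h0 : (0 : ℝ) ∈ Icc 0 τ := left_mem_Icc.2 hτ
  have hs₀0 : 0 ≤ s₀ := hs.trans hs₀
  set v := interaction w u with hv
  have hmild : IsMild w 0 τ v := hu.isMild hwc hs hτ hm
  have hv0 : v 0 = fourierBasis.repr u₀ := hu.interaction_zero h0
  obtain ⟨hmem, hcont⟩ := continuousInSobolev_iff.1 hu.1
  obtain ⟨A, hA⟩ := isCompact_Icc.exists_bound_of_continuousOn hcont
  have hvA : ∀ t ∈ Icc 0 τ, SqSumLe (fun n => |(n : ℝ)| ^ s * ‖v t n‖) A := fun t ht => by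
    refine (SeqL2.sqSumLe_of_norm_le (hA t ht)).mono fun n => ?_
    rw [abs_norm, (hmem t ht).weightSeq_apply, fourierCoeff_eq_interaction w, norm_mul, norm_mul,
      norm_airySymbol, one_mul, Complex.norm_real, Real.norm_of_nonneg (by positivity),
      abs_of_nonneg (by positivity)]
    exact mul_le_mul_of_nonneg_right (abs_rpow_le_weight hs n) (norm_nonneg _)
  obtain ⟨K, hK⟩ := hmild.exists_weighted_sub_le hw hs (σ := s₀ - s) (by linarith) (by linarith)
    hτT hvA
  have hKw : ∀ r t, 0 ≤ r → r ≤ t → t ≤ τ →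
      SqSumLe (fun n => ‖(((1 + (n : ℝ) ^ 2) ^ (s₀ / 2) : ℝ) : ℂ) * (v t n - v r n)‖)
        (2 ^ (s₀ / 2) * (K * (t - r) ^ γ)) := fun r t hr hrt ht => by
    refine sqSumLe_weight hs₀0 ?_ ?_
    · rw [hmild.zero t ⟨hr.trans hrt, ht⟩, hmild.zero r ⟨hr, hrt.trans ht⟩, sub_zero]
    · simpa using hK r t hr hrt ht
  set Z : ℝ → SeqL2 := fun t => weightSeq s₀ fun n => v t n - v 0 n with hZ
  have hZa : ∀ t ∈ Icc 0 τ, ∀ n,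
      Z t n = (((1 + (n : ℝ) ^ 2) ^ (s₀ / 2) : ℝ) : ℂ) * (v t n - v 0 n) := fun t ht n =>
    toSeq_apply_of_sqSumLe (hKw 0 t le_rfl ht.1 ht.2) n
  have hZc : ContinuousOn Z (Icc 0 τ) := by
    refine continuousOn_of_norm_sub_le (K := 2 ^ (s₀ / 2) * K) hw.pos fun r t hr hrt ht => ?_
    rw [mul_assoc]
    refine SeqL2.norm_le_of_sqSumLe ((hKw r t hr hrt ht).mono fun n => ?_)
    rw [abs_norm, abs_norm, lp.coeFn_sub, Pi.sub_apply, hZa t ⟨hr.trans hrt, ht⟩,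
      hZa r ⟨hr, hrt.trans ht⟩, ← mul_sub, sub_sub_sub_cancel_right]
  have hcoef : ∀ t n, fourierCoeff (u t - airy (w t) u₀ : L2) n =
      airySymbol (w t) n * (v t n - v 0 n) := fun t n => by
    rw [fourierCoeff_sub', fourierCoeff_airy, fourierCoeff_eq_interaction w, ← hv, hv0, repr_apply,
      mul_sub]
  have hmem' : ∀ t ∈ Icc 0 τ, MemSobolev s₀ (u t - airy (w t) u₀) := fun t ht => by
    rw [memSobolev_iff]
    refine SqSumLe.memℓp ((hKw 0 t le_rfl ht.1 ht.2).mono fun n => ?_)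
    rw [abs_norm, abs_norm, hcoef, mul_left_comm, norm_mul (airySymbol _ _), norm_airySymbol,
      one_mul]
  refine continuousInSobolev_iff.2 ⟨hmem', (continuousOn_airySeq hwc hZc).congr fun t ht => ?_⟩
  refine lp.ext (funext fun n => ?_)
  rw [(hmem' t ht).weightSeq_apply, hcoef, airySeq_apply, hZa t ht]
  ring

/-- Bootstrap: the Duhamel part gains regularity at each step, and the linear part is as regular as
the data. -/
theorem IsSolution.persistence {ρ γ T C : ℝ} {w : ℝ → ℝ} (hw : PhaseDecay ρ γ T C w)
    (hρ : 5 / 4 < ρ) {s τ : ℝ} (hs : 0 ≤ s) (hτ : 0 ≤ τ) (hτT : τ ≤ T) {u₀ : L2}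
    (hu₀ : MemSobolev s u₀) (hm : MeanZero u₀) {u : ℝ → L2}
    (hu : IsSolution w 0 u₀ (Icc 0 τ) u) : IsSolution w s u₀ (Icc 0 τ) u := by
  have hwc : ContinuousOn w (Icc 0 τ) := hw.cont.mono (Icc_subset_Icc_right hτT)
  have hδ : 0 < ρ - 5 / 4 := by linarith
  -- The increment `ρ - 5/4` is half of the excluded endpoint `2ρ - 5/2` of the gain, hence
  -- admissible.
  have key : ∀ k : ℕ, IsSolution w (min s (k * (ρ - 5 / 4))) u₀ (Icc 0 τ) u := by
    intro k
    induction k with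
    | zero => simpa [min_eq_right hs] using hu
    | succ k ih =>
      refine ⟨?_, hu.2⟩
      have h1 : min s ((k + 1 : ℕ) * (ρ - 5 / 4)) ≤ min s (k * (ρ - 5 / 4)) + (ρ - 5 / 4) := by
        rw [← min_add_add_right]
        exact min_le_min (by linarith) (by push_cast; linarith)
      have h2 := ih.smoothing hw (s₀ := min s ((k + 1 : ℕ) * (ρ - 5 / 4)))
        (le_min hs (by positivity)) (min_le_min_left _ (by push_cast; linarith)) (by linarith)
        hτ hτT hm
      have h3 := ContinuousInSobolev.airy hwc
        (continuousInSobolev_const (J := Icc 0 τ) (hu₀.mono (min_le_left s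
          ((k + 1 : ℕ) * (ρ - 5 / 4)))))
      simpa only [sub_add_cancel] using h2.add h3
  obtain ⟨k, hk⟩ := exists_nat_ge (s / (ρ - 5 / 4))
  have := key k
  rwa [min_eq_left ((div_le_iff₀ hδ).1 hk)] at this

theorem ContinuousInSobolev.mono_set {s : ℝ} {J J' : Set ℝ} {u : ℝ → L2}
    (h : ContinuousInSobolev s J u) (hJ : J' ⊆ J) : ContinuousInSobolev s J' u :=
  ⟨fun t ht => h.1 t (hJ ht), fun t ht => (h.2 t (hJ ht)).mono_left (nhdsWithin_mono t hJ)⟩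

theorem IsSolution.mono_set {w : ℝ → ℝ} {s : ℝ} {u₀ : L2} {J J' : Set ℝ} {u : ℝ → L2}
    (h : IsSolution w s u₀ J u) (hJ : J' ⊆ J) : IsSolution w s u₀ J' u :=
  ⟨h.1.mono_set hJ, fun t ht => h.2 t (hJ ht)⟩

theorem Icc_mem_nhdsWithin_Ici_zero (t : ℝ) : Icc 0 (t + 1) ∈ 𝓝[Ici 0] t := by
  have h : Iic (t + 1) ∈ 𝓝 t := Iic_mem_nhds (by linarith)
  rw [← Ici_inter_Iic]
  exact inter_mem_nhdsWithin _ h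

theorem isSolution_Ici_of_Icc {w : ℝ → ℝ} {s : ℝ} {u₀ : L2} {u : ℝ → L2}
    (h : ∀ τ, 0 < τ → IsSolution w s u₀ (Icc 0 τ) u) : IsSolution w s u₀ (Ici 0) u := by
  have h1 : ∀ t ∈ Ici (0 : ℝ), 0 < t + 1 ∧ t ∈ Icc 0 (t + 1) := fun t ht => by
    have : (0 : ℝ) ≤ t := ht
    exact ⟨by linarith, this, by linarith⟩
  refine ⟨⟨fun t ht => (h _ (h1 t ht).1).1.1 t (h1 t ht).2, fun t ht => ?_⟩,
    fun t ht => (h _ (h1 t ht).1).2 t (h1 t ht).2⟩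
  refine ((h _ (h1 t ht).1).1.2 t (h1 t ht).2).mono_left ?_
  exact nhdsWithin_le_of_mem (Icc_mem_nhdsWithin_Ici_zero t)

/-! ### Well-posedness -/

/-- The solution is constructed in `L²` and upgraded by persistence, so its lifespan depends on the
data only through the `L²` norm. -/
theorem PhaseDecay.unconditionallyLocallyWellPosed {ρ γ T C : ℝ} {w : ℝ → ℝ}
    (hw : PhaseDecay ρ γ T C w) (hρ : 5 / 4 < ρ) (hT : 0 < T) {s : ℝ} (hs : 0 ≤ s) :
    UnconditionallyLocallyWellPosed w T s := by
  intro u₀ hu₀ hm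
  refine ⟨?_, fun τ hτ hτT u v hu hv => hu.unique hw hρ hs hτ.le hτT hm hv⟩
  obtain ⟨h, hh, hex⟩ := hw.exists_isMild hρ ‖fourierBasis.repr u₀‖
  have hτ : 0 < min h T := lt_min hh hT
  have hτT : min h T ≤ T := min_le_right _ _
  obtain ⟨v, hv, hv0, hvr⟩ := hex 0 (min h T) le_rfl hτ.le hτT (by simp) (fourierBasis.repr u₀)
    le_rfl (by rw [repr_apply]; exact (meanZero_iff u₀).1 hm)
  refine ⟨min h T, hτ, hτT, ofInteraction w v, ?_, fun hr t ht => ?_⟩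
  · refine IsSolution.persistence hw hρ hs hτ.le hτT hu₀ hm (isSolution_ofInteraction
      (hw.cont.mono (Icc_subset_Icc_right hτT)) hv.cont fun t ht n => ?_)
    rw [hv.eq t ht n, hv0, repr_apply]
  · refine isRealValued_ofInteraction (hvr (fun n => ?_) t ht)
    rw [repr_apply, repr_apply]
    exact hr.isRealSeq n

theorem unconditionallyGloballyWellPosed_of_phaseDecay {ρ γ : ℝ} {w : ℝ → ℝ}
    (hw : ∀ T, 0 < T → ∃ C, PhaseDecay ρ γ T C w) (hρ : 5 / 4 < ρ) {s : ℝ} (hs : 0 ≤ s) :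
    UnconditionallyGloballyWellPosed w s := by
  intro u₀ hu₀ hm hr
  obtain ⟨v, hv0, hv⟩ := exists_isMild_halfLine hw hρ (x := fourierBasis.repr u₀)
    (by rw [repr_apply]; exact (meanZero_iff u₀).1 hm)
    (fun n => by rw [repr_apply, repr_apply]; exact hr.isRealSeq n)
  have hsol : ∀ τ, 0 < τ → IsSolution w s u₀ (Icc 0 τ) (ofInteraction w v) := fun τ hτ => by
    obtain ⟨C, hC⟩ := hw τ hτ
    obtain ⟨m, -⟩ := hv τ hτ.le
    refine IsSolution.persistence hC hρ hs hτ.le le_rfl hu₀ hm (isSolution_ofInteraction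
      hC.cont m.cont fun t ht n => ?_)
    rw [m.eq t ht n, hv0, repr_apply]
  refine ⟨ofInteraction w v, isSolution_Ici_of_Icc hsol, fun t ht => ?_, fun u hu t ht => ?_⟩
  · exact isRealValued_ofInteraction ((hv t ht).2 t ⟨ht, le_rfl⟩)
  · have ht0 : (0 : ℝ) ≤ t := ht
    have ht1 : 0 < t + 1 := by linarith
    obtain ⟨C, hC⟩ := hw (t + 1) ht1
    exact (hu.mono_set Icc_subset_Ici_self).unique hC hρ hs ht1.le le_rfl hm (hsol _ ht1)
      ⟨ht0, by linarith⟩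

end ModulatedKdV

end

theorem theorem1p1 (ρ γ T : ℝ) (hρ : 5 / 4 < ρ) (hγ : 1 / 2 < γ) (hγ' : γ < 1) (hT : 0 < T)
    (w : ℝ → ℝ) (hw₀ : w 0 = 0) (hw : IsIrregular ρ γ T w) :
    (∀ s : ℝ, 0 ≤ s →
      UnconditionallyLocallyWellPosed w T s ∧
        (IsIrregularOnHalfLine ρ γ w → UnconditionallyGloballyWellPosed w s)) ∧
    (∀ s s₀ : ℝ, 0 ≤ s → s < s₀ → s₀ < s + 2 * ρ - 5 / 2 →
      ∀ u₀ : L2, MemSobolev s u₀ → MeanZero u₀ →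
        ∀ τ : ℝ, 0 < τ → τ ≤ T → ∀ u : ℝ → L2, IsSolution w s u₀ (Icc 0 τ) u →
          ContinuousInSobolev s₀ (Icc 0 τ) (fun t => u t - airy (w t) u₀)) := by
  have hρ0 : 0 < ρ := by linarith
  have hγ0 : 0 < γ := by linarith
  obtain ⟨C, hC⟩ := hw.exists_phaseDecay hρ0 hγ0
  refine ⟨fun s hs => ⟨hC.unconditionallyLocallyWellPosed hρ hT hs, fun hhl => ?_⟩, ?_⟩
  · exact unconditionallyGloballyWellPosed_of_phaseDecay
      (fun T' hT' => (hhl T' hT').exists_phaseDecay hρ0 hγ0) hρ hs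
  · intro s s₀ hs hss₀ hs₀ u₀ _ hm τ hτ hτT u hu
    exact hu.smoothing hC hs hss₀.le hs₀ hτ.le hτT hm
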